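/- **Setting.** Let $V$ be a separable real Hilbert space and let $A$ be a densely defined linear operator on $V$ such that $-A$ is symmetric, strictly positive and has a compact inverse; let $(S(t))_{t\ge 0}$ be the (analytic) strongly continuous semigroup generated by $A$, and let $(e_i)$ be a complete orthonormal basis of $V$ consisting of eigenvectors of $-A$. Let $F:V\to V$ be continuous with $\|F(v)\|\le c_F+L_F\|v\|$ for some constants $c_F,L_F>0$, and let $G:V\to L_2(V)$ (the Hilbert–Schmidt operators on $V$) be Lipschitz continuous. Fix $$\tfrac12<\beta<\beta'<1,\qquad 1-\beta'<\alpha<\beta .$$ For $a<b$ put $\|f\|_{\beta',a,b}=\sup_{[a,b]}\|f\|+\sup_{a\le s<t\le b}\frac{\|f(t)-f(s)\|}{(t-s)^{\beta'}}$, the norm of $C^{\beta'}([a,b],V)$. Let $C^\beta_\beta([0,T],V)$ be the space of continuous $f:[0,T]\to V$ with finite norm $$\|f\|_{\beta,\beta,0,T}=\sup_{[0,T]}\|f\|+\sup_{0<s<t\le T}s^\beta\frac{\|f(t)-f(s)\|}{(t-s)^\beta}.$$ Let $\Omega=C^{0,\beta'}_0(\mathbb R,V)$ be the Fréchet space of continuous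 $\omega:\mathbb R\to V$ with $\omega(0)=0$ whose restriction to $[-n,n]$ lies, for every $n\in\mathbb N$, in the closure of $C^\infty([-n,n],V)$ in $C^{\beta'}([-n,n],V)$, with the topology generated by the norms $\|\cdot\|_{\beta',-n,n}$. The integral against $\omega$ is $$\int_s^t g\,d\omega=(-1)^\alpha\sum_j\Big(\sum_i\int_s^t D^\alpha_{s+}(e_j,g(\cdot)e_i)[r]\;D^{1-\alpha}_{t-}(e_i,\omega_{t-}(\cdot))[r]\,dr\Big)e_j ,\qquad \omega_{t-}=\omega-\omega(t),$$ where $$D^\alpha_{s+}g[r]=\frac1{\Gamma(1-\alpha)}\Big(\frac{g(r)}{(r-s)^\alpha}+\alpha\int_s^r\frac{g(r)-g(q)}{(r-q)^{1+\alpha}}dq\Big),$$ $$D^{1-\alpha}_{t-}\omega_{t-}[r]=\frac{(-1)^{1-\alpha}}{\Gamma(\alpha)}\Big(\frac{\omega(r)-\omega(t)}{(t-r)^{1-\alpha}}+(1-\alpha)\int_r^t\frac{\omega(r)-\omega(q)}{(q-r)^{2-\alpha}}dq\Big)$$ and $(-1)^\alpha(-1)^{1-\alpha}=-1$. For $u_0\in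 V$ and $\omega\in\Omega$ let $\mathcal F(u_0,\omega)$ be the set of all globally defined mild solutions of $du=(Au+F(u))dt+G(u)d\omega$, $u(0)=u_0$: functions $u:[0,\infty)\to V$ such that, for every $T>0$, $u|_{[0,T]}\in C^\beta_\beta([0,T],V)$ and $$u(t)=S(t)u_0+\int_0^tS(t-r)F(u(r))\,dr+\int_0^tS(t-r)G(u(r))\,d\omega(r),\qquad t\in[0,T].$$ Put $\Phi(t,\omega,u_0)=\{u(t):u\in\mathcal F(u_0,\omega)\}$ for $t\ge 0$. **Theorem.** 1. Let $u_0^n\to u_0$ in $V$, and let $\omega^n,\omega\in\Omega$ with $\omega^n\to\omega$ in $C^{\beta'}([0,T],V)$ for every $T>0$ (in particular, this holds if $\omega^n\to\omega$ in $\Omega$). Then for every sequence $u^n\in\mathcal F(u_0^n,\omega^n)$ there are a subsequence $u^{n_k}$ and a $u\in\mathcal F(u_0,\omega)$ such that $u^{n_k}\to u$ in $C^\beta_\beta([0,T],V)$ for every $T>0$. 2. Let $u_0^n\to u_0$ in $V$, let $\omega^n,\omega\in\Omega$ with $\omega^n\to\omega$ in $C^{\beta'}([0,T],V)$ for every $T>0$,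 let $t^n\to t_0$ in $[0,\infty)$ and let $y^n\in\Phi(t^n,\omega^n,u_0^n)$. Then a subsequence of $(y^n)$ converges in $V$ to some $y_0\in\Phi(t_0,\omega,u_0)$. 3. $\Phi$ is upper semicontinuous in all its variables: for all $(t_0,\omega_0,x_0)\in[0,\infty)\times\Omega\times V$ and every open set $O\subset V$ containing $\Phi(t_0,\omega_0,x_0)$ there is a neighbourhood of $(t_0,\omega_0,x_0)$ in $[0,\infty)\times\Omega\times V$ such that $\Phi(t,\omega,x)\subset O$ for all $(t,\omega,x)$ in it. -/

import Mathlib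

open Set Filter Topology MeasureTheory
open scoped NNReal ENNReal InnerProductSpace

noncomputable section

namespace RoughEvolution

section FunctionSpaces

variable {E : Type*} [NormedAddCommGroup E]

/-- The norm of `C([a, b], E)`, as an extended nonnegative real. -/
def supNorm (a b : ℝ) (f : ℝ → E) : ℝ≥0∞ :=
  ⨆ s ∈ Icc a b, ‖f s‖ₑ

/-- The Hölder seminorm `sup_{a ≤ s < t ≤ b} ‖f t - f s‖ / (t - s) ^ γ`. -/
def holderSeminorm (γ a b : ℝ) (f : ℝ → E) : ℝ≥0∞ :=
  ⨆ (s : ℝ) (t : ℝ) (_ : a ≤ s ∧ s < t ∧ t ≤ b),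
    ENNReal.ofReal (‖f t - f s‖ / (t - s) ^ γ)

/-- The norm of `C^γ([a, b], E)`. It is finite exactly on the `γ`-Hölder functions. -/
def holderNorm (γ a b : ℝ) (f : ℝ → E) : ℝ≥0∞ :=
  supNorm a b f + holderSeminorm γ a b f

/-- The seminorm `sup_{a < s < t ≤ b} (s - a) ^ β * ‖f t - f s‖ / (t - s) ^ β`. -/
def weightedHolderSeminorm (β a b : ℝ) (f : ℝ → E) : ℝ≥0∞ :=
  ⨆ (s : ℝ) (t : ℝ) (_ : a < s ∧ s < t ∧ t ≤ b),
    ENNReal.ofReal ((s - a) ^ β * (‖f t - f s‖ / (t - s) ^ β))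

/-- The norm of `C^β_β([a, b], E)`. -/
def weightedHolderNorm (β a b : ℝ) (f : ℝ → E) : ℝ≥0∞ :=
  supNorm a b f + weightedHolderSeminorm β a b f

/-- Membership in `C^β_β([a, b], E)` (only the values of `f` on `[a, b]` matter). -/
def MemWeightedHolder (β a b : ℝ) (f : ℝ → E) : Prop :=
  ContinuousOn f (Icc a b) ∧ weightedHolderNorm β a b f < ⊤

/-- Membership in `C^{0,γ}([a, b], E)`, the closure of `C^∞([a, b], E)` in `C^γ([a, b], E)`. -/
def MemLittleHolder [NormedSpace ℝ E] (γ a b : ℝ) (f : ℝ → E) : Prop :=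
  holderNorm γ a b f < ⊤ ∧
    ∀ ε : ℝ, 0 < ε → ∃ φ : ℝ → E, ContDiffOn ℝ ((⊤ : ℕ∞) : WithTop ℕ∞) φ (Icc a b) ∧
      holderNorm γ a b (fun s => f s - φ s) < ENNReal.ofReal ε

/-- The space `C_0^{0,γ}(ℝ, E)`: continuous paths on `ℝ`, zero at zero, whose restriction to
`[-n, n]` belongs to `C^{0,γ}([-n, n], E)` for every `n`. Its Fréchet topology is generated by
the norms `holderNorm γ (-n) n`. -/
def pathSpace (E : Type*) [NormedAddCommGroup E] [NormedSpace ℝ E] (γ : ℝ) : Set (ℝ → E) :=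
  {ω | Continuous ω ∧ ω 0 = 0 ∧ ∀ n : ℕ, MemLittleHolder γ (-(n : ℝ)) n ω}

end FunctionSpaces

section FractionalDerivatives

/-- The left sided fractional derivative `D_{s+}^α g [r]` of order `α` of a scalar function. -/
def leftFracDeriv (α s : ℝ) (g : ℝ → ℝ) (r : ℝ) : ℝ :=
  (Real.Gamma (1 - α))⁻¹ *
    (g r / (r - s) ^ α + α * ∫ q in s..r, (g r - g q) / (r - q) ^ (1 + α))

/-- The right sided fractional derivative of order `a`, without its phase:
`D_{t-}^a w [r] = (-1) ^ a * rightFracDeriv a t w r`. -/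
def rightFracDeriv (a t : ℝ) (w : ℝ → ℝ) (r : ℝ) : ℝ :=
  (Real.Gamma (1 - a))⁻¹ *
    (w r / (t - r) ^ a + a * ∫ q in r..t, (w r - w q) / (q - r) ^ (1 + a))

end FractionalDerivatives

variable {V : Type*} [NormedAddCommGroup V] [InnerProductSpace ℝ V] {ι : Type*}

/-- The integral
`∫_s^t g dω = (-1)^α ∑_j (∑_i ∫_s^t D_{s+}^α (e_j, g e_i) [r] D_{t-}^{1-α} (e_i, ω_{t-}) [r] dr) e_j`
with `ω_{t-} = ω - ω(t)`. The product of the phases, `(-1)^α * (-1)^(1-α) = -1`, is the factor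
`-1` below. -/
def pathIntegral (e : HilbertBasis ι ℝ V) (α s t : ℝ) (g : ℝ → V →L[ℝ] V) (ω : ℝ → V) : V :=
  ∑' j, ((-1 : ℝ) * ∑' i, ∫ r in s..t,
    leftFracDeriv α s (fun q => ⟪e j, g q (e i)⟫_ℝ) r *
      rightFracDeriv (1 - α) t (fun q => ⟪e i, ω q - ω t⟫_ℝ) r) • e j

/-- Hilbert-Schmidt operators on `V` (the condition does not depend on the basis). -/
def IsHilbertSchmidt (e : HilbertBasis ι ℝ V) (T : V →L[ℝ] V) : Prop :=
  Summable fun i => ‖T (e i)‖ ^ 2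

/-- The Hilbert-Schmidt norm (which does not depend on the basis). -/
def hilbertSchmidtNorm (e : HilbertBasis ι ℝ V) (T : V →L[ℝ] V) : ℝ :=
  Real.sqrt (∑' i, ‖T (e i)‖ ^ 2)

/-- A densely defined, symmetric and strictly positive operator with a compact inverse. -/
structure IsPositiveWithCompactInverse (B : V →ₗ.[ℝ] V) : Prop where
  dense_domain : Dense (B.domain : Set V)
  symmetric : ∀ x y : B.domain, ⟪B x, (y : V)⟫_ℝ = ⟪(x : V), B y⟫_ℝ
  pos : ∀ x : B.domain, (x : V) ≠ 0 → 0 < ⟪B x, (x : V)⟫_ℝ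
  exists_inverse : ∃ K : V →L[ℝ] V, IsCompactOperator K ∧
    (∀ y : V, (K y, y) ∈ B.graph) ∧ ∀ x : B.domain, K (B x) = x

/-- `(S t)_{t ≥ 0}` is the strongly continuous semigroup generated by `A`: the domain of `A`
consists of those `x` for which `(S t x - x) / t` converges as `t ↓ 0`, and `A x` is the limit. -/
structure IsSemigroupGeneratedBy (A : V →ₗ.[ℝ] V) (S : ℝ → V →L[ℝ] V) : Prop where
  zero : S 0 = ContinuousLinearMap.id ℝ V
  add : ∀ s t : ℝ, 0 ≤ s → 0 ≤ t → S (s + t) = (S s).comp (S t)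
  strong_cont : ∀ x : V, Tendsto (fun t => S t x) (𝓝[>] 0) (𝓝 x)
  generator : ∀ x y : V, (x, y) ∈ A.graph ↔
    Tendsto (fun t : ℝ => t⁻¹ • (S t x - x)) (𝓝[>] 0) (𝓝 y)

/-- Mild pathwise solutions on `[0, T]` of `du = (A u + F u) dt + G u dω`, `u 0 = u₀`, where
`S` is the semigroup generated by `A`. -/
def IsMildSolution (S : ℝ → V →L[ℝ] V) (e : HilbertBasis ι ℝ V) (F : V → V)
    (G : V → V →L[ℝ] V) (α β T : ℝ) (ω : ℝ → V) (u₀ : V) (u : ℝ → V) : Prop :=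
  MemWeightedHolder β 0 T u ∧ ∀ t ∈ Icc 0 T,
    u t = S t u₀ + (∫ r in (0 : ℝ)..t, S (t - r) (F (u r))) +
      pathIntegral e α 0 t (fun r => (S (t - r)).comp (G (u r))) ω

/-- The set `𝓕(u₀, ω)` of globally defined mild solutions. A solution is a function on `[0, ∞)`;
its values at negative times are irrelevant. -/
def globalSolutions (S : ℝ → V →L[ℝ] V) (e : HilbertBasis ι ℝ V) (F : V → V)
    (G : V → V →L[ℝ] V) (α β : ℝ) (u₀ : V) (ω : ℝ → V) : Set (ℝ → V) :=
  {u | ∀ T : ℝ, 0 < T → IsMildSolution S e F G α β T ω u₀ u}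

/-- The multivalued map `Φ(t, ω, u₀) = {u(t) : u ∈ 𝓕(u₀, ω)}`. -/
def solutionMap (S : ℝ → V →L[ℝ] V) (e : HilbertBasis ι ℝ V) (F : V → V)
    (G : V → V →L[ℝ] V) (α β : ℝ) (t : ℝ≥0) (ω : ℝ → V) (u₀ : V) : Set V :=
  {y | ∃ u ∈ globalSolutions S e F G α β u₀ ω, u t = y}

end RoughEvolution

end

open Set Filter Topology MeasureTheory
open scoped NNReal ENNReal InnerProductSpace

noncomputable section

namespace RoughEvolution

/-! ### Integrals over intervals with power singularities at the end points -/

section Kernels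

variable {X : Type*} [NormedAddCommGroup X]

/-! The proof lives off a small exponent δ left over by the strict inequalities between α, β and β'.
Write a solution as u = S(·)u₀ + v, where v collects the two convolutions with the semigroup. The
integral against ω is rewritten as a Bochner integral of the left derivative of S(t-·)G(u), an
operator, applied to the right derivative of ω - ω(t). The first factor is controlled by the
weighted Hölder bounds of u and the smoothing of S, the second by the β'-Hölder constant of ω, and
the singularities at the two end points combine to a Beta integral. The outcome
(`exists_convBound_youngConv`, `exists_convBound_detConv`) is that v is better than u by δ: it
vanishes like t^δ at zero, its increments weighted by s^β are of order (t-s)^(β+δ), and s^β‖S(h)v(s)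
- v(s)‖ is of order h^(β+δ).

Measured with the exponential weight e^(ρt), these bounds carry a factor ρ^(-δ). Since F grows
linearly and G is Lipschitz, the right side is affine in the norm of u, and for large ρ its linear
part is absorbed. Hence solutions are bounded uniformly over bounded initial values and bounded
Hölder constants of the paths (`exists_apriori_bound`).

For h > 0 the operator S(h) is compact, so the third property makes the values v^n(t) relatively
compact; with equicontinuity, Arzelà–Ascoli yields a locally uniformly convergent subsequence
(`exists_subseq_tendsto_of_convBound`). The uniform bounds justify dominated convergence in both
convolutions, so the limit solves the limit equation. Interpolating uniform convergence against the
surplus δ gives convergence of v^n in C^β_β, and S(·)(u₀^n - u₀) is estimated directly. The second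
claim evaluates the convergent solutions at t^n, and the third follows from the second by
contradiction. -/

theorem ae_mem_Ioo_of_mem_Ioc (a b : ℝ) : ∀ᵐ x : ℝ, x ∈ Ioc a b → x ∈ Ioo a b := by
  have h : ∀ᵐ x : ℝ, x ≠ b := by simp [ae_iff]
  filter_upwards [h] with x hx hx'
  exact ⟨hx'.1, lt_of_le_of_ne hx'.2 hx⟩

theorem intervalIntegrable_of_Ioo {a b : ℝ} (hab : a ≤ b) {f : ℝ → X} {g : ℝ → ℝ}
    (hf : AEStronglyMeasurable f (volume.restrict (Ioo a b)))
    (h : ∀ x ∈ Ioo a b, ‖f x‖ ≤ g x) (hg : IntervalIntegrable g volume a b) :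
    IntervalIntegrable f volume a b := by
  rw [intervalIntegrable_iff_integrableOn_Ioo_of_le hab] at hg ⊢
  exact Integrable.mono' hg hf ((ae_restrict_iff' measurableSet_Ioo).2 (ae_of_all _ h))

variable [NormedSpace ℝ X]

theorem norm_integral_le_of_Ioo {a b : ℝ} (hab : a ≤ b) {f : ℝ → X} {g : ℝ → ℝ}
    (h : ∀ x ∈ Ioo a b, ‖f x‖ ≤ g x) (hg : IntervalIntegrable g volume a b) :
    ‖∫ x in a..b, f x‖ ≤ ∫ x in a..b, g x := by
  refine intervalIntegral.norm_integral_le_of_norm_le hab ?_ hg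
  filter_upwards [ae_mem_Ioo_of_mem_Ioc a b] with x hx hx'
  exact h x (hx hx')

theorem integral_congr_Ioo {a b : ℝ} (hab : a ≤ b) {f g : ℝ → X}
    (h : ∀ x ∈ Ioo a b, f x = g x) : ∫ x in a..b, f x = ∫ x in a..b, g x := by
  refine intervalIntegral.integral_congr_ae ?_
  filter_upwards [ae_mem_Ioo_of_mem_Ioc a b] with x hx hx'
  rw [uIoc_of_le hab] at hx'
  exact h x (hx hx')

/-- The value of the Beta function. -/
def betaConst (a b : ℝ) : ℝ := ∫ x in (0 : ℝ)..1, x ^ (a - 1) * (1 - x) ^ (b - 1)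

theorem betaConst_nonneg (a b : ℝ) : 0 ≤ betaConst a b := by
  refine intervalIntegral.integral_nonneg zero_le_one fun x hx => ?_
  exact mul_nonneg (Real.rpow_nonneg hx.1 _) (Real.rpow_nonneg (by linarith [hx.2]) _)

theorem intervalIntegrable_beta_one {a b : ℝ} (ha : 0 < a) (hb : 0 < b) :
    IntervalIntegrable (fun x : ℝ => x ^ (a - 1) * (1 - x) ^ (b - 1)) volume 0 1 := by
  have h := (Complex.betaIntegral_convergent (u := a) (v := b) (by simpa) (by simpa)).norm
  rw [intervalIntegrable_iff_integrableOn_Ioo_of_le zero_le_one] at h ⊢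
  refine h.congr_fun (fun x hx => ?_) measurableSet_Ioo
  have h1 : (1 - (x : ℂ)) = ((1 - x : ℝ) : ℂ) := by push_cast; rfl
  simp only [norm_mul]
  rw [h1, Complex.norm_cpow_eq_rpow_re_of_pos hx.1,
    Complex.norm_cpow_eq_rpow_re_of_pos (by linarith [hx.2])]
  simp

theorem beta_kernel_scale {a b r q : ℝ} (hr : 0 < r) (hq : q ∈ Ioo 0 r) :
    q ^ (a - 1) * (r - q) ^ (b - 1) =
      r ^ (a + b - 2) * ((q / r) ^ (a - 1) * (1 - q / r) ^ (b - 1)) := by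
  have h1 : 1 - q / r = (r - q) / r := by field_simp
  rw [h1, Real.div_rpow hq.1.le hr.le, Real.div_rpow (by linarith [hq.2]) hr.le,
    show a + b - 2 = (a - 1) + (b - 1) by ring, Real.rpow_add hr]
  have := (Real.rpow_pos_of_pos hr (a - 1)).ne'
  have := (Real.rpow_pos_of_pos hr (b - 1)).ne'
  field_simp

theorem intervalIntegrable_beta {a b r : ℝ} (ha : 0 < a) (hb : 0 < b) (hr : 0 ≤ r) :
    IntervalIntegrable (fun q : ℝ => q ^ (a - 1) * (r - q) ^ (b - 1)) volume 0 r := by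
  rcases hr.eq_or_lt with rfl | hr'
  · exact IntervalIntegrable.refl
  have h := ((intervalIntegrable_beta_one ha hb).comp_mul_left (c := r⁻¹)).const_mul
    (r ^ (a + b - 2))
  have e1 : (0 : ℝ) / r⁻¹ = 0 := by simp
  have e2 : (1 : ℝ) / r⁻¹ = r := by simp
  rw [e1, e2] at h
  rw [intervalIntegrable_iff_integrableOn_Ioo_of_le hr] at h ⊢
  refine h.congr_fun (fun q hq => ?_) measurableSet_Ioo
  simp only
  rw [beta_kernel_scale hr' hq, inv_mul_eq_div]

theorem integral_beta {a b r : ℝ} (hr : 0 < r) :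
    ∫ q in (0 : ℝ)..r, q ^ (a - 1) * (r - q) ^ (b - 1) = betaConst a b * r ^ (a + b - 1) := by
  rw [integral_congr_Ioo hr.le (fun q hq => beta_kernel_scale hr hq),
    intervalIntegral.integral_const_mul,
    intervalIntegral.integral_comp_div (fun x => x ^ (a - 1) * (1 - x) ^ (b - 1)) hr.ne',
    zero_div, div_self hr.ne', smul_eq_mul, betaConst,
    show a + b - 1 = (a + b - 2) + 1 by ring, Real.rpow_add_one hr.ne']
  ring

/-- Every integral with singularities at both end points is estimated in this form. No measurability
of f is needed, because only the majorant has to be integrable. -/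
theorem norm_integral_le_beta {a b r K : ℝ} (ha : 0 < a) (hb : 0 < b) (hr : 0 ≤ r) (hK : 0 ≤ K)
    {f : ℝ → X} (h : ∀ q ∈ Ioo 0 r, ‖f q‖ ≤ K * (q ^ (a - 1) * (r - q) ^ (b - 1))) :
    ‖∫ q in (0 : ℝ)..r, f q‖ ≤ K * betaConst a b * r ^ (a + b - 1) := by
  rcases hr.eq_or_lt with rfl | hr'
  · simp only [intervalIntegral.integral_same, norm_zero]
    exact mul_nonneg (mul_nonneg hK (betaConst_nonneg a b)) (Real.rpow_nonneg le_rfl _)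
  · refine (norm_integral_le_of_Ioo hr h ((intervalIntegrable_beta ha hb hr).const_mul K)).trans ?_
    rw [intervalIntegral.integral_const_mul, integral_beta hr', mul_assoc]

theorem intervalIntegrable_sub_rpow {b s t : ℝ} (hb : 0 < b) :
    IntervalIntegrable (fun q : ℝ => (t - q) ^ (b - 1)) volume s t := by
  have h := (intervalIntegral.intervalIntegrable_rpow' (a := t - s) (b := 0)
    (r := b - 1) (by linarith)).comp_sub_left t
  simpa using h

theorem norm_integral_le_sub_rpow {b s t K : ℝ} (hb : 0 < b) (hst : s ≤ t)
    {f : ℝ → X} (h : ∀ q ∈ Ioo s t, ‖f q‖ ≤ K * (t - q) ^ (b - 1)) :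
    ‖∫ q in s..t, f q‖ ≤ K * ((t - s) ^ b / b) := by
  refine (norm_integral_le_of_Ioo hst h ((intervalIntegrable_sub_rpow hb).const_mul K)).trans ?_
  rw [intervalIntegral.integral_const_mul,
    intervalIntegral.integral_comp_sub_left (fun x => x ^ (b - 1)) t,
    integral_rpow (Or.inl (by linarith))]
  simp [Real.zero_rpow hb.ne']

end Kernels

/-! ### Fractional derivatives of vector valued functions -/

/-- Surplus positive powers are repeatedly traded for the constant T, which is why T ≥ 1 and
exponent gaps of at most one appear throughout. -/
theorem rpow_le_of_le_one {x T y : ℝ} (hx : 0 ≤ x) (hxT : x ≤ T) (hT : 1 ≤ T) (hy : 0 ≤ y)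
    (hy1 : y ≤ 1) : x ^ y ≤ T :=
  calc x ^ y ≤ T ^ y := Real.rpow_le_rpow hx hxT hy
    _ ≤ T ^ (1 : ℝ) := Real.rpow_le_rpow_of_exponent_le hT hy1
    _ = T := Real.rpow_one T

section VectorFracDeriv

variable {X : Type*} [NormedAddCommGroup X]

/-- A pointwise Hölder type bound which controls the left sided fractional derivative at `r`. -/
def LeftBound (α β δ A : ℝ) (g : ℝ → X) (r : ℝ) : Prop :=
  ‖g r‖ ≤ A ∧ ∀ q ∈ Ioo 0 r, ‖g r - g q‖ ≤ A * (q ^ (-β) * (r - q) ^ (α + δ))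

/-- `w` is Hölder continuous on `[0, T]` with constant `W`. -/
def HolderBound (γ T W : ℝ) (w : ℝ → X) : Prop :=
  ∀ s t : ℝ, 0 ≤ s → s ≤ t → t ≤ T → ‖w t - w s‖ ≤ W * (t - s) ^ γ

theorem HolderBound.norm_sub_le {γ T W : ℝ} {w : ℝ → X} (h : HolderBound γ T W w)
    {s t : ℝ} (hs : 0 ≤ s) (hst : s ≤ t) (ht : t ≤ T) : ‖w s - w t‖ ≤ W * (t - s) ^ γ := by
  rw [norm_sub_rev]; exact h s t hs hst ht

theorem HolderBound.mono {γ T W T' W' : ℝ} {w : ℝ → X} (h : HolderBound γ T W w) (hT : T' ≤ T)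
    (hW : W ≤ W') : HolderBound γ T' W' w := fun s t hs hst ht =>
  (h s t hs hst (ht.trans hT)).trans
    (mul_le_mul_of_nonneg_right hW (Real.rpow_nonneg (sub_nonneg.2 hst) _))

variable [NormedSpace ℝ X]

/-- The left sided fractional derivative with base point `0` of a vector valued function. -/
def leftD (α : ℝ) (g : ℝ → X) (r : ℝ) : X :=
  (Real.Gamma (1 - α))⁻¹ •
    ((r ^ α)⁻¹ • g r + α • ∫ q in (0 : ℝ)..r, ((r - q) ^ (1 + α))⁻¹ • (g r - g q))

/-- The right sided fractional derivative, without phase, of a vector valued function. -/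
def rightD (a t : ℝ) (w : ℝ → X) (r : ℝ) : X :=
  (Real.Gamma (1 - a))⁻¹ •
    (((t - r) ^ a)⁻¹ • w r + a • ∫ q in r..t, ((q - r) ^ (1 + a))⁻¹ • (w r - w q))

/-- The right sided fractional derivative of `w - w t`. -/
def pathD (α t : ℝ) (w : ℝ → X) (r : ℝ) : X := rightD (1 - α) t (fun q => w q - w t) r

theorem leftD_integrand_le {α β δ A : ℝ} {g : ℝ → X} {r : ℝ}
    (h : LeftBound α β δ A g r) {q : ℝ} (hq : q ∈ Ioo 0 r) :
    ‖((r - q) ^ (1 + α))⁻¹ • (g r - g q)‖ ≤ A * (q ^ ((1 - β) - 1) * (r - q) ^ (δ - 1)) := by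
  have h0 : 0 < r - q := by linarith [hq.2]
  rw [norm_smul, norm_inv, Real.norm_of_nonneg (Real.rpow_nonneg h0.le _), ← Real.rpow_neg h0.le]
  calc (r - q) ^ (-(1 + α)) * ‖g r - g q‖
      ≤ (r - q) ^ (-(1 + α)) * (A * (q ^ (-β) * (r - q) ^ (α + δ))) :=
        mul_le_mul_of_nonneg_left (h.2 q hq) (Real.rpow_nonneg h0.le _)
    _ = A * (q ^ (-β) * ((r - q) ^ (-(1 + α)) * (r - q) ^ (α + δ))) := by ring
    _ = _ := by rw [← Real.rpow_add h0]; congr 3 <;> ring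

/-- The constant in `norm_leftD_le`. -/
def leftConst (α β δ T : ℝ) : ℝ := |(Real.Gamma (1 - α))⁻¹| * (T + α * betaConst (1 - β) δ * T)

theorem leftConst_nonneg {α β δ T : ℝ} (hα : 0 ≤ α) (hT : 0 ≤ T) : 0 ≤ leftConst α β δ T :=
  mul_nonneg (abs_nonneg _) (add_nonneg hT (mul_nonneg (mul_nonneg hα (betaConst_nonneg _ _)) hT))

/-- Both terms are of order r^(-β). The boundary term r^(-α) is, because α ≤ β; the integral is a
Beta integral of size r^(δ-β). -/
theorem norm_leftD_le {α β δ A T : ℝ} {g : ℝ → X} {r : ℝ} (hα : 0 < α) (hαβ : α ≤ β)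
    (hβ : β < 1) (hδ : 0 < δ) (hδ1 : δ ≤ 1) (hr : 0 < r) (hrT : r ≤ T) (hT : 1 ≤ T)
    (h : LeftBound α β δ A g r) :
    ‖leftD α g r‖ ≤ leftConst α β δ T * (A * r ^ (-β)) := by
  have hA : 0 ≤ A := (norm_nonneg _).trans h.1
  have hrβ : 0 ≤ r ^ (-β) := Real.rpow_nonneg hr.le _
  rw [leftD, norm_smul, leftConst, mul_assoc, Real.norm_eq_abs]
  refine mul_le_mul_of_nonneg_left ((norm_add_le _ _).trans ?_) (abs_nonneg _)
  have h1 : ‖(r ^ α)⁻¹ • g r‖ ≤ T * (A * r ^ (-β)) := by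
    rw [norm_smul, norm_inv, Real.norm_of_nonneg (Real.rpow_nonneg hr.le _), ← Real.rpow_neg hr.le,
      show -α = (β - α) + -β by ring, Real.rpow_add hr]
    have := rpow_le_of_le_one hr.le hrT hT (sub_nonneg.2 hαβ) (by linarith)
    calc _ ≤ T * r ^ (-β) * A := by
          gcongr
          exact h.1
      _ = _ := by ring
  have h2 : ‖α • ∫ q in (0 : ℝ)..r, ((r - q) ^ (1 + α))⁻¹ • (g r - g q)‖ ≤
      α * betaConst (1 - β) δ * T * (A * r ^ (-β)) := by
    rw [norm_smul, Real.norm_of_nonneg hα.le]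
    have := norm_integral_le_beta (by linarith : 0 < 1 - β) hδ hr.le hA
      (fun q hq => leftD_integrand_le h hq)
    rw [show 1 - β + δ - 1 = δ + -β by ring, Real.rpow_add hr] at this
    have h3 := rpow_le_of_le_one hr.le hrT hT hδ.le hδ1
    have hB := betaConst_nonneg (1 - β) δ
    calc _ ≤ α * (A * betaConst (1 - β) δ * (T * r ^ (-β))) := by
          refine mul_le_mul_of_nonneg_left (this.trans ?_) hα.le
          gcongr
      _ = _ := by ring
  calc _ ≤ _ := add_le_add h1 h2
    _ = _ := by ring

theorem intervalIntegrable_leftD_integrand {α β δ A t : ℝ} {g : ℝ → X} {r : ℝ}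
    (hβ : β < 1) (hδ : 0 < δ) (hg : ContinuousOn g (Ioo 0 t)) (hr : r ∈ Ioo 0 t)
    (h : LeftBound α β δ A g r) :
    IntervalIntegrable (fun q => ((r - q) ^ (1 + α))⁻¹ • (g r - g q)) volume 0 r := by
  refine intervalIntegrable_of_Ioo hr.1.le ?_ (fun q hq => leftD_integrand_le h hq)
    ((intervalIntegrable_beta (by linarith) hδ hr.1.le).const_mul A)
  refine ContinuousOn.aestronglyMeasurable ?_ measurableSet_Ioo
  refine ContinuousOn.smul (ContinuousOn.inv₀ (ContinuousOn.rpow_const (by fun_prop) ?_) ?_)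
    (continuousOn_const.sub (hg.mono (Ioo_subset_Ioo_right hr.2.le)))
  · exact fun q hq => Or.inl (by linarith [hq.2])
  · exact fun q hq => (Real.rpow_pos_of_pos (by linarith [hq.2]) _).ne'

theorem rightD_integrand_le {α γ T W t r : ℝ} {w : ℝ → X} (h : HolderBound γ T W w)
    (hr : 0 ≤ r) (ht : t ≤ T) {q : ℝ} (hq : q ∈ Ioo r t) :
    ‖((q - r) ^ (1 + (1 - α)))⁻¹ • (w r - w q)‖ ≤ W * (q - r) ^ ((γ + α - 1) - 1) := by
  have h0 : 0 < q - r := by linarith [hq.1]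
  rw [norm_smul, norm_inv, Real.norm_of_nonneg (Real.rpow_nonneg h0.le _), ← Real.rpow_neg h0.le]
  calc _ ≤ (q - r) ^ (-(1 + (1 - α))) * (W * (q - r) ^ γ) :=
        mul_le_mul_of_nonneg_left (h.norm_sub_le hr hq.1.le (hq.2.le.trans ht))
          (Real.rpow_nonneg h0.le _)
    _ = W * ((q - r) ^ (-(1 + (1 - α))) * (q - r) ^ γ) := by ring
    _ = _ := by rw [← Real.rpow_add h0]; congr 2; ring

theorem intervalIntegrable_rpow_sub {b s t : ℝ} (hb : 0 < b) (c : ℝ) :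
    IntervalIntegrable (fun q : ℝ => (q - c) ^ (b - 1)) volume s t := by
  have h := (intervalIntegral.intervalIntegrable_rpow' (a := s - c) (b := t - c)
    (r := b - 1) (by linarith)).comp_sub_right c
  simpa using h

theorem intervalIntegrable_rightD_integrand {α γ T W t r s : ℝ} {w : ℝ → X}
    (hγ : 1 - α < γ) (hw : Continuous w) (h : HolderBound γ T W w)
    (hr : 0 ≤ r) (hrs : r ≤ s) (hst : s ≤ t) (ht : t ≤ T) :
    IntervalIntegrable (fun q => ((q - r) ^ (1 + (1 - α)))⁻¹ • (w r - w q)) volume s t := by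
  refine intervalIntegrable_of_Ioo hst ?_
    (fun q hq => rightD_integrand_le h hr ht ⟨hrs.trans_lt hq.1, hq.2⟩)
    ((intervalIntegrable_rpow_sub (by linarith) r).const_mul W)
  refine ContinuousOn.aestronglyMeasurable ?_ measurableSet_Ioo
  refine ContinuousOn.smul (ContinuousOn.inv₀ (ContinuousOn.rpow_const (by fun_prop) ?_) ?_)
    (by fun_prop)
  · exact fun q hq => Or.inl (by linarith [hq.1])
  · exact fun q hq => (Real.rpow_pos_of_pos (by linarith [hq.1]) _).ne'

/-- The constant in `norm_pathD_le`. -/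
def rightConst (α γ : ℝ) : ℝ := |(Real.Gamma α)⁻¹| * (1 + (1 - α) / (γ + α - 1))

theorem rightConst_nonneg {α γ : ℝ} (hα : α ≤ 1) (hγ : 1 - α < γ) : 0 ≤ rightConst α γ :=
  mul_nonneg (abs_nonneg _) (add_nonneg zero_le_one (div_nonneg (by linarith) (by linarith)))

theorem integral_rpow_sub {b c s t : ℝ} (hb : 0 < b) :
    ∫ q in s..t, (q - c) ^ (b - 1) = ((t - c) ^ b - (s - c) ^ b) / b := by
  rw [intervalIntegral.integral_comp_sub_right (fun x => x ^ (b - 1)) c,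
    integral_rpow (Or.inl (by linarith))]
  simp

/-- Each difference of w supplies γ powers of the distance, against the 1 - α powers of the boundary
term and the 2 - α powers under the integral. The condition 1 - α < γ makes the integral converge at
q = r. -/
theorem norm_pathD_le {α γ T W t r : ℝ} {w : ℝ → X} (hα : α ≤ 1) (hγ : 1 - α < γ)
    (h : HolderBound γ T W w) (hr : 0 ≤ r) (hrt : r < t) (ht : t ≤ T) :
    ‖pathD α t w r‖ ≤ rightConst α γ * (W * (t - r) ^ (γ + α - 1)) := by
  have h0 : 0 < t - r := by linarith
  have hb : 0 < γ + α - 1 := by linarith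
  rw [pathD, rightD, norm_smul, rightConst, mul_assoc, Real.norm_eq_abs, sub_sub_cancel]
  refine mul_le_mul_of_nonneg_left ((norm_add_le _ _).trans ?_) (abs_nonneg _)
  have h1 : ‖((t - r) ^ (1 - α))⁻¹ • (w r - w t)‖ ≤ W * (t - r) ^ (γ + α - 1) := by
    rw [norm_smul, norm_inv, Real.norm_of_nonneg (Real.rpow_nonneg h0.le _),
      ← Real.rpow_neg h0.le]
    calc _ ≤ (t - r) ^ (-(1 - α)) * (W * (t - r) ^ γ) :=
          mul_le_mul_of_nonneg_left (h.norm_sub_le hr hrt.le ht) (Real.rpow_nonneg h0.le _)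
      _ = W * ((t - r) ^ (-(1 - α)) * (t - r) ^ γ) := by ring
      _ = _ := by rw [← Real.rpow_add h0]; congr 2; ring
  have h2 : ‖(1 - α) • ∫ q in r..t, ((q - r) ^ (1 + (1 - α)))⁻¹ • ((w r - w t) - (w q - w t))‖ ≤
      (1 - α) / (γ + α - 1) * (W * (t - r) ^ (γ + α - 1)) := by
    simp only [sub_sub_sub_cancel_right]
    rw [norm_smul, Real.norm_of_nonneg (by linarith)]
    have := norm_integral_le_of_Ioo hrt.le (fun q hq => rightD_integrand_le (α := α) h hr ht hq)
      ((intervalIntegrable_rpow_sub hb r).const_mul W)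
    rw [intervalIntegral.integral_const_mul, integral_rpow_sub hb, sub_self,
      Real.zero_rpow hb.ne', sub_zero] at this
    calc _ ≤ _ := mul_le_mul_of_nonneg_left this (by linarith)
      _ = _ := by ring
  calc _ ≤ _ := add_le_add h1 h2
    _ = _ := by ring

theorem hasDerivAt_rpow_neg_sub {a r q : ℝ} (hq : r < q) :
    HasDerivAt (fun q => -(q - r) ^ (-a)) (a * ((q - r) ^ (1 + a))⁻¹) q := by
  have h0 : 0 < q - r := by linarith
  have := (((hasDerivAt_id q).sub_const r).rpow_const (p := -a) (Or.inl h0.ne')).neg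
  refine this.congr_deriv ?_
  rw [← Real.rpow_neg h0.le, show -a - 1 = -(1 + a) by ring]
  simp

/-- Changing the end point from s to t only leaves increments of w inside [s, t], each at most W
(t-s)^γ. Their weights are (t-r)^(-a) from the boundary and (s-r)^(-a) - (t-r)^(-a) from the
integral of the kernel, with a = 1 - α, and add up exactly to (s-r)^(-a). -/
theorem norm_pathD_sub_le [CompleteSpace X] {α γ T W s t r : ℝ} {w : ℝ → X} (hα1 : α < 1)
    (hγ0 : 0 < γ) (hγ : 1 - α < γ) (hw : Continuous w) (h : HolderBound γ T W w) (hr : 0 ≤ r)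
    (hrs : r < s) (hst : s ≤ t) (ht : t ≤ T) (hW : 0 ≤ W) :
    ‖pathD α t w r - pathD α s w r‖ ≤
      |(Real.Gamma α)⁻¹| * (W * ((t - s) ^ γ * (s - r) ^ (α - 1))) := by
  have hs0 : 0 < s - r := by linarith
  have ht0 : 0 < t - r := by linarith
  set a := 1 - α with ha
  have ha0 : 0 < a := by linarith
  have hcont : ∀ q ∈ uIcc s t, HasDerivAt (fun q => -(q - r) ^ (-a)) (a * ((q - r) ^ (1 + a))⁻¹) q :=
    fun q hq => by
      rw [uIcc_of_le hst] at hq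
      exact hasDerivAt_rpow_neg_sub (hrs.trans_le hq.1)
  have hkint : IntervalIntegrable (fun q => a * ((q - r) ^ (1 + a))⁻¹) volume s t := by
    refine ContinuousOn.intervalIntegrable ?_
    rw [uIcc_of_le hst]
    refine continuousOn_const.mul
      (ContinuousOn.inv₀ (ContinuousOn.rpow_const (by fun_prop) ?_) ?_)
    · exact fun q hq => Or.inl (by linarith [hq.1])
    · exact fun q hq => (Real.rpow_pos_of_pos (by linarith [hq.1]) _).ne'
  have hk : ∫ q in s..t, a * ((q - r) ^ (1 + a))⁻¹ = (s - r) ^ (-a) - (t - r) ^ (-a) := by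
    rw [intervalIntegral.integral_eq_sub_of_hasDerivAt hcont hkint]; ring
  have i1 := intervalIntegrable_rightD_integrand hγ hw h hr le_rfl hrs.le (hst.trans ht)
  have i2 := intervalIntegrable_rightD_integrand hγ hw h hr hrs.le hst ht
  have hkint' : IntervalIntegrable (fun q => ((q - r) ^ (1 + a))⁻¹) volume s t := by
    have := hkint.const_mul a⁻¹
    simpa [← mul_assoc, inv_mul_cancel₀ ha0.ne'] using this
  have hks (x : X) : IntervalIntegrable (fun q => ((q - r) ^ (1 + a))⁻¹ • x) volume s t :=
    ⟨hkint'.1.smul_const x, hkint'.2.smul_const x⟩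
  have i3 : IntervalIntegrable (fun q => ((q - r) ^ (1 + a))⁻¹ • (w s - w q)) volume s t := by
    have := i2.sub (hks (w r - w s))
    refine this.congr fun q _ => ?_
    simp only [ha]
    rw [← smul_sub]
    congr 1
    abel
  -- On [s, t] one writes w r - w q = (w r - w s) + (w s - w q). The constant part integrates
  -- explicitly and cancels against the boundary terms.
  have key : pathD α t w r - pathD α s w r = (Real.Gamma α)⁻¹ •
      (((t - r) ^ a)⁻¹ • (w s - w t) + a • ∫ q in s..t, ((q - r) ^ (1 + a))⁻¹ • (w s - w q)) := by
    have e1 : ∫ q in r..t, ((q - r) ^ (1 + a))⁻¹ • (w r - w q) =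
        (∫ q in r..s, ((q - r) ^ (1 + a))⁻¹ • (w r - w q)) +
          ((∫ q in s..t, ((q - r) ^ (1 + a))⁻¹) • (w r - w s) +
          ∫ q in s..t, ((q - r) ^ (1 + a))⁻¹ • (w s - w q)) := by
      rw [← intervalIntegral.integral_add_adjacent_intervals i1 i2,
        ← intervalIntegral.integral_smul_const,
        ← intervalIntegral.integral_add (hks _) i3]
      congr 1
      refine intervalIntegral.integral_congr fun q _ => ?_
      rw [← smul_add, sub_add_sub_cancel]
    have e2 : a * (∫ q in s..t, ((q - r) ^ (1 + a))⁻¹) = ((s - r) ^ a)⁻¹ - ((t - r) ^ a)⁻¹ := by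
      rw [← intervalIntegral.integral_const_mul, hk, Real.rpow_neg hs0.le, Real.rpow_neg ht0.le]
    simp only [pathD, rightD, sub_sub_sub_cancel_right, ← ha]
    rw [e1, show 1 - a = α by rw [ha]; ring, ← smul_sub]
    congr 1
    rw [smul_add, smul_add, smul_smul, e2]
    generalize (∫ q in r..s, ((q - r) ^ (1 + a))⁻¹ • (w r - w q)) = I1
    generalize (∫ q in s..t, ((q - r) ^ (1 + a))⁻¹ • (w s - w q)) = I2
    module
  rw [key, norm_smul, Real.norm_eq_abs]
  refine mul_le_mul_of_nonneg_left ((norm_add_le _ _).trans ?_) (abs_nonneg _)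
  have b1 : ‖((t - r) ^ a)⁻¹ • (w s - w t)‖ ≤ (t - r) ^ (-a) * (W * (t - s) ^ γ) := by
    rw [norm_smul, norm_inv, Real.norm_of_nonneg (Real.rpow_nonneg ht0.le _),
      ← Real.rpow_neg ht0.le]
    exact mul_le_mul_of_nonneg_left (h.norm_sub_le (by linarith) hst ht)
      (Real.rpow_nonneg ht0.le _)
  have b2 : ‖a • ∫ q in s..t, ((q - r) ^ (1 + a))⁻¹ • (w s - w q)‖ ≤
      ((s - r) ^ (-a) - (t - r) ^ (-a)) * (W * (t - s) ^ γ) := by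
    rw [← intervalIntegral.integral_smul, ← hk, ← intervalIntegral.integral_mul_const]
    refine norm_integral_le_of_Ioo hst (fun q hq => ?_) (hkint.mul_const _)
    have hq0 : 0 < q - r := by linarith [hq.1]
    rw [smul_smul, norm_smul, Real.norm_of_nonneg
      (mul_nonneg ha0.le (inv_nonneg.2 (Real.rpow_nonneg hq0.le _)))]
    refine mul_le_mul_of_nonneg_left ?_
      (mul_nonneg ha0.le (inv_nonneg.2 (Real.rpow_nonneg hq0.le _)))
    refine (h.norm_sub_le (by linarith) hq.1.le (hq.2.le.trans ht)).trans ?_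
    exact mul_le_mul_of_nonneg_left (Real.rpow_le_rpow (by linarith [hq.1]) (by linarith [hq.2])
      hγ0.le) hW
  calc _ ≤ _ := add_le_add b1 b2
    _ = W * ((t - s) ^ γ * (s - r) ^ (-a)) := by ring
    _ = _ := by rw [show -a = α - 1 by rw [ha]; ring]

/-- The integrand, extended by zero off the open triangle, is measurable on the plane, and
measurability survives integration in one variable. Continuity is needed only inside the triangle,
away from the singular kernel. -/
theorem aestronglyMeasurable_integral_triangle {t : ℝ} {f : ℝ → ℝ → X}
    (hf : ContinuousOn (fun p : ℝ × ℝ => f p.1 p.2) {p : ℝ × ℝ | 0 < p.2 ∧ p.2 < p.1 ∧ p.1 < t}) :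
    AEStronglyMeasurable (fun r => ∫ q in (0 : ℝ)..r, f r q) (volume.restrict (Ioo 0 t)) := by
  set D : Set (ℝ × ℝ) := {p : ℝ × ℝ | 0 < p.2 ∧ p.2 < p.1 ∧ p.1 < t}
  have hD : MeasurableSet D :=
    ((isOpen_lt continuous_const continuous_snd).inter
      ((isOpen_lt continuous_snd continuous_fst).inter
        (isOpen_lt continuous_fst continuous_const))).measurableSet
  have h1 : AEStronglyMeasurable (D.indicator fun p : ℝ × ℝ => f p.1 p.2)
      ((volume : Measure ℝ).prod (volume : Measure ℝ)) :=
    (aestronglyMeasurable_indicator_iff hD).2 (hf.aestronglyMeasurable hD)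
  refine (h1.integral_prod_right'.mono_measure Measure.restrict_le_self).congr ?_
  refine (ae_restrict_iff' measurableSet_Ioo).2 (ae_of_all _ fun r hr => ?_)
  simp only
  rw [intervalIntegral.integral_of_le hr.1.le, integral_Ioc_eq_integral_Ioo,
    ← integral_indicator measurableSet_Ioo]
  refine integral_congr_ae (ae_of_all _ fun q => ?_)
  simp only [indicator, D, mem_ofPred_eq, mem_Ioo]
  simp only [hr.2, and_true]

theorem aestronglyMeasurable_integral_triangle' {t : ℝ} {f : ℝ → ℝ → X}
    (hf : ContinuousOn (fun p : ℝ × ℝ => f p.1 p.2) {p : ℝ × ℝ | 0 < p.1 ∧ p.1 < p.2 ∧ p.2 < t}) :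
    AEStronglyMeasurable (fun r => ∫ q in r..t, f r q) (volume.restrict (Ioo 0 t)) := by
  set D : Set (ℝ × ℝ) := {p : ℝ × ℝ | 0 < p.1 ∧ p.1 < p.2 ∧ p.2 < t}
  have hD : MeasurableSet D :=
    ((isOpen_lt continuous_const continuous_fst).inter
      ((isOpen_lt continuous_fst continuous_snd).inter
        (isOpen_lt continuous_snd continuous_const))).measurableSet
  have h1 : AEStronglyMeasurable (D.indicator fun p : ℝ × ℝ => f p.1 p.2)
      ((volume : Measure ℝ).prod (volume : Measure ℝ)) :=
    (aestronglyMeasurable_indicator_iff hD).2 (hf.aestronglyMeasurable hD)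
  refine (h1.integral_prod_right'.mono_measure Measure.restrict_le_self).congr ?_
  refine (ae_restrict_iff' measurableSet_Ioo).2 (ae_of_all _ fun r hr => ?_)
  simp only
  rw [intervalIntegral.integral_of_le hr.2.le, integral_Ioc_eq_integral_Ioo,
    ← integral_indicator measurableSet_Ioo]
  refine integral_congr_ae (ae_of_all _ fun q => ?_)
  simp only [indicator, D, mem_ofPred_eq, mem_Ioo]
  simp only [hr.1, true_and]

theorem aestronglyMeasurable_leftD {α t : ℝ} {g : ℝ → X} (hg : ContinuousOn g (Ioo 0 t)) :
    AEStronglyMeasurable (leftD α g) (volume.restrict (Ioo 0 t)) := by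
  refine AEStronglyMeasurable.const_smul (AEStronglyMeasurable.add ?_
    (AEStronglyMeasurable.const_smul (aestronglyMeasurable_integral_triangle ?_) α)) _
  · refine ContinuousOn.aestronglyMeasurable (ContinuousOn.smul (ContinuousOn.inv₀
      (ContinuousOn.rpow_const (by fun_prop) ?_) ?_) hg) measurableSet_Ioo
    · exact fun q hq => Or.inl hq.1.ne'
    · exact fun q hq => (Real.rpow_pos_of_pos hq.1 _).ne'
  · refine ContinuousOn.smul (ContinuousOn.inv₀
      (ContinuousOn.rpow_const (by fun_prop) ?_) ?_) (ContinuousOn.sub ?_ ?_)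
    · exact fun p hp => Or.inl (by linarith [hp.2.1])
    · exact fun p hp => (Real.rpow_pos_of_pos (by linarith [hp.2.1]) _).ne'
    · exact hg.comp continuousOn_fst fun p hp => ⟨hp.1.trans hp.2.1, hp.2.2⟩
    · exact hg.comp continuousOn_snd fun p hp => ⟨hp.1, hp.2.1.trans hp.2.2⟩

theorem aestronglyMeasurable_pathD {α t : ℝ} {w : ℝ → X} (hw : Continuous w) :
    AEStronglyMeasurable (pathD α t w) (volume.restrict (Ioo 0 t)) := by
  refine AEStronglyMeasurable.const_smul (AEStronglyMeasurable.add ?_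
    (AEStronglyMeasurable.const_smul (aestronglyMeasurable_integral_triangle' ?_) _)) _
  · refine ContinuousOn.aestronglyMeasurable (ContinuousOn.smul (ContinuousOn.inv₀
      (ContinuousOn.rpow_const (by fun_prop) ?_) ?_) (by fun_prop)) measurableSet_Ioo
    · exact fun q hq => Or.inl (by linarith [hq.2])
    · exact fun q hq => (Real.rpow_pos_of_pos (by linarith [hq.2]) _).ne'
  · refine ContinuousOn.smul (ContinuousOn.inv₀
      (ContinuousOn.rpow_const (by fun_prop) ?_) ?_) (by fun_prop)
    · exact fun p hp => Or.inl (by linarith [hp.2.1])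
    · exact fun p hp => (Real.rpow_pos_of_pos (by linarith [hp.2.1]) _).ne'

end VectorFracDeriv

/-! ### The path integral as a Bochner integral -/

section PathIntegral

variable {V : Type*} [NormedAddCommGroup V] [InnerProductSpace ℝ V] {ι : Type*}

/-- Distinct basis vectors have distance √2, so balls of radius 1/2 around them are disjoint.
Countability makes the filter of finite index sets countably generated, as dominated convergence for
the basis expansion requires. -/
theorem countable_of_hilbertBasis [TopologicalSpace.SeparableSpace V] (e : HilbertBasis ι ℝ V) :
    Countable ι := by
  refine Pairwise.countable_of_isOpen_disjoint (s := fun i => Metric.ball (e i) (1 / 2))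
    (fun i j hij => ?_) (fun _ => Metric.isOpen_ball) fun i => ⟨e i, by simp⟩
  refine Metric.ball_disjoint_ball ?_
  have h0 : ⟪e i, e j⟫_ℝ = 0 := e.orthonormal.2 hij
  have h1 : ‖e i - e j‖ ^ 2 = 2 := by
    rw [norm_sub_sq_real, h0, e.orthonormal.1 i, e.orthonormal.1 j]; norm_num
  rw [dist_eq_norm]
  nlinarith [norm_nonneg (e i - e j)]

theorem norm_sum_inner_smul_le (e : HilbertBasis ι ℝ V) (s : Finset ι) (b : V) :
    ‖∑ i ∈ s, ⟪e i, b⟫_ℝ • e i‖ ≤ ‖b‖ := by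
  have h := e.orthonormal.sum_inner_products_le (x := b) (s := s)
  have h2 : ‖∑ i ∈ s, ⟪e i, b⟫_ℝ • e i‖ ^ 2 = ∑ i ∈ s, ‖⟪e i, b⟫_ℝ‖ ^ 2 := by
    rw [← real_inner_self_eq_norm_sq, e.orthonormal.inner_sum]
    refine Finset.sum_congr rfl fun i _ => ?_
    simp [sq]
  exact (sq_le_sq₀ (norm_nonneg _) (norm_nonneg _)).1 (h2.trans_le h)

/-- The vector valued form of the integral against a Hölder path. -/
def fracIntegral (α t : ℝ) (g : ℝ → V →L[ℝ] V) (w : ℝ → V) : V :=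
  -∫ r in (0 : ℝ)..t, leftD α g r (pathD α t w r)

theorem aestronglyMeasurable_leftD_pathD {α t : ℝ} {g : ℝ → V →L[ℝ] V} {w : ℝ → V} {t' : ℝ}
    (htt : t' ≤ t) (hg : ContinuousOn g (Ioo 0 t)) (hw : Continuous w) :
    AEStronglyMeasurable (fun r => leftD α g r (pathD α t w r)) (volume.restrict (Ioo 0 t')) :=
  ((ContinuousLinearMap.apply ℝ V : V →L[ℝ] (V →L[ℝ] V) →L[ℝ] V).aestronglyMeasurable_comp₂
    (aestronglyMeasurable_pathD hw) (aestronglyMeasurable_leftD hg)).mono_measure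
      (Measure.restrict_mono (Ioo_subset_Ioo_right htt) le_rfl)

variable [CompleteSpace V]

theorem integral_clm_comp {X Y : Type*} [NormedAddCommGroup X] [NormedSpace ℝ X] [CompleteSpace X]
    [NormedAddCommGroup Y] [NormedSpace ℝ Y] [CompleteSpace Y] (L : X →L[ℝ] Y) {a b : ℝ}
    {f : ℝ → X} (hf : IntervalIntegrable f volume a b) :
    ∫ x in a..b, L (f x) = L (∫ x in a..b, f x) := by
  simp only [intervalIntegral, map_sub, L.integral_comp_comm hf.1, L.integral_comp_comm hf.2]

theorem leftD_clm {X Y : Type*} [NormedAddCommGroup X] [NormedSpace ℝ X] [CompleteSpace X]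
    [NormedAddCommGroup Y] [NormedSpace ℝ Y] [CompleteSpace Y] (L : X →L[ℝ] Y)
    {α r : ℝ} {g : ℝ → X}
    (hi : IntervalIntegrable (fun q => ((r - q) ^ (1 + α))⁻¹ • (g r - g q)) volume 0 r) :
    leftD α (fun q => L (g q)) r = L (leftD α g r) := by
  simp only [leftD, map_smul, map_add, ← map_sub]
  rw [← integral_clm_comp L hi]
  simp only [map_smul]

/-- Matrix coefficients are bounded linear functionals of the operator. Integrability of the
operator valued integrand is what lets them pass under the integral. -/
theorem leftFracDeriv_inner (e : HilbertBasis ι ℝ V) {α r : ℝ} {g : ℝ → V →L[ℝ] V} (i j : ι)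
    (hi : IntervalIntegrable (fun q => ((r - q) ^ (1 + α))⁻¹ • (g r - g q)) volume 0 r) :
    leftFracDeriv α 0 (fun q => ⟪e j, g q (e i)⟫_ℝ) r = ⟪e j, leftD α g r (e i)⟫_ℝ := by
  have h := leftD_clm ((innerSL ℝ (e j)).comp (ContinuousLinearMap.apply ℝ V (e i))) hi
  simp only [ContinuousLinearMap.comp_apply, ContinuousLinearMap.apply_apply,
    innerSL_apply_apply] at h
  rw [← h, leftD, leftFracDeriv]
  simp only [sub_zero, smul_eq_mul, div_eq_mul_inv, mul_comm]

theorem rightFracDeriv_inner (e : HilbertBasis ι ℝ V) {α r t : ℝ} {w : ℝ → V} (i : ι)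
    (hi : IntervalIntegrable (fun q => ((q - r) ^ (1 + (1 - α)))⁻¹ • (w r - w q)) volume r t) :
    rightFracDeriv (1 - α) t (fun q => ⟪e i, w q - w t⟫_ℝ) r = ⟪e i, pathD α t w r⟫_ℝ := by
  have h := integral_clm_comp (innerSL ℝ (e i)) hi
  simp only [innerSL_apply_apply] at h
  rw [pathD, rightD, rightFracDeriv]
  simp only [sub_sub_sub_cancel_right, inner_smul_right, inner_add_right]
  rw [← h]
  simp only [← inner_sub_right, sub_sub_sub_cancel_right, div_eq_mul_inv, inner_smul_right,
    mul_comm]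

/-- For fixed j, a partial sum over i replaces the right derivative of w by its projection onto
finitely many basis vectors. Projections do not increase norms, so B dominates all partial sums and
the sum over i may be taken under the integral. The sum over j is then the basis expansion of the
resulting vector. -/
theorem pathIntegral_eq_fracIntegral [TopologicalSpace.SeparableSpace V] (e : HilbertBasis ι ℝ V)
    {α γ T W t : ℝ} (ht : 0 ≤ t) (htT : t ≤ T) {g : ℝ → V →L[ℝ] V} {w : ℝ → V}
    (hγ : 1 - α < γ) (hw : Continuous w) (hW : HolderBound γ T W w)
    (hg : ContinuousOn g (Ioo 0 t))
    (hgi : ∀ r ∈ Ioo 0 t,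
      IntervalIntegrable (fun q => ((r - q) ^ (1 + α))⁻¹ • (g r - g q)) volume 0 r)
    {B : ℝ → ℝ} (hB : IntervalIntegrable B volume 0 t)
    (hBle : ∀ r ∈ Ioo 0 t, ‖leftD α g r‖ * ‖pathD α t w r‖ ≤ B r) :
    pathIntegral e α 0 t g w = fracIntegral α t g w := by
  have : Countable ι := countable_of_hilbertBasis e
  have hfi : IntervalIntegrable (fun r => leftD α g r (pathD α t w r)) volume 0 t :=
    intervalIntegrable_of_Ioo ht (aestronglyMeasurable_leftD_pathD le_rfl hg hw)
      (fun r hr => ((leftD α g r).le_opNorm _).trans (hBle r hr)) hB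
  have key (j : ι) : HasSum (fun i => ∫ r in (0 : ℝ)..t,
      leftFracDeriv α 0 (fun q => ⟪e j, g q (e i)⟫_ℝ) r *
        rightFracDeriv (1 - α) t (fun q => ⟪e i, w q - w t⟫_ℝ) r)
      ⟪e j, ∫ r in (0 : ℝ)..t, leftD α g r (pathD α t w r)⟫_ℝ := by
    have hF (i : ι) : ∀ r ∈ Ioo 0 t,
        leftFracDeriv α 0 (fun q => ⟪e j, g q (e i)⟫_ℝ) r *
          rightFracDeriv (1 - α) t (fun q => ⟪e i, w q - w t⟫_ℝ) r =
        ⟪e j, leftD α g r (e i)⟫_ℝ * ⟪e i, pathD α t w r⟫_ℝ := fun r hr => by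
      rw [leftFracDeriv_inner e i j (hgi r hr), rightFracDeriv_inner e i
        (intervalIntegrable_rightD_integrand hγ hw hW hr.1.le le_rfl hr.2.le htT)]
    simp only [integral_congr_Ioo ht (hF _)]
    have hsum (s : Finset ι) (r : ℝ) :
        ∑ i ∈ s, ⟪e j, leftD α g r (e i)⟫_ℝ * ⟪e i, pathD α t w r⟫_ℝ =
          ⟪e j, leftD α g r (∑ i ∈ s, ⟪e i, pathD α t w r⟫_ℝ • e i)⟫_ℝ := by
      rw [map_sum, inner_sum]
      refine Finset.sum_congr rfl fun i _ => ?_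
      rw [map_smul, inner_smul_right, mul_comm]
    have hbd (s : Finset ι) : ∀ r ∈ Ioo 0 t,
        ‖∑ i ∈ s, ⟪e j, leftD α g r (e i)⟫_ℝ * ⟪e i, pathD α t w r⟫_ℝ‖ ≤ B r := fun r hr => by
      rw [hsum]
      refine (norm_inner_le_norm _ _).trans ?_
      rw [e.orthonormal.1 j, one_mul]
      refine ((leftD α g r).le_opNorm _).trans (le_trans ?_ (hBle r hr))
      exact mul_le_mul_of_nonneg_left (norm_sum_inner_smul_le e s _) (norm_nonneg _)
    have hmeas (i : ι) : AEStronglyMeasurable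
        (fun r => ⟪e j, leftD α g r (e i)⟫_ℝ * ⟪e i, pathD α t w r⟫_ℝ)
        (volume.restrict (Ioo 0 t)) := by
      refine AEStronglyMeasurable.mul ?_ ?_
      · exact ((innerSL ℝ (e j)).comp (ContinuousLinearMap.apply ℝ V (e i))).continuous
          |>.comp_aestronglyMeasurable (aestronglyMeasurable_leftD hg)
      · exact (innerSL ℝ (e i)).continuous.comp_aestronglyMeasurable
          (aestronglyMeasurable_pathD hw)
    have hint (i : ι) : IntervalIntegrable
        (fun r => ⟪e j, leftD α g r (e i)⟫_ℝ * ⟪e i, pathD α t w r⟫_ℝ) volume 0 t :=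
      intervalIntegrable_of_Ioo ht (hmeas i) (fun r hr => by simpa using hbd {i} r hr) hB
    have hlim := integral_clm_comp (innerSL ℝ (e j)) hfi
    simp only [innerSL_apply_apply] at hlim
    rw [HasSum, ← hlim]
    have hconv : Tendsto (fun s : Finset ι => ∫ r in (0 : ℝ)..t,
        ∑ i ∈ s, ⟪e j, leftD α g r (e i)⟫_ℝ * ⟪e i, pathD α t w r⟫_ℝ) atTop
        (𝓝 (∫ r in (0 : ℝ)..t, ⟪e j, leftD α g r (pathD α t w r)⟫_ℝ)) := by
      refine intervalIntegral.tendsto_integral_filter_of_dominated_convergence B ?_ ?_ hB ?_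
      · refine Eventually.of_forall fun s => ?_
        rw [uIoc_of_le ht, ← restrict_Ioo_eq_restrict_Ioc]
        exact Finset.aestronglyMeasurable_fun_sum s fun i _ => hmeas i
      · refine Eventually.of_forall fun s => ?_
        filter_upwards [ae_mem_Ioo_of_mem_Ioc 0 t] with r hr hr'
        rw [uIoc_of_le ht] at hr'
        exact hbd s r (hr hr')
      · refine ae_of_all _ fun r _ => ?_
        simp only [hsum]
        have h := e.hasSum_repr (pathD α t w r)
        simp only [e.repr_apply_apply] at h
        exact ((innerSL ℝ (e j)).continuous.tendsto _).comp
          (((leftD α g r).continuous.tendsto _).comp h)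
    refine hconv.congr fun s => ?_
    exact intervalIntegral.integral_finsetSum fun i _ => hint i
  unfold pathIntegral
  simp only [(key _).tsum_eq]
  have h := e.hasSum_repr (fracIntegral α t g w)
  rw [← h.tsum_eq]
  simp only [e.repr_apply_apply, fracIntegral, inner_neg_right, neg_one_mul]

end PathIntegral

/-! ### Smoothing estimates for the semigroup -/

section Semigroup

variable {V : Type*} [NormedAddCommGroup V] [InnerProductSpace ℝ V] {ι : Type*}

theorem one_sub_exp_neg_le_rpow {x γ : ℝ} (hx : 0 ≤ x) (h0 : 0 ≤ γ) (h1 : γ ≤ 1) :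
    1 - Real.exp (-x) ≤ x ^ γ := by
  rcases le_total x 1 with h | h
  · have h2 := Real.add_one_le_exp (-x)
    have h3 := Real.rpow_le_rpow_of_exponent_ge' hx h h0 h1
    rw [Real.rpow_one] at h3
    linarith
  · have h2 := Real.exp_pos (-x)
    have h3 := Real.one_le_rpow h h0
    linarith

theorem exp_neg_le_rpow_neg {y γ : ℝ} (hy : 0 < y) (h0 : 0 ≤ γ) (h1 : γ ≤ 1) :
    Real.exp (-y) ≤ y ^ (-γ) := by
  rw [Real.exp_neg, Real.rpow_neg hy.le]
  refine inv_anti₀ (Real.rpow_pos_of_pos hy _) ?_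
  have h2 := Real.add_one_le_exp y
  rcases le_total y 1 with h | h
  · have h3 := Real.rpow_le_one hy.le h h0
    linarith
  · have h3 := Real.rpow_le_rpow_of_exponent_le h h1
    rw [Real.rpow_one] at h3
    linarith

/-- The properties of the semigroup which enter the estimates. -/
structure SmoothingSemigroup (S : ℝ → V →L[ℝ] V) : Prop where
  zero : S 0 = ContinuousLinearMap.id ℝ V
  add : ∀ s t : ℝ, 0 ≤ s → 0 ≤ t → S (s + t) = (S s).comp (S t)
  strong_cont : ∀ x : V, Tendsto (fun t => S t x) (𝓝[>] 0) (𝓝 x)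
  norm_le : ∀ t : ℝ, 0 ≤ t → ‖S t‖ ≤ 1
  smoothing : ∀ γ h r : ℝ, 0 ≤ γ → γ ≤ 1 → 0 ≤ h → 0 < r →
    ‖(S h - ContinuousLinearMap.id ℝ V).comp (S r)‖ ≤ h ^ γ * r ^ (-γ)
  compact : ∀ h R : ℝ, 0 < h → ∃ C : Set V, IsCompact C ∧ ∀ v, ‖v‖ ≤ R → S h v ∈ C

theorem norm_le_of_inner_le (e : HilbertBasis ι ℝ V) {C : ℝ} (hC : 0 ≤ C) {x y : V}
    (h : ∀ i, |⟪e i, y⟫_ℝ| ≤ C * |⟪e i, x⟫_ℝ|) : ‖y‖ ≤ C * ‖x‖ := by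
  have hx := (e.hasSum_inner_mul_inner x x).mul_left (C ^ 2)
  have hy := e.hasSum_inner_mul_inner y y
  have hle := hasSum_le (fun i => ?_) hy hx
  · rw [real_inner_self_eq_norm_sq, real_inner_self_eq_norm_sq, ← mul_pow] at hle
    exact (sq_le_sq₀ (norm_nonneg _) (mul_nonneg hC (norm_nonneg _))).1 hle
  · rw [real_inner_comm y (e i), real_inner_comm x (e i), ← sq, ← sq, ← mul_pow]
    refine sq_le_sq.2 ?_
    rw [abs_mul, abs_of_nonneg hC, real_inner_comm (e i) y, real_inner_comm (e i) x]
    simpa only [real_inner_comm] using h i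

theorem inner_diagonal (e : HilbertBasis ι ℝ V) {T : V →L[ℝ] V} {c : ι → ℝ}
    (hT : ∀ i, T (e i) = c i • e i) (v : V) (i : ι) : ⟪e i, T v⟫_ℝ = c i * ⟪e i, v⟫_ℝ := by
  have h := (((e.hasSum_repr v).mapL T).mapL (innerSL ℝ (e i)))
  have h2 : HasSum (fun j => innerSL ℝ (e i) (T (e.repr v j • e j))) (c i * ⟪e i, v⟫_ℝ) := by
    have h3 := hasSum_single (f := fun j => innerSL ℝ (e i) (T (e.repr v j • e j))) i
      (fun j hj => ?_)
    · convert h3 using 1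
      simp [hT, e.repr_apply_apply, e.orthonormal.1 i, mul_comm]
    · simp [hT, e.orthonormal.2 (Ne.symm hj)]
  exact (innerSL_apply_apply ℝ (e i) (T v)).symm.trans (h.unique h2)

theorem norm_le_of_diagonal (e : HilbertBasis ι ℝ V) {T : V →L[ℝ] V} {c : ι → ℝ}
    (hT : ∀ i, T (e i) = c i • e i) {C : ℝ} (hC : 0 ≤ C) (hc : ∀ i, |c i| ≤ C) : ‖T‖ ≤ C := by
  refine T.opNorm_le_bound hC fun v => norm_le_of_inner_le e hC fun i => ?_
  rw [inner_diagonal e hT, abs_mul]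
  exact mul_le_mul_of_nonneg_right (hc i) (abs_nonneg _)

theorem tendsto_nhdsGE_of_strong_cont {S : ℝ → V →L[ℝ] V}
    (h0 : S 0 = ContinuousLinearMap.id ℝ V) {x : V}
    (hc : Tendsto (fun t => S t x) (𝓝[>] 0) (𝓝 x)) : Tendsto (fun t => S t x) (𝓝[≥] 0) (𝓝 x) := by
  rw [← Ioi_insert, nhdsWithin_insert]
  refine Tendsto.sup ?_ hc
  rw [tendsto_pure_left]
  intro s hs
  rw [h0]
  exact mem_of_mem_nhds hs

/-- Otherwise there are times h n → 0 with ‖S (h n)‖ > n, although S (h n) x converges for every x;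
this contradicts Banach–Steinhaus. -/
theorem exists_norm_le_near_zero [CompleteSpace V] {S : ℝ → V →L[ℝ] V}
    (h0 : S 0 = ContinuousLinearMap.id ℝ V)
    (hc : ∀ x : V, Tendsto (fun t => S t x) (𝓝[>] 0) (𝓝 x)) :
    ∃ δ > 0, ∃ M, ∀ h ∈ Icc (0 : ℝ) δ, ‖S h‖ ≤ M := by
  by_contra! hcon
  choose h hh hS using fun n : ℕ => hcon (1 / ((n : ℝ) + 1)) (by positivity) n
  have hlim : Tendsto h atTop (𝓝[≥] 0) := by
    refine tendsto_nhdsWithin_iff.2 ⟨?_, Eventually.of_forall fun n => (hh n).1⟩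
    exact squeeze_zero (fun n => (hh n).1) (fun n => (hh n).2) tendsto_one_div_add_atTop_nhds_zero_nat
  obtain ⟨C, hC⟩ := banach_steinhaus (g := fun n => S (h n)) fun x => by
    obtain ⟨C, hC⟩ := ((tendsto_nhdsGE_of_strong_cont h0 (hc x)).comp hlim).norm.bddAbove_range
    exact ⟨C, fun n => hC ⟨n, rfl⟩⟩
  obtain ⟨n, hn⟩ := exists_nat_gt C
  exact absurd (hC n) (not_le.2 (hn.trans (hS n)))

/-- For s ≤ t the increment is S s (S (t-s) x - x). A bound at the earlier of the two times thus
turns continuity at zero from the right into two-sided continuity. -/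
theorem strong_continuousOn {S : ℝ → V →L[ℝ] V} (h0 : S 0 = ContinuousLinearMap.id ℝ V)
    (hadd : ∀ s t : ℝ, 0 ≤ s → 0 ≤ t → S (s + t) = (S s).comp (S t)) {x : V}
    (hc : Tendsto (fun t => S t x) (𝓝[>] 0) (𝓝 x)) {D : Set ℝ} (hD : D ⊆ Ici 0) {M : ℝ}
    (hM : ∀ h ∈ D, ‖S h‖ ≤ M) : ContinuousOn (fun t => S t x) D := by
  have hle : ∀ s ∈ D, ∀ t ∈ D, s ≤ t → ‖S t x - S s x‖ ≤ M * ‖S |t - s| x - x‖ := by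
    intro s hs t ht hst
    have h1 : S t x = S s (S (t - s) x) := by
      have := hadd s (t - s) (hD hs) (by linarith)
      rw [add_sub_cancel] at this
      rw [this]; rfl
    rw [h1, ← map_sub, abs_of_nonneg (by linarith)]
    exact ((S s).le_opNorm _).trans (mul_le_mul_of_nonneg_right (hM s hs) (norm_nonneg _))
  intro s hs
  rw [ContinuousWithinAt, tendsto_iff_norm_sub_tendsto_zero]
  have hlim : Tendsto (fun t => |t - s|) (𝓝[D] s) (𝓝[≥] 0) := by
    refine tendsto_nhdsWithin_iff.2 ⟨?_, Eventually.of_forall fun t => mem_Ici.2 (abs_nonneg _)⟩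
    have : Continuous fun t => |t - s| := by fun_prop
    simpa using (this.tendsto s).mono_left (nhdsWithin_le_nhds (s := D))
  have h2 : Tendsto (fun t => M * ‖S |t - s| x - x‖) (𝓝[D] s) (𝓝 0) := by
    have := ((tendsto_nhdsGE_of_strong_cont h0 hc).comp hlim).sub_const x
    simpa using this.norm.const_mul M
  refine squeeze_zero' (Eventually.of_forall fun t => norm_nonneg _) ?_ h2
  filter_upwards [self_mem_nhdsWithin] with t ht
  rcases le_total s t with h | h
  · exact hle s hs t ht h
  · rw [norm_sub_rev, abs_sub_comm]
    exact hle t ht s hs h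

/-- The function e^(μt) S(t)x has vanishing right derivative, hence is constant. At this stage `S`
is only known to be bounded near zero, so the argument runs on [0, δ]. -/
theorem semigroup_apply_eigenvector [CompleteSpace V] {A : V →ₗ.[ℝ] V} {S : ℝ → V →L[ℝ] V}
    (hS : IsSemigroupGeneratedBy A S) {x : V} {μ : ℝ} (hx : (x, -(μ • x)) ∈ A.graph) {t : ℝ}
    (ht : 0 ≤ t) : S t x = Real.exp (-(μ * t)) • x := by
  obtain ⟨δ, hδ, M, hM⟩ := exists_norm_le_near_zero hS.zero hS.strong_cont
  have hgen := (hS.generator x _).1 hx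
  have hloc : ∀ t ∈ Icc (0 : ℝ) δ, S t x = Real.exp (-(μ * t)) • x := by
    have hcont : ContinuousOn (fun t => Real.exp (μ * t) • S t x) (Icc 0 δ) :=
      ContinuousOn.smul (by fun_prop)
        (strong_continuousOn hS.zero hS.add (hS.strong_cont x) Icc_subset_Ici_self hM)
    have hderiv : ∀ r ∈ Ico (0 : ℝ) δ,
        HasDerivWithinAt (fun t => Real.exp (μ * t) • S t x) 0 (Ici r) r := by
      intro r hr
      have h1 : HasDerivWithinAt (fun t => S t x) (S r (-(μ • x))) (Ici r) r := by
        rw [← hasDerivWithinAt_Ioi_iff_Ici, hasDerivWithinAt_iff_tendsto_slope' (by simp)]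
        have hsub : Tendsto (fun y => y - r) (𝓝[>] r) (𝓝[>] 0) := by
          refine tendsto_nhdsWithin_iff.2 ⟨?_, ?_⟩
          · have : Continuous fun y : ℝ => y - r := by fun_prop
            simpa using (this.tendsto r).mono_left (nhdsWithin_le_nhds (s := Ioi r))
          · filter_upwards [self_mem_nhdsWithin] with y hy using mem_Ioi.2 (sub_pos.2 (mem_Ioi.1 hy))
        refine (((S r).continuous.tendsto _).comp (hgen.comp hsub)).congr' ?_
        filter_upwards [self_mem_nhdsWithin] with y hy
        have h2 : S y x = S r (S (y - r) x) := by
          have := hS.add r (y - r) hr.1 (sub_nonneg.2 (le_of_lt (mem_Ioi.1 hy)))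
          rw [add_sub_cancel] at this
          rw [this]; rfl
        simp only [Function.comp_apply, slope_def_module, map_smul, map_sub, h2]
      have h3 : HasDerivWithinAt (fun t => Real.exp (μ * t)) (Real.exp (μ * r) * μ) (Ici r) r := by
        have := ((hasDerivAt_id r).const_mul μ).exp
        simpa using this.hasDerivWithinAt
      refine (h3.smul h1).congr_deriv ?_
      rw [map_neg, map_smul]
      module
    intro t ht
    have h := constant_of_has_deriv_right_zero hcont hderiv t ht
    simp only [mul_zero, Real.exp_zero, one_smul, hS.zero, ContinuousLinearMap.id_apply] at h
    rw [Real.exp_neg, ← h, smul_smul, inv_mul_cancel₀ (Real.exp_pos _).ne', one_smul, h]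
  -- The semigroup law propagates the formula from [0, δ] to all times in steps of length δ.
  have hind : ∀ n : ℕ, ∀ t ∈ Icc (0 : ℝ) (n * δ), S t x = Real.exp (-(μ * t)) • x := by
    intro n
    induction n with
    | zero =>
      intro t ht
      refine hloc t ⟨ht.1, ht.2.trans ?_⟩
      simp [hδ.le]
    | succ n ih =>
      intro t ht
      rcases le_total t (n * δ) with h | h
      · exact ih t ⟨ht.1, h⟩
      · have hn : 0 ≤ (n : ℝ) * δ := by positivity
        have h1 := hS.add (n * δ) (t - n * δ) hn (by linarith)
        have h2 := ht.2
        push_cast at h2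
        rw [add_sub_cancel] at h1
        rw [h1, ContinuousLinearMap.comp_apply, hloc (t - n * δ) ⟨by linarith, by linarith⟩,
          map_smul, ih (n * δ) ⟨hn, le_rfl⟩, smul_smul, ← Real.exp_add]
        congr 2
        ring
  obtain ⟨n, hn⟩ := exists_nat_gt (t / δ)
  exact hind n t ⟨ht, ((div_lt_iff₀ hδ).1 hn).le⟩

theorem exists_eigenvalues [CompleteSpace V] {A : V →ₗ.[ℝ] V}
    (hA : IsPositiveWithCompactInverse (-A)) {S : ℝ → V →L[ℝ] V}
    (hS : IsSemigroupGeneratedBy A S) (e : HilbertBasis ι ℝ V)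
    (he : ∀ i, ∃ μ : ℝ, (e i, μ • e i) ∈ (-A).graph) :
    ∃ μ : ι → ℝ, (∀ i, 0 < μ i) ∧ (∀ i t, 0 ≤ t → S t (e i) = Real.exp (-(μ i * t)) • e i) ∧
      ∃ K : V →L[ℝ] V, IsCompactOperator K ∧ ∀ i, K (μ i • e i) = e i := by
  choose μ hμ using he
  obtain ⟨K, hK, -, hK2⟩ := hA.exists_inverse
  have hgr (i : ι) : ∃ y : (-A).domain, (y : V) = e i ∧ (-A) y = μ i • e i :=
    (LinearPMap.mem_graph_iff _).1 (hμ i)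
  refine ⟨μ, fun i => ?_, fun i t ht => ?_, K, hK, fun i => ?_⟩
  · obtain ⟨y, hy1, hy2⟩ := hgr i
    have hne : (y : V) ≠ 0 := by
      rw [hy1]; exact e.orthonormal.ne_zero i
    have h := hA.pos y hne
    rw [hy2, hy1, inner_smul_left, real_inner_self_eq_norm_sq, e.orthonormal.1 i] at h
    simpa using h
  · refine semigroup_apply_eigenvector hS ?_ ht
    obtain ⟨y, hy1, hy2⟩ := hgr i
    refine (LinearPMap.mem_graph_iff _).2 ⟨y, hy1, ?_⟩
    rw [LinearPMap.neg_apply] at hy2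
    rw [← hy2, neg_neg]
  · obtain ⟨y, hy1, hy2⟩ := hgr i
    have := hK2 y
    rwa [hy2, hy1] at this

/-- In the basis e all operators are diagonal, so the norm bounds reduce to 1 - e^(-x) ≤ x^γ and
e^(-y) ≤ y^(-γ) with x = μh and y = μr. The eigenvalue cancels in the product. -/
theorem smoothingSemigroup_of_generator [CompleteSpace V] {A : V →ₗ.[ℝ] V}
    (hA : IsPositiveWithCompactInverse (-A)) {S : ℝ → V →L[ℝ] V}
    (hS : IsSemigroupGeneratedBy A S) (e : HilbertBasis ι ℝ V)
    (he : ∀ i, ∃ μ : ℝ, (e i, μ • e i) ∈ (-A).graph) : SmoothingSemigroup S := by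
  obtain ⟨μ, hμ, hSe, K, hK, hKe⟩ := exists_eigenvalues hA hS e he
  refine ⟨hS.zero, hS.add, hS.strong_cont, fun t ht => ?_, fun γ h r hγ0 hγ1 hh hr => ?_,
    fun h R hh => ?_⟩
  · refine norm_le_of_diagonal e (fun i => hSe i t ht) zero_le_one fun i => ?_
    rw [abs_of_pos (Real.exp_pos _), Real.exp_le_one_iff, neg_nonpos]
    exact mul_nonneg (hμ i).le ht
  · refine norm_le_of_diagonal e
      (c := fun i => (Real.exp (-(μ i * h)) - 1) * Real.exp (-(μ i * r))) (fun i => ?_)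
      (mul_nonneg (Real.rpow_nonneg hh _) (Real.rpow_nonneg hr.le _)) fun i => ?_
    · simp only [ContinuousLinearMap.comp_apply, hSe i r hr.le, map_smul,
        sub_apply, hSe i h hh, ContinuousLinearMap.id_apply]
      module
    · have hx : 0 ≤ μ i * h := mul_nonneg (hμ i).le hh
      have hy : 0 < μ i * r := mul_pos (hμ i) hr
      rw [abs_mul, abs_sub_comm, abs_of_nonneg (sub_nonneg.2 (Real.exp_le_one_iff.2 (by linarith))),
        abs_of_pos (Real.exp_pos _)]
      calc _ ≤ (μ i * h) ^ γ * (μ i * r) ^ (-γ) :=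
            mul_le_mul (one_sub_exp_neg_le_rpow hx hγ0 hγ1) (exp_neg_le_rpow_neg hy hγ0 hγ1)
              (Real.exp_pos _).le (Real.rpow_nonneg hx _)
        _ = ((μ i) ^ γ * (μ i) ^ (-γ)) * (h ^ γ * r ^ (-γ)) := by
            rw [Real.mul_rpow (hμ i).le hh, Real.mul_rpow (hμ i).le hr.le]; ring
        _ = _ := by rw [← Real.rpow_add (hμ i)]; simp
  -- Compactness of S(h): S(h)v = K y with y = -A S(h)v, and ‖y‖ ≤ R/h because μ e^(-μh) ≤ 1/h. The
  -- vector y is built from its coefficients.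
  · obtain ⟨C, hC, hKC⟩ := hK.image_closedBall_subset_compact (h⁻¹ * R)
    refine ⟨C, hC, fun v hv => hKC ?_⟩
    have hbd (i : ι) : |μ i * Real.exp (-(μ i * h))| ≤ h⁻¹ := by
      have h1 := exp_neg_le_rpow_neg (mul_pos (hμ i) hh) zero_le_one le_rfl
      rw [Real.rpow_neg_one, mul_inv] at h1
      rw [abs_of_nonneg (mul_nonneg (hμ i).le (Real.exp_pos _).le)]
      calc _ ≤ μ i * ((μ i)⁻¹ * h⁻¹) := mul_le_mul_of_nonneg_left h1 (hμ i).le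
        _ = h⁻¹ := by rw [← mul_assoc, mul_inv_cancel₀ (hμ i).ne', one_mul]
    have hmem : Memℓp (fun i => μ i * Real.exp (-(μ i * h)) * ⟪e i, v⟫_ℝ) 2 := by
      refine memℓp_gen ?_
      have hs := ((lp.memℓp (e.repr v)).summable (by norm_num)).mul_left ((h⁻¹) ^ 2)
      refine Summable.of_nonneg_of_le (fun i => by positivity) (fun i => ?_) hs
      simp only [ENNReal.toReal_ofNat, Real.rpow_ofNat, e.repr_apply_apply, Real.norm_eq_abs,
        ← mul_pow]
      rw [abs_mul]
      exact pow_le_pow_left₀ (mul_nonneg (abs_nonneg _) (abs_nonneg _))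
        (mul_le_mul_of_nonneg_right (hbd i) (abs_nonneg _)) 2
    set y : V := e.repr.symm ⟨_, hmem⟩ with hy
    have hyi (i : ι) : ⟪e i, y⟫_ℝ = μ i * Real.exp (-(μ i * h)) * ⟪e i, v⟫_ℝ := by
      rw [← e.repr_apply_apply, hy, LinearIsometryEquiv.apply_symm_apply]
    refine ⟨y, ?_, ?_⟩
    · rw [mem_closedBall_zero_iff]
      refine (norm_le_of_inner_le e (inv_nonneg.2 hh.le) (x := v) fun i => ?_).trans
        (mul_le_mul_of_nonneg_left hv (inv_nonneg.2 hh.le))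
      rw [hyi, abs_mul]
      exact mul_le_mul_of_nonneg_right (hbd i) (abs_nonneg _)
    · have h1 := (e.hasSum_repr y).mapL K
      have h2 := (e.hasSum_repr v).mapL (S h)
      refine h1.unique (h2.congr_fun ?_)
      intro i
      have h3 : K (e i) = (μ i)⁻¹ • e i := by
        conv_rhs => rw [← hKe i, map_smul K, smul_smul, inv_mul_cancel₀ (hμ i).ne', one_smul]
      rw [e.repr_apply_apply, e.repr_apply_apply, hyi, map_smul (S h), hSe i h hh.le, smul_smul,
        map_smul K, h3, smul_smul]
      congr 1
      have := (hμ i).ne'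
      field_simp

namespace SmoothingSemigroup

variable {S : ℝ → V →L[ℝ] V} (hS : SmoothingSemigroup S)
include hS

theorem apply_add {s t : ℝ} (hs : 0 ≤ s) (ht : 0 ≤ t) (x : V) : S (s + t) x = S s (S t x) := by
  rw [hS.add s t hs ht]; rfl

theorem comm_apply {s t : ℝ} (hs : 0 ≤ s) (ht : 0 ≤ t) (x : V) : S s (S t x) = S t (S s x) := by
  rw [← hS.apply_add hs ht, ← hS.apply_add ht hs, add_comm]

theorem norm_apply_le {t : ℝ} (ht : 0 ≤ t) (x : V) : ‖S t x‖ ≤ ‖x‖ := by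
  simpa using (S t).le_of_opNorm_le (hS.norm_le t ht) x

theorem continuousOn_apply (x : V) : ContinuousOn (fun t => S t x) (Ici 0) :=
  strong_continuousOn hS.zero hS.add (hS.strong_cont x) Subset.rfl hS.norm_le

theorem norm_sub_le {γ s t : ℝ} (h0 : 0 ≤ γ) (h1 : γ ≤ 1) (hs : 0 < s) (hst : s ≤ t) :
    ‖S t - S s‖ ≤ (t - s) ^ γ * s ^ (-γ) := by
  have h := hS.smoothing γ (t - s) s h0 h1 (sub_nonneg.2 hst) hs
  have h2 := hS.add (t - s) s (sub_nonneg.2 hst) hs.le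
  rwa [ContinuousLinearMap.sub_comp, ← h2, ContinuousLinearMap.id_comp, sub_add_cancel] at h

theorem continuousOn_norm : ContinuousOn S (Ioi 0) := by
  intro s hs
  rw [mem_Ioi] at hs
  refine ContinuousAt.continuousWithinAt ?_
  rw [ContinuousAt, tendsto_iff_norm_sub_tendsto_zero]
  have h2 : Tendsto (fun t => |t - s| * (s / 2)⁻¹) (𝓝 s) (𝓝 0) := by
    have : Continuous fun t : ℝ => |t - s| * (s / 2)⁻¹ := by fun_prop
    simpa using this.tendsto s
  refine squeeze_zero' (Eventually.of_forall fun t => norm_nonneg _) ?_ h2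
  filter_upwards [lt_mem_nhds (half_lt_self hs)] with t ht
  have ht0 : 0 < t := lt_trans (by linarith) ht
  rcases le_total s t with h | h
  · have := hS.norm_sub_le zero_le_one le_rfl hs h
    rw [Real.rpow_one, Real.rpow_neg_one] at this
    rw [abs_of_nonneg (sub_nonneg.2 h)]
    refine this.trans (mul_le_mul_of_nonneg_left ?_ (sub_nonneg.2 h))
    exact inv_anti₀ (by linarith) (by linarith)
  · have := hS.norm_sub_le zero_le_one le_rfl ht0 h
    rw [Real.rpow_one, Real.rpow_neg_one] at this
    rw [norm_sub_rev, abs_sub_comm, abs_of_nonneg (sub_nonneg.2 h)]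
    refine this.trans (mul_le_mul_of_nonneg_left ?_ (sub_nonneg.2 h))
    exact inv_anti₀ (by linarith) ht.le

/-- Splitting S(x) into two halves lets each difference use its own smoothing factor. The halving
costs 2^(κ+γ) ≤ 4. -/
theorem norm_double_le {κ γ h k x : ℝ} (hκ0 : 0 ≤ κ) (hκ1 : κ ≤ 1) (hγ0 : 0 ≤ γ) (hγ1 : γ ≤ 1)
    (hh : 0 ≤ h) (hk : 0 ≤ k) (hx : 0 < x) :
    ‖(S h - ContinuousLinearMap.id ℝ V).comp (S (x + k) - S x)‖ ≤
      4 * h ^ κ * (x ^ (-κ - γ) * k ^ γ) := by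
  have hx2 : 0 < x / 2 := by linarith
  have e1 : S (x + k) - S x =
      (S (x / 2)).comp ((S k - ContinuousLinearMap.id ℝ V).comp (S (x / 2))) := by
    ext v
    simp only [sub_apply, ContinuousLinearMap.comp_apply,
      ContinuousLinearMap.id_apply, map_sub]
    rw [hS.comm_apply hk hx2.le, ← hS.apply_add hx2.le hx2.le, ← hS.apply_add hx2.le hx2.le,
      add_halves, ← hS.apply_add hx.le hk]
  have e2 : (x / 2) ^ (-κ) * (x / 2) ^ (-γ) ≤ 4 * x ^ (-κ - γ) := by
    rw [← Real.rpow_add hx2, Real.div_rpow hx.le zero_le_two, ← sub_eq_add_neg, div_eq_mul_inv,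
      ← Real.rpow_neg zero_le_two, mul_comm]
    refine mul_le_mul_of_nonneg_right ?_ (Real.rpow_nonneg hx.le _)
    calc (2 : ℝ) ^ (-(-κ - γ)) ≤ 2 ^ (2 : ℝ) :=
          Real.rpow_le_rpow_of_exponent_le one_le_two (by linarith)
      _ = 4 := by norm_num
  rw [e1, ← ContinuousLinearMap.comp_assoc]
  calc _ ≤ (h ^ κ * (x / 2) ^ (-κ)) * (k ^ γ * (x / 2) ^ (-γ)) :=
        (ContinuousLinearMap.opNorm_comp_le _ _).trans (mul_le_mul
          (hS.smoothing κ h _ hκ0 hκ1 hh hx2) (hS.smoothing γ k _ hγ0 hγ1 hk hx2) (norm_nonneg _)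
          (mul_nonneg (Real.rpow_nonneg hh _) (Real.rpow_nonneg hx2.le _)))
    _ = h ^ κ * k ^ γ * ((x / 2) ^ (-κ) * (x / 2) ^ (-γ)) := by ring
    _ ≤ h ^ κ * k ^ γ * (4 * x ^ (-κ - γ)) := mul_le_mul_of_nonneg_left e2
        (mul_nonneg (Real.rpow_nonneg hh _) (Real.rpow_nonneg hk _))
    _ = _ := by ring

end SmoothingSemigroup

end Semigroup

/-! ### Estimates for stochastic and deterministic convolutions -/

/-- Admissible exponents: `δ` is a small quantity which measures the available gain. -/
structure Exponents (α β β' δ : ℝ) : Prop where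
  pos : 0 < δ
  le_alpha : δ ≤ α
  alpha_beta : α + 2 * δ ≤ β
  beta_beta' : β + 4 * δ ≤ β'
  beta'_lt : β' < 1
  alpha_gt : 1 - α < β'

section Convolution

/-- The bounds encoded in the exponentially weighted norm of `C^β_β([0, T], X)`. -/
def WBound {X : Type*} [NormedAddCommGroup X] (β T ρ U : ℝ) (f : ℝ → X) : Prop :=
  (∀ t ∈ Icc 0 T, ‖f t‖ ≤ Real.exp (ρ * t) * U) ∧
    ∀ s t : ℝ, 0 < s → s < t → t ≤ T →
      s ^ β * ‖f t - f s‖ ≤ Real.exp (ρ * t) * U * (t - s) ^ β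

theorem WBound.nonneg {X : Type*} [NormedAddCommGroup X] {β T ρ U : ℝ} {f : ℝ → X}
    (h : WBound β T ρ U f) (hT : 0 ≤ T) : 0 ≤ U := by
  have := (norm_nonneg _).trans (h.1 0 ⟨le_rfl, hT⟩)
  simpa using this

/-- The source of all smallness: a factor ρ^(-δ) is gained at the price of the integrable
singularity (t-r)^(-δ). -/
theorem exp_le_exp_mul_rpow {δ ρ r t : ℝ} (hδ0 : 0 ≤ δ) (hδ1 : δ ≤ 1) (hρ : 0 < ρ) (hrt : r < t) :
    Real.exp (ρ * r) ≤ Real.exp (ρ * t) * ρ ^ (-δ) * (t - r) ^ (-δ) := by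
  have h0 : 0 < t - r := sub_pos.2 hrt
  have h := exp_neg_le_rpow_neg (mul_pos hρ h0) hδ0 hδ1
  rw [Real.mul_rpow hρ.le h0.le] at h
  calc Real.exp (ρ * r) = Real.exp (ρ * t) * Real.exp (-(ρ * (t - r))) := by
        rw [← Real.exp_add]; congr 1; ring
    _ ≤ Real.exp (ρ * t) * (ρ ^ (-δ) * (t - r) ^ (-δ)) :=
        mul_le_mul_of_nonneg_left h (Real.exp_pos _).le
    _ = _ := by ring

theorem rpow_le_mul_rpow {x T a b : ℝ} (hx : 0 < x) (hxT : x ≤ T) (hT : 1 ≤ T) (hab : a ≤ b)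
    (hba : b ≤ a + 1) : x ^ b ≤ T * x ^ a := by
  rw [show b = (b - a) + a by ring, Real.rpow_add hx]
  exact mul_le_mul_of_nonneg_right (rpow_le_of_le_one hx.le hxT hT (by linarith) (by linarith))
    (Real.rpow_nonneg hx.le _)

variable {V : Type*} [NormedAddCommGroup V] [InnerProductSpace ℝ V]

/-- The exponent -κ-α-2δ is that of the Hölder constant of P, -κ-(α+δ), lowered by the δ spent on
the exponential weight. The product rule gives two terms, whence the factor 2, and T² absorbs
surplus powers. -/
theorem leftBound_comp {α β β' δ κ T ρ Q c s : ℝ} (hx : Exponents α β β' δ) (hT : 1 ≤ T)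
    (hρ : 0 < ρ) (hs : s ≤ T) (hc : 0 ≤ c) {P Γ : ℝ → V →L[ℝ] V}
    (hP0 : ∀ r ∈ Ioo 0 s, ‖P r‖ ≤ c * (s - r) ^ (-κ))
    (hP1 : ∀ q r, 0 < q → q < r → r < s →
      ‖P r - P q‖ ≤ c * ((s - r) ^ (-κ - (α + δ)) * (r - q) ^ (α + δ)))
    (hΓ : WBound β T ρ Q Γ) {r : ℝ} (hr : r ∈ Ioo 0 s) :
    LeftBound α β δ (2 * T ^ 2 * c * (Real.exp (ρ * s) * ρ ^ (-δ) * Q) *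
      (s - r) ^ (-κ - α - 2 * δ)) (fun q => (P q).comp (Γ q)) r := by
  obtain ⟨hδ, hδα, hαβ, hββ, hβ1, -⟩ := hx
  have hT0 : 0 < T := by linarith
  have hQ : 0 ≤ Q := hΓ.nonneg hT0.le
  have h0 : 0 < s - r := sub_pos.2 hr.2
  have h0T : s - r ≤ T := by linarith [hr.1]
  have hE := exp_le_exp_mul_rpow hδ.le (by linarith : δ ≤ 1) hρ hr.2
  set E := Real.exp (ρ * s) * ρ ^ (-δ) with hEdef
  have hE0 : 0 ≤ E := mul_nonneg (Real.exp_pos _).le (Real.rpow_nonneg hρ.le _)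
  set D := (s - r) ^ (-κ - α - 2 * δ) with hD
  have hD0 : 0 ≤ D := Real.rpow_nonneg h0.le _
  have e1 : (s - r) ^ (-κ) * (s - r) ^ (-δ) ≤ T * D := by
    rw [← Real.rpow_add h0]
    exact rpow_le_mul_rpow h0 h0T hT (by linarith) (by linarith)
  have e2 : (s - r) ^ (-κ - (α + δ)) * (s - r) ^ (-δ) = D := by
    rw [← Real.rpow_add h0]; congr 1; ring
  have hPΓ : ‖P r‖ * (Real.exp (ρ * r) * Q) ≤ T * c * (E * Q) * D :=
    calc _ ≤ (c * (s - r) ^ (-κ)) * ((E * (s - r) ^ (-δ)) * Q) := by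
          gcongr
          exact hP0 r hr
      _ = c * (E * Q) * ((s - r) ^ (-κ) * (s - r) ^ (-δ)) := by ring
      _ ≤ c * (E * Q) * (T * D) := by gcongr
      _ = _ := by ring
  have hTT : T ≤ T ^ 2 := by nlinarith
  refine ⟨?_, fun q hq => ?_⟩
  · calc ‖(P r).comp (Γ r)‖ ≤ ‖P r‖ * ‖Γ r‖ := ContinuousLinearMap.opNorm_comp_le _ _
      _ ≤ ‖P r‖ * (Real.exp (ρ * r) * Q) :=
          mul_le_mul_of_nonneg_left (hΓ.1 r ⟨hr.1.le, hr.2.le.trans hs⟩) (norm_nonneg _)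
      _ ≤ T * c * (E * Q) * D := hPΓ
      _ ≤ _ := by
          have : 0 ≤ c * (E * Q) * D := by positivity
          nlinarith
  · have hrq : 0 < r - q := sub_pos.2 hq.2
    have hqb : 0 < q ^ β := Real.rpow_pos_of_pos hq.1 _
    have hΓq : ‖Γ q‖ ≤ Real.exp (ρ * r) * Q := by
      refine (hΓ.1 q ⟨hq.1.le, by linarith [hq.2, hr.2]⟩).trans ?_
      have : ρ * q ≤ ρ * r := mul_le_mul_of_nonneg_left hq.2.le hρ.le
      gcongr
    have hΓrq : ‖Γ r - Γ q‖ ≤ Real.exp (ρ * r) * Q * (q ^ (-β) * (r - q) ^ β) := by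
      have := hΓ.2 q r hq.1 hq.2 (by linarith [hr.2])
      rw [Real.rpow_neg hq.1.le]
      calc ‖Γ r - Γ q‖ = (q ^ β)⁻¹ * (q ^ β * ‖Γ r - Γ q‖) := by
            rw [← mul_assoc, inv_mul_cancel₀ hqb.ne', one_mul]
        _ ≤ (q ^ β)⁻¹ * (Real.exp (ρ * r) * Q * (r - q) ^ β) :=
            mul_le_mul_of_nonneg_left this (inv_nonneg.2 hqb.le)
        _ = _ := by ring
    have hq1 : 1 ≤ T * q ^ (-β) := by
      rw [Real.rpow_neg hq.1.le, ← div_eq_mul_inv, one_le_div hqb]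
      exact rpow_le_of_le_one hq.1.le (by linarith [hq.2, hr.2]) hT (by linarith) (by linarith)
    have hr1 : (r - q) ^ β ≤ T * (r - q) ^ (α + δ) :=
      rpow_le_mul_rpow hrq (by linarith [hq.1, hr.2]) hT (by linarith) (by linarith)
    -- The first summand uses the weighted Hölder bound of Γ and the size of P; the second uses the
    -- Hölder bound of P and the size of Γ.
    have hdec : (P r).comp (Γ r) - (P q).comp (Γ q) =
        (P r).comp (Γ r - Γ q) + (P r - P q).comp (Γ q) := by
      rw [ContinuousLinearMap.comp_sub, ContinuousLinearMap.sub_comp]; abel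
    have b1 : ‖(P r).comp (Γ r - Γ q)‖ ≤
        T ^ 2 * c * (E * Q) * D * (q ^ (-β) * (r - q) ^ (α + δ)) :=
      calc _ ≤ ‖P r‖ * ‖Γ r - Γ q‖ := ContinuousLinearMap.opNorm_comp_le _ _
        _ ≤ ‖P r‖ * (Real.exp (ρ * r) * Q * (q ^ (-β) * (r - q) ^ β)) :=
            mul_le_mul_of_nonneg_left hΓrq (norm_nonneg _)
        _ = ‖P r‖ * (Real.exp (ρ * r) * Q) * (q ^ (-β) * (r - q) ^ β) := by ring
        _ ≤ (T * c * (E * Q) * D) * (q ^ (-β) * (T * (r - q) ^ (α + δ))) := by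
            have := Real.rpow_nonneg hq.1.le (-β)
            gcongr
        _ = _ := by ring
    have b2 : ‖(P r - P q).comp (Γ q)‖ ≤
        T ^ 2 * c * (E * Q) * D * (q ^ (-β) * (r - q) ^ (α + δ)) :=
      calc _ ≤ ‖P r - P q‖ * ‖Γ q‖ := ContinuousLinearMap.opNorm_comp_le _ _
        _ ≤ (c * ((s - r) ^ (-κ - (α + δ)) * (r - q) ^ (α + δ))) *
              ((E * (s - r) ^ (-δ)) * Q) := by
            have h1 := hP1 q r hq.1 hq.2 hr.2
            have h2 : ‖Γ q‖ ≤ (E * (s - r) ^ (-δ)) * Q :=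
              hΓq.trans (mul_le_mul_of_nonneg_right hE hQ)
            exact mul_le_mul h1 h2 (norm_nonneg _) ((norm_nonneg _).trans h1)
        _ = c * (E * Q) * ((s - r) ^ (-κ - (α + δ)) * (s - r) ^ (-δ)) * (r - q) ^ (α + δ) := by
            ring
        _ = 1 * (c * (E * Q) * D * (r - q) ^ (α + δ)) := by rw [e2]; ring
        _ ≤ (T * q ^ (-β)) * (c * (E * Q) * D * (r - q) ^ (α + δ)) := by gcongr
        _ = T * (c * (E * Q) * D * (q ^ (-β) * (r - q) ^ (α + δ))) := by ring
        _ ≤ T ^ 2 * (c * (E * Q) * D * (q ^ (-β) * (r - q) ^ (α + δ))) := by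
            have := Real.rpow_nonneg hq.1.le (-β)
            gcongr
        _ = _ := by ring
    rw [hdec]
    calc _ ≤ _ := norm_add_le _ _
      _ ≤ _ := add_le_add b1 b2
      _ = _ := by ring

/-- The data shared by all estimates of the integral of `P Γ` against `w` on `[0, s]`. -/
structure ConvData (α β β' δ κ T ρ Q W c s : ℝ) (P Γ : ℝ → V →L[ℝ] V) (w : ℝ → V) : Prop where
  exps : Exponents α β β' δ
  one_le : 1 ≤ T
  rho_pos : 0 < ρ
  nonneg : 0 ≤ s
  le : s ≤ T
  c_nonneg : 0 ≤ c
  bound : ∀ r ∈ Ioo 0 s, ‖P r‖ ≤ c * (s - r) ^ (-κ)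
  holder : ∀ q r, 0 < q → q < r → r < s →
      ‖P r - P q‖ ≤ c * ((s - r) ^ (-κ - (α + δ)) * (r - q) ^ (α + δ))
  cont : ContinuousOn P (Ioo 0 s)
  wbound : WBound β T ρ Q Γ
  wcont : ContinuousOn Γ (Icc 0 T)
  path_cont : Continuous w
  path : HolderBound β' T W w
  path_nonneg : 0 ≤ W

namespace ConvData

variable {α β β' δ κ T ρ Q W c s : ℝ} {P Γ : ℝ → V →L[ℝ] V} {w : ℝ → V}

theorem continuousOn_comp (h : ConvData α β β' δ κ T ρ Q W c s P Γ w) :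
    ContinuousOn (fun q => (P q).comp (Γ q)) (Ioo 0 s) :=
  h.cont.clm_comp (h.wcont.mono fun _ hq => ⟨hq.1.le, hq.2.le.trans h.le⟩)

theorem leftBound (h : ConvData α β β' δ κ T ρ Q W c s P Γ w) {r : ℝ} (hr : r ∈ Ioo 0 s) :
    LeftBound α β δ (2 * T ^ 2 * c * (Real.exp (ρ * s) * ρ ^ (-δ) * Q) *
      (s - r) ^ (-κ - α - 2 * δ)) (fun q => (P q).comp (Γ q)) r :=
  leftBound_comp h.exps h.one_le h.rho_pos h.le h.c_nonneg h.bound h.holder h.wbound hr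

theorem inner_integrable (h : ConvData α β β' δ κ T ρ Q W c s P Γ w) {r : ℝ} (hr : r ∈ Ioo 0 s) :
    IntervalIntegrable (fun q => ((r - q) ^ (1 + α))⁻¹ •
      ((P r).comp (Γ r) - (P q).comp (Γ q))) volume 0 r := by
  have := h.exps.beta_beta'
  have := h.exps.beta'_lt
  have := h.exps.pos
  exact intervalIntegrable_leftD_integrand (g := fun q => (P q).comp (Γ q)) (by linarith)
    h.exps.pos h.continuousOn_comp hr (h.leftBound hr)

theorem norm_leftD_le (h : ConvData α β β' δ κ T ρ Q W c s P Γ w) {r : ℝ} (hr : r ∈ Ioo 0 s) :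
    ‖leftD α (fun q => (P q).comp (Γ q)) r‖ ≤ leftConst α β δ T * (2 * T ^ 2 * c *
      (Real.exp (ρ * s) * ρ ^ (-δ) * Q)) * ((s - r) ^ (-κ - α - 2 * δ) * r ^ (-β)) := by
  obtain ⟨hδ, hδα, hαβ, hββ, hβ1, -⟩ := h.exps
  refine (RoughEvolution.norm_leftD_le (by linarith) (by linarith) (by linarith) hδ (by linarith)
    hr.1 (hr.2.le.trans h.le) h.one_le (h.leftBound hr)).trans (le_of_eq ?_)
  ring

/-- The constant in the bound of the integrand. -/
def const (α β β' δ T ρ Q W c s : ℝ) : ℝ :=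
  leftConst α β δ T * rightConst α β' * (2 * T ^ 2) *
    (c * (W * Q * ρ ^ (-δ) * Real.exp (ρ * s)))

theorem const_nonneg (h : ConvData α β β' δ κ T ρ Q W c s P Γ w) :
    0 ≤ const α β β' δ T ρ Q W c s := by
  obtain ⟨hδ, hδα, hαβ, hββ, hβ1, hα1⟩ := h.exps
  have hT := h.one_le
  have h1 := leftConst_nonneg (α := α) (β := β) (δ := δ) (T := T) (by linarith) (by linarith)
  have h2 := rightConst_nonneg (α := α) (γ := β') (by linarith) (by linarith)
  have h3 := h.wbound.nonneg (by linarith)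
  have h4 := h.path_nonneg
  have h5 := h.c_nonneg
  have h6 := Real.rpow_nonneg h.rho_pos.le (-δ)
  unfold const
  positivity

/-- The powers of s - r add up to (-κ-α-2δ) + (β'+α-1), so α drops out and a Beta kernel remains. -/
theorem integrand_le (h : ConvData α β β' δ κ T ρ Q W c s P Γ w) {r : ℝ} (hr : r ∈ Ioo 0 s) :
    ‖leftD α (fun q => (P q).comp (Γ q)) r‖ * ‖pathD α s w r‖ ≤ const α β β' δ T ρ Q W c s *
      (r ^ ((1 - β) - 1) * (s - r) ^ ((β' - κ - 2 * δ) - 1)) := by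
  obtain ⟨hδ, hδα, hαβ, hββ, hβ1, hα1⟩ := h.exps
  have h0 : 0 < s - r := sub_pos.2 hr.2
  have h1 := h.norm_leftD_le hr
  have h2 := norm_pathD_le (by linarith : α ≤ 1) hα1 h.path hr.1.le hr.2 h.le
  have h3 : (s - r) ^ ((β' - κ - 2 * δ) - 1) =
      (s - r) ^ (-κ - α - 2 * δ) * (s - r) ^ (β' + α - 1) := by
    rw [← Real.rpow_add h0]; congr 1; ring
  calc _ ≤ _ := mul_le_mul h1 h2 (norm_nonneg _) ((norm_nonneg _).trans h1)
    _ = _ := by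
      rw [h3, show (1 - β) - 1 = -β by ring, const]; ring

/-- The bound κ ≤ β + δ leaves β' - κ - 2δ ≥ δ, which is the reason for asking β + 4δ ≤ β'. -/
theorem integrable_bound (h : ConvData α β β' δ κ T ρ Q W c s P Γ w) (hκ : κ ≤ β + δ) :
    IntervalIntegrable (fun r => const α β β' δ T ρ Q W c s *
      (r ^ ((1 - β) - 1) * (s - r) ^ ((β' - κ - 2 * δ) - 1))) volume 0 s := by
  obtain ⟨hδ, hδα, hαβ, hββ, hβ1, hα1⟩ := h.exps
  exact (intervalIntegrable_beta (by linarith) (by linarith) h.nonneg).const_mul _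

theorem integrable (h : ConvData α β β' δ κ T ρ Q W c s P Γ w) (hκ : κ ≤ β + δ) :
    IntervalIntegrable (fun r => leftD α (fun q => (P q).comp (Γ q)) r (pathD α s w r))
      volume 0 s :=
  intervalIntegrable_of_Ioo h.nonneg
    (aestronglyMeasurable_leftD_pathD le_rfl h.continuousOn_comp h.path_cont)
    (fun _ hr => (ContinuousLinearMap.le_opNorm _ _).trans (h.integrand_le hr))
    (h.integrable_bound hκ)

theorem norm_fracIntegral_le (h : ConvData α β β' δ κ T ρ Q W c s P Γ w) (hκ : κ ≤ β + δ) :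
    ‖fracIntegral α s (fun q => (P q).comp (Γ q)) w‖ ≤ const α β β' δ T ρ Q W c s *
      betaConst (1 - β) (β' - κ - 2 * δ) * s ^ (β' - β - κ - 2 * δ) := by
  obtain ⟨hδ, hδα, hαβ, hββ, hβ1, hα1⟩ := h.exps
  rw [fracIntegral, norm_neg]
  refine (norm_integral_le_beta (by linarith) (by linarith) h.nonneg h.const_nonneg
    fun r hr => (ContinuousLinearMap.le_opNorm _ _).trans (h.integrand_le hr)).trans (le_of_eq ?_)
  congr 2
  ring

end ConvData

end Convolution

/-! ### Convolution against a path: kernels and the increment formula. -/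

section ConvolutionBounds

variable {V : Type*} [NormedAddCommGroup V] [InnerProductSpace ℝ V]

/-- The regularity gained by a convolution with the semigroup `S`: decay at zero, uniform
closeness to its regularisation by `S h`, and weighted Hölder continuity. -/
structure ConvBound (S : ℝ → V →L[ℝ] V) (β δ T ρ K : ℝ) (v : ℝ → V) : Prop where
  norm_le : ∀ t ∈ Icc 0 T, ‖v t‖ ≤ K * Real.exp (ρ * t) * t ^ δ
  regular : ∀ s ∈ Ioc 0 T, ∀ h, 0 ≤ h →
    s ^ β * ‖S h (v s) - v s‖ ≤ K * Real.exp (ρ * s) * h ^ (β + δ)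
  incr : ∀ s t, 0 < s → s < t → t ≤ T →
    s ^ β * ‖v t - v s‖ ≤ K * Real.exp (ρ * t) * (t - s) ^ (β + δ)

/-- The convolution of `Γ` with the semigroup, integrated against `w`. -/
def youngConv (S : ℝ → V →L[ℝ] V) (α : ℝ) (Γ : ℝ → V →L[ℝ] V) (w : ℝ → V) (t : ℝ) : V :=
  fracIntegral α t (fun r => (S (t - r)).comp (Γ r)) w

variable {S : ℝ → V →L[ℝ] V} {α β β' δ T ρ Q W s t h : ℝ} {Γ : ℝ → V →L[ℝ] V} {w : ℝ → V}

theorem continuousOn_semigroup_sub (hS : SmoothingSemigroup S) (s : ℝ) :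
    ContinuousOn (fun r => S (s - r)) (Iio s) :=
  hS.continuousOn_norm.comp (by fun_prop) fun _ hr => sub_pos.2 (mem_Iio.1 hr)

theorem convData_semigroup (hx : Exponents α β β' δ) (hS : SmoothingSemigroup S) (hT : 1 ≤ T)
    (hρ : 0 < ρ) (hs : 0 ≤ s) (hsT : s ≤ T) (hΓ : WBound β T ρ Q Γ)
    (hΓc : ContinuousOn Γ (Icc 0 T)) (hwc : Continuous w) (hw : HolderBound β' T W w)
    (hW : 0 ≤ W) :
    ConvData α β β' δ 0 T ρ Q W 1 s (fun r => S (s - r)) Γ w where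
  exps := hx
  one_le := hT
  rho_pos := hρ
  nonneg := hs
  le := hsT
  c_nonneg := zero_le_one
  bound r hr := by simpa using hS.norm_le (s - r) (by linarith [hr.2])
  holder q r _ hqr hrs := by
    obtain ⟨hδ, hδα, hαβ, hββ, hβ1, -⟩ := hx
    have h := hS.norm_sub_le (γ := α + δ) (s := s - r) (t := s - q) (by linarith) (by linarith)
      (by linarith) (by linarith)
    rw [norm_sub_rev, one_mul, neg_zero, zero_sub, mul_comm]
    convert h using 2
    congr 1
    ring
  cont := (continuousOn_semigroup_sub hS s).mono fun _ hr => hr.2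
  wbound := hΓ
  wcont := hΓc
  path_cont := hwc
  path := hw
  path_nonneg := hW

/-- Regularisation by S(h) is a convolution with the kernel (S(h) - 1)S(s-r). It is small of order
h^(β+δ) but more singular, with κ = β + δ; `norm_double_le` supplies its Hölder bound and the factor
4. -/
theorem convData_semigroup_sub (hx : Exponents α β β' δ) (hS : SmoothingSemigroup S) (hT : 1 ≤ T)
    (hρ : 0 < ρ) (hs : 0 ≤ s) (hsT : s ≤ T) (hh : 0 ≤ h) (hΓ : WBound β T ρ Q Γ)
    (hΓc : ContinuousOn Γ (Icc 0 T)) (hwc : Continuous w) (hw : HolderBound β' T W w)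
    (hW : 0 ≤ W) :
    ConvData α β β' δ (β + δ) T ρ Q W (4 * h ^ (β + δ)) s
      (fun r => (S h - ContinuousLinearMap.id ℝ V).comp (S (s - r))) Γ w where
  exps := hx
  one_le := hT
  rho_pos := hρ
  nonneg := hs
  le := hsT
  c_nonneg := mul_nonneg (by norm_num) (Real.rpow_nonneg hh _)
  bound r hr := by
    obtain ⟨hδ, hδα, hαβ, hββ, hβ1, -⟩ := hx
    have h0 : 0 < s - r := sub_pos.2 hr.2
    refine (hS.smoothing (β + δ) h (s - r) (by linarith) (by linarith) hh h0).trans ?_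
    refine mul_le_mul_of_nonneg_right ?_ (Real.rpow_nonneg h0.le _)
    linarith [Real.rpow_nonneg hh (β + δ)]
  holder q r _ hqr hrs := by
    obtain ⟨hδ, hδα, hαβ, hββ, hβ1, -⟩ := hx
    have h := hS.norm_double_le (κ := β + δ) (γ := α + δ) (h := h) (k := r - q) (x := s - r)
      (by linarith) (by linarith) (by linarith) (by linarith) hh (by linarith) (by linarith)
    rw [← ContinuousLinearMap.comp_sub, ← neg_sub (S (s - q)), ContinuousLinearMap.comp_neg,
      norm_neg]
    rwa [show s - r + (r - q) = s - q by ring] at h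
  cont := continuousOn_const.clm_comp
    ((continuousOn_semigroup_sub hS s).mono fun _ hr => hr.2)
  wbound := hΓ
  wcont := hΓc
  path_cont := hwc
  path := hw
  path_nonneg := hW

theorem leftD_congr {X : Type*} [NormedAddCommGroup X] [NormedSpace ℝ X] {f g : ℝ → X} {r : ℝ}
    (hr : 0 ≤ r) (hfg : ∀ q ∈ Icc 0 r, f q = g q) : leftD α f r = leftD α g r := by
  have h : ∫ q in (0 : ℝ)..r, ((r - q) ^ (1 + α))⁻¹ • (f r - f q) =
      ∫ q in (0 : ℝ)..r, ((r - q) ^ (1 + α))⁻¹ • (g r - g q) :=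
    integral_congr_Ioo hr fun q hq => by
      rw [hfg r ⟨hr, le_rfl⟩, hfg q ⟨hq.1.le, hq.2.le⟩]
  rw [leftD, leftD, h, hfg r ⟨hr, le_rfl⟩]

variable [CompleteSpace V]

theorem leftD_comp_left {P Γ : ℝ → V →L[ℝ] V} {r : ℝ} (L : V →L[ℝ] V)
    (hi : IntervalIntegrable (fun q => ((r - q) ^ (1 + α))⁻¹ •
      ((P r).comp (Γ r) - (P q).comp (Γ q))) volume 0 r) :
    leftD α (fun q => (L.comp (P q)).comp (Γ q)) r =
      L.comp (leftD α (fun q => (P q).comp (Γ q)) r) := by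
  have h := leftD_clm (ContinuousLinearMap.compL ℝ V V V L) (g := fun q => (P q).comp (Γ q)) hi
  simp only [ContinuousLinearMap.compL_apply] at h
  simp only [ContinuousLinearMap.comp_assoc]
  exact h

/-- A bounded operator passes through the fractional derivative and the integral. The case of
interest is L = S(h) - 1. -/
theorem semigroup_youngConv_sub (hx : Exponents α β β' δ) (hS : SmoothingSemigroup S) (hT : 1 ≤ T)
    (hρ : 0 < ρ) (hs : 0 ≤ s) (hsT : s ≤ T) (hΓ : WBound β T ρ Q Γ)
    (hΓc : ContinuousOn Γ (Icc 0 T)) (hwc : Continuous w) (hw : HolderBound β' T W w)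
    (hW : 0 ≤ W) (L : V →L[ℝ] V) :
    fracIntegral α s (fun r => (L.comp (S (s - r))).comp (Γ r)) w = L (youngConv S α Γ w s) := by
  have hd := convData_semigroup hx hS hT hρ hs hsT hΓ hΓc hwc hw hW
  have hκ : (0 : ℝ) ≤ β + δ := by linarith [hx.pos, hx.alpha_beta, hx.le_alpha]
  have hi : IntervalIntegrable (fun r => leftD α (fun q => (S (s - q)).comp (Γ q)) r
      (pathD α s w r)) volume 0 s := hd.integrable hκ
  rw [youngConv, fracIntegral, fracIntegral, map_neg, ← integral_clm_comp L hi]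
  congr 1
  refine integral_congr_Ioo hs fun r hr => ?_
  rw [leftD_comp_left (P := fun q => S (s - q)) L (hd.inner_integrable hr), ContinuousLinearMap.comp_apply]

/-- Before time s the kernel for t is S(t-s) times the kernel for s. Replacing there the right
derivative at t by the one at s produces S(t-s) applied to the convolution at s, plus the last
integral as correction; the times after s give the middle integral. -/
theorem youngConv_sub (hx : Exponents α β β' δ) (hS : SmoothingSemigroup S) (hT : 1 ≤ T)
    (hρ : 0 < ρ) (hs : 0 ≤ s) (hst : s ≤ t) (htT : t ≤ T) (hΓ : WBound β T ρ Q Γ)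
    (hΓc : ContinuousOn Γ (Icc 0 T)) (hwc : Continuous w) (hw : HolderBound β' T W w)
    (hW : 0 ≤ W) :
    youngConv S α Γ w t - youngConv S α Γ w s =
      (S (t - s) (youngConv S α Γ w s) - youngConv S α Γ w s) -
      (∫ r in s..t, leftD α (fun q => (S (t - q)).comp (Γ q)) r (pathD α t w r)) -
      ∫ r in (0 : ℝ)..s, leftD α (fun q => (S (t - q)).comp (Γ q)) r
        (pathD α t w r - pathD α s w r) := by
  have hds := convData_semigroup hx hS hT hρ hs (hst.trans htT) hΓ hΓc hwc hw hW
  have hdt := convData_semigroup hx hS hT hρ (hs.trans hst) htT hΓ hΓc hwc hw hW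
  have hκ : (0 : ℝ) ≤ β + δ := by linarith [hx.pos, hx.alpha_beta, hx.le_alpha]
  have it : IntervalIntegrable (fun r => leftD α (fun q => (S (t - q)).comp (Γ q)) r
      (pathD α t w r)) volume 0 t := hdt.integrable hκ
  have is : IntervalIntegrable (fun r => leftD α (fun q => (S (s - q)).comp (Γ q)) r
      (pathD α s w r)) volume 0 s := hds.integrable hκ
  have it1 := it.mono_set (show uIcc 0 s ⊆ uIcc 0 t by
    rw [uIcc_of_le hs, uIcc_of_le (hs.trans hst)]; exact Icc_subset_Icc_right hst)
  have it2 := it.mono_set (show uIcc s t ⊆ uIcc 0 t by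
    rw [uIcc_of_le hst, uIcc_of_le (hs.trans hst)]; exact Icc_subset_Icc_left hs)
  have hD : ∀ r ∈ Ioo 0 s, leftD α (fun q => (S (t - q)).comp (Γ q)) r =
      (S (t - s)).comp (leftD α (fun q => (S (s - q)).comp (Γ q)) r) := fun r hr => by
    rw [← leftD_comp_left (P := fun q => S (s - q)) (S (t - s)) (hds.inner_integrable hr)]
    refine leftD_congr hr.1.le fun q hq => ?_
    rw [← hS.add (t - s) (s - q) (by linarith) (by linarith [hq.2, hr.2])]
    congr 2
    ring
  have h1 : ∫ r in (0 : ℝ)..s, leftD α (fun q => (S (t - q)).comp (Γ q)) r (pathD α s w r) =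
      S (t - s) (-youngConv S α Γ w s) := by
    rw [youngConv, fracIntegral, neg_neg, ← integral_clm_comp (S (t - s)) is]
    refine integral_congr_Ioo hs fun r hr => ?_
    rw [hD r hr, ContinuousLinearMap.comp_apply]
  have i3 : IntervalIntegrable (fun r => leftD α (fun q => (S (t - q)).comp (Γ q)) r
      (pathD α s w r)) volume 0 s := by
    have h := (intervalIntegrable_iff_integrableOn_Ioo_of_le hs).1 is
    rw [intervalIntegrable_iff_integrableOn_Ioo_of_le hs]
    have h2 : IntegrableOn (fun r => S (t - s) (leftD α (fun q => (S (s - q)).comp (Γ q)) r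
      (pathD α s w r))) (Ioo 0 s) := (S (t - s)).integrable_comp h
    refine h2.congr_fun (fun r hr => ?_) measurableSet_Ioo
    simp only
    rw [hD r hr, ContinuousLinearMap.comp_apply]
  have h2 : ∫ r in (0 : ℝ)..s, leftD α (fun q => (S (t - q)).comp (Γ q)) r
      (pathD α t w r - pathD α s w r) =
      (∫ r in (0 : ℝ)..s, leftD α (fun q => (S (t - q)).comp (Γ q)) r (pathD α t w r)) -
        S (t - s) (-youngConv S α Γ w s) := by
    rw [← h1, ← intervalIntegral.integral_sub it1 i3]
    simp only [map_sub]
  have h3 : youngConv S α Γ w t =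
      -((∫ r in (0 : ℝ)..s, leftD α (fun q => (S (t - q)).comp (Γ q)) r (pathD α t w r)) +
      ∫ r in s..t, leftD α (fun q => (S (t - q)).comp (Γ q)) r (pathD α t w r)) := by
    rw [intervalIntegral.integral_add_adjacent_intervals it1 it2]
    rfl
  rw [h2, h3, map_neg]
  abel

end ConvolutionBounds

/-! ### The gain of δ in the two convolutions. -/

section ConvBounds

variable {V : Type*} [NormedAddCommGroup V] [InnerProductSpace ℝ V]

theorem rpow_le_mul_rpow_of_nonneg {x T a b : ℝ} (hx : 0 ≤ x) (hxT : x ≤ T) (hT : 1 ≤ T)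
    (ha : 0 < a) (hab : a ≤ b) (hba : b ≤ a + 1) : x ^ b ≤ T * x ^ a := by
  rcases hx.eq_or_lt with rfl | hx
  · rw [Real.zero_rpow (by linarith), Real.zero_rpow (by linarith), mul_zero]
  · exact rpow_le_mul_rpow hx hxT hT hab hba

theorem ConvBound.mono {S : ℝ → V →L[ℝ] V} {β δ T ρ K K' : ℝ} {v : ℝ → V}
    (h : ConvBound S β δ T ρ K v) (hK : K ≤ K') : ConvBound S β δ T ρ K' v where
  norm_le t ht := (h.norm_le t ht).trans <| by
    have := Real.rpow_nonneg ht.1 δ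
    gcongr
  regular s hs r hr := (h.regular s hs r hr).trans <| by
    have := Real.rpow_nonneg hr (β + δ)
    gcongr
  incr s t hs hst ht := (h.incr s t hs hst ht).trans <| by
    have := Real.rpow_nonneg (sub_nonneg.2 hst.le) (β + δ)
    gcongr

theorem ConvBound.add {S : ℝ → V →L[ℝ] V} {β δ T ρ K K' : ℝ} {v v' : ℝ → V}
    (h : ConvBound S β δ T ρ K v) (h' : ConvBound S β δ T ρ K' v') :
    ConvBound S β δ T ρ (K + K') (fun t => v t + v' t) where
  norm_le t ht := (norm_add_le _ _).trans <| by
    linarith [h.norm_le t ht, h'.norm_le t ht]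
  regular s hs r hr := by
    have h1 : S r (v s + v' s) - (v s + v' s) = (S r (v s) - v s) + (S r (v' s) - v' s) := by
      rw [map_add]; abel
    have h2 := mul_le_mul_of_nonneg_left (norm_add_le (S r (v s) - v s) (S r (v' s) - v' s))
      (Real.rpow_nonneg hs.1.le β)
    rw [h1]
    linarith [h.regular s hs r hr, h'.regular s hs r hr]
  incr s t hs hst ht := by
    have h2 := mul_le_mul_of_nonneg_left (norm_add_le (v t - v s) (v' t - v' s))
      (Real.rpow_nonneg hs.le β)
    rw [add_sub_add_comm]
    linarith [h.incr s t hs hst ht, h'.incr s t hs hst ht]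

variable {S : ℝ → V →L[ℝ] V} {α β β' δ T : ℝ}

theorem exists_norm_youngConv_le (hx : Exponents α β β' δ) (hS : SmoothingSemigroup S)
    (hT : 1 ≤ T) : ∃ C, 0 ≤ C ∧ ∀ (ρ Q W : ℝ) (Γ : ℝ → V →L[ℝ] V) (w : ℝ → V), 0 < ρ →
      WBound β T ρ Q Γ → ContinuousOn Γ (Icc 0 T) → Continuous w → HolderBound β' T W w → 0 ≤ W →
      ∀ t ∈ Icc 0 T, ‖youngConv S α Γ w t‖ ≤
        C * (W * Q * ρ ^ (-δ)) * Real.exp (ρ * t) * t ^ δ := by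
  obtain ⟨hδ, hδα, hαβ, hββ, hβ1, hα1⟩ := id hx
  have h1 := leftConst_nonneg (α := α) (β := β) (δ := δ) (T := T) (by linarith) (by linarith)
  have h2 := rightConst_nonneg (α := α) (γ := β') (by linarith) (by linarith)
  have h3 := betaConst_nonneg (1 - β) (β' - 0 - 2 * δ)
  refine ⟨leftConst α β δ T * rightConst α β' * (2 * T ^ 2) *
    betaConst (1 - β) (β' - 0 - 2 * δ) * T, by positivity, ?_⟩
  intro ρ Q W Γ w hρ hΓ hΓc hwc hw hW t ht
  have hd := convData_semigroup hx hS hT hρ ht.1 ht.2 hΓ hΓc hwc hw hW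
  have hc := hd.const_nonneg
  refine (hd.norm_fracIntegral_le (by linarith)).trans ?_
  have := rpow_le_mul_rpow_of_nonneg (a := δ) (b := β' - β - 0 - 2 * δ) ht.1 ht.2 hT hδ
    (by linarith) (by linarith)
  calc _ ≤ ConvData.const α β β' δ T ρ Q W 1 t * betaConst (1 - β) (β' - 0 - 2 * δ) *
        (T * t ^ δ) := by gcongr
    _ = _ := by rw [ConvData.const]; ring

/-- On [s, t] the singularity r^(-β) is at most s^(-β), which the weight s^β cancels. What remains
has order (t-s)^(β'-2δ). -/
theorem exists_tail_youngConv_le (hx : Exponents α β β' δ) (hS : SmoothingSemigroup S)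
    (hT : 1 ≤ T) : ∃ C, 0 ≤ C ∧ ∀ (ρ Q W : ℝ) (Γ : ℝ → V →L[ℝ] V) (w : ℝ → V), 0 < ρ →
      WBound β T ρ Q Γ → ContinuousOn Γ (Icc 0 T) → Continuous w → HolderBound β' T W w → 0 ≤ W →
      ∀ s t, 0 < s → s < t → t ≤ T →
      s ^ β * ‖∫ r in s..t, leftD α (fun q => (S (t - q)).comp (Γ q)) r (pathD α t w r)‖ ≤
        C * (W * Q * ρ ^ (-δ)) * Real.exp (ρ * t) * (t - s) ^ (β + δ) := by
  obtain ⟨hδ, hδα, hαβ, hββ, hβ1, hα1⟩ := id hx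
  have h1 := leftConst_nonneg (α := α) (β := β) (δ := δ) (T := T) (by linarith) (by linarith)
  have h2 := rightConst_nonneg (α := α) (γ := β') (by linarith) (by linarith)
  have hb : 0 < β' - 0 - 2 * δ := by linarith
  refine ⟨leftConst α β δ T * rightConst α β' * (2 * T ^ 2) * (T / (β' - 0 - 2 * δ)),
    by positivity, ?_⟩
  intro ρ Q W Γ w hρ hΓ hΓc hwc hw hW s t hs hst ht
  have hd := convData_semigroup hx hS hT hρ (hs.le.trans hst.le) ht hΓ hΓc hwc hw hW
  have hc := hd.const_nonneg
  have hsβ := Real.rpow_pos_of_pos hs β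
  have key := norm_integral_le_sub_rpow (X := V) (K := ConvData.const α β β' δ T ρ Q W 1 t * s ^ (-β))
    hb hst.le (f := fun r => leftD α (fun q => (S (t - q)).comp (Γ q)) r (pathD α t w r))
    fun r hr => by
      refine (ContinuousLinearMap.le_opNorm _ _).trans
        ((hd.integrand_le ⟨hs.trans hr.1, hr.2⟩).trans ?_)
      rw [mul_assoc]
      refine mul_le_mul_of_nonneg_left (mul_le_mul_of_nonneg_right ?_
        (Real.rpow_nonneg (by linarith [hr.2]) _)) hc
      rw [show 1 - β - 1 = -β by ring]
      exact Real.rpow_le_rpow_of_nonpos hs hr.1.le (by linarith)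
  have h4 : (t - s) ^ (β' - 0 - 2 * δ) ≤ T * (t - s) ^ (β + δ) :=
    rpow_le_mul_rpow (by linarith) (by linarith) hT (by linarith) (by linarith)
  have h5 : s ^ β * s ^ (-β) = 1 := by rw [← Real.rpow_add hs]; simp
  calc _ ≤ _ := mul_le_mul_of_nonneg_left key hsβ.le
    _ = (s ^ β * s ^ (-β)) * (ConvData.const α β β' δ T ρ Q W 1 t *
        ((t - s) ^ (β' - 0 - 2 * δ) / (β' - 0 - 2 * δ))) := by ring
    _ = ConvData.const α β β' δ T ρ Q W 1 t *
        ((t - s) ^ (β' - 0 - 2 * δ) / (β' - 0 - 2 * δ)) := by rw [h5, one_mul]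
    _ ≤ ConvData.const α β β' δ T ρ Q W 1 t *
        (T * (t - s) ^ (β + δ) / (β' - 0 - 2 * δ)) := by gcongr
    _ = _ := by rw [ConvData.const]; ring

/-- The deterministic convolution with the semigroup. -/
def detConv (S : ℝ → V →L[ℝ] V) (f : ℝ → V) (t : ℝ) : V :=
  ∫ r in (0 : ℝ)..t, S (t - r) (f r)

theorem norm_detConv_integrand_le {κ ρ Q c s r : ℝ} {P : ℝ → V →L[ℝ] V} {f : ℝ → V} (hδ : 0 ≤ δ)
    (hδ1 : δ ≤ 1) (hρ : 0 < ρ) (hc : 0 ≤ c) (hP : ‖P r‖ ≤ c * (s - r) ^ (-κ))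
    (hf : ‖f r‖ ≤ Real.exp (ρ * r) * Q) (hQ : 0 ≤ Q) (hrs : r < s) :
    ‖P r (f r)‖ ≤ c * (Q * ρ ^ (-δ) * Real.exp (ρ * s)) * (s - r) ^ ((1 - κ - δ) - 1) := by
  have h0 : 0 < s - r := sub_pos.2 hrs
  have hE := exp_le_exp_mul_rpow hδ hδ1 hρ hrs
  have h1 := Real.rpow_nonneg h0.le (-κ)
  calc _ ≤ ‖P r‖ * ‖f r‖ := (P r).le_opNorm _
    _ ≤ (c * (s - r) ^ (-κ)) * (Real.exp (ρ * s) * ρ ^ (-δ) * (s - r) ^ (-δ) * Q) :=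
        mul_le_mul hP (hf.trans (mul_le_mul_of_nonneg_right hE hQ)) (norm_nonneg _)
          (mul_nonneg hc h1)
    _ = c * (Q * ρ ^ (-δ) * Real.exp (ρ * s)) * ((s - r) ^ (-κ) * (s - r) ^ (-δ)) := by ring
    _ = _ := by rw [← Real.rpow_add h0]; congr 2; ring

theorem aestronglyMeasurable_detConv (hS : SmoothingSemigroup S) {f : ℝ → V} {t : ℝ}
    (ht : t ≤ T) (hf : ContinuousOn f (Icc 0 T)) :
    AEStronglyMeasurable (fun r => S (t - r) (f r)) (volume.restrict (Ioo 0 t)) :=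
  (((continuousOn_semigroup_sub hS t).mono fun _ hr => hr.2).clm_apply
    (hf.mono fun _ hr => ⟨hr.1.le, hr.2.le.trans ht⟩)).aestronglyMeasurable measurableSet_Ioo

theorem intervalIntegrable_detConv (hS : SmoothingSemigroup S) {f : ℝ → V} {t : ℝ}
    (ht0 : 0 ≤ t) (ht : t ≤ T) (hf : ContinuousOn f (Icc 0 T)) {M : ℝ}
    (hM : ∀ r ∈ Icc 0 T, ‖f r‖ ≤ M) :
    IntervalIntegrable (fun r => S (t - r) (f r)) volume 0 t :=
  intervalIntegrable_of_Ioo ht0 (aestronglyMeasurable_detConv hS ht hf)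
    (fun r hr => (hS.norm_apply_le (by linarith [hr.2]) _).trans
      (hM r ⟨hr.1.le, hr.2.le.trans ht⟩)) intervalIntegrable_const

variable [CompleteSpace V]

/-- With κ = β + δ the Beta integral yields s^(β'-β-κ-2δ), possibly a negative power; multiplied by
s^β it becomes s^(β'-β-3δ), which is bounded. -/
theorem exists_regular_youngConv_le (hx : Exponents α β β' δ) (hS : SmoothingSemigroup S)
    (hT : 1 ≤ T) : ∃ C, 0 ≤ C ∧ ∀ (ρ Q W : ℝ) (Γ : ℝ → V →L[ℝ] V) (w : ℝ → V), 0 < ρ →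
      WBound β T ρ Q Γ → ContinuousOn Γ (Icc 0 T) → Continuous w → HolderBound β' T W w → 0 ≤ W →
      ∀ s ∈ Ioc 0 T, ∀ h, 0 ≤ h →
      s ^ β * ‖S h (youngConv S α Γ w s) - youngConv S α Γ w s‖ ≤
        C * (W * Q * ρ ^ (-δ)) * Real.exp (ρ * s) * h ^ (β + δ) := by
  obtain ⟨hδ, hδα, hαβ, hββ, hβ1, hα1⟩ := id hx
  have h1 := leftConst_nonneg (α := α) (β := β) (δ := δ) (T := T) (by linarith) (by linarith)
  have h2 := rightConst_nonneg (α := α) (γ := β') (by linarith) (by linarith)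
  have h3 := betaConst_nonneg (1 - β) (β' - (β + δ) - 2 * δ)
  refine ⟨leftConst α β δ T * rightConst α β' * (2 * T ^ 2) *
    (4 * betaConst (1 - β) (β' - (β + δ) - 2 * δ)) * T, by positivity, ?_⟩
  intro ρ Q W Γ w hρ hΓ hΓc hwc hw hW s hs h hh
  have hd := convData_semigroup_sub hx hS hT hρ hs.1.le hs.2 hh hΓ hΓc hwc hw hW
  have hc := hd.const_nonneg
  have he : S h (youngConv S α Γ w s) - youngConv S α Γ w s = fracIntegral α s
      (fun r => ((S h - ContinuousLinearMap.id ℝ V).comp (S (s - r))).comp (Γ r)) w := by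
    rw [semigroup_youngConv_sub hx hS hT hρ hs.1.le hs.2 hΓ hΓc hwc hw hW]
    simp
  rw [he]
  have h4 : s ^ β * s ^ (β' - β - (β + δ) - 2 * δ) ≤ T := by
    rw [← Real.rpow_add hs.1]
    exact rpow_le_of_le_one hs.1.le hs.2 hT (by linarith) (by linarith)
  have hsβ := Real.rpow_nonneg hs.1.le β
  calc _ ≤ s ^ β * (ConvData.const α β β' δ T ρ Q W (4 * h ^ (β + δ)) s *
        betaConst (1 - β) (β' - (β + δ) - 2 * δ) * s ^ (β' - β - (β + δ) - 2 * δ)) :=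
        mul_le_mul_of_nonneg_left (hd.norm_fracIntegral_le le_rfl) hsβ
    _ = ConvData.const α β β' δ T ρ Q W (4 * h ^ (β + δ)) s *
        betaConst (1 - β) (β' - (β + δ) - 2 * δ) * (s ^ β * s ^ (β' - β - (β + δ) - 2 * δ)) := by
        ring
    _ ≤ ConvData.const α β β' δ T ρ Q W (4 * h ^ (β + δ)) s *
        betaConst (1 - β) (β' - (β + δ) - 2 * δ) * T := by gcongr
    _ = _ := by rw [ConvData.const]; ring

theorem exists_shift_youngConv_le (hx : Exponents α β β' δ) (hS : SmoothingSemigroup S)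
    (hT : 1 ≤ T) : ∃ C, 0 ≤ C ∧ ∀ (ρ Q W : ℝ) (Γ : ℝ → V →L[ℝ] V) (w : ℝ → V), 0 < ρ →
      WBound β T ρ Q Γ → ContinuousOn Γ (Icc 0 T) → Continuous w → HolderBound β' T W w → 0 ≤ W →
      ∀ s t, 0 < s → s < t → t ≤ T →
      s ^ β * ‖∫ r in (0 : ℝ)..s, leftD α (fun q => (S (t - q)).comp (Γ q)) r
          (pathD α t w r - pathD α s w r)‖ ≤
        C * (W * Q * ρ ^ (-δ)) * Real.exp (ρ * t) * (t - s) ^ (β + δ) := by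
  obtain ⟨hδ, hδα, hαβ, hββ, hβ1, hα1⟩ := id hx
  have h1 := leftConst_nonneg (α := α) (β := β) (δ := δ) (T := T) (by linarith) (by linarith)
  have h2 := betaConst_nonneg (1 - β) δ
  refine ⟨leftConst α β δ T * (2 * T ^ 2) * |(Real.Gamma α)⁻¹| * betaConst (1 - β) δ * T ^ 2,
    by positivity, ?_⟩
  intro ρ Q W Γ w hρ hΓ hΓc hwc hw hW s t hs hst ht
  have hd := convData_semigroup hx hS hT hρ (hs.le.trans hst.le) ht hΓ hΓc hwc hw hW
  have hsβ := Real.rpow_pos_of_pos hs β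
  have hQ := hΓ.nonneg (by linarith)
  have hρδ := Real.rpow_nonneg hρ.le (-δ)
  set K := leftConst α β δ T * (2 * T ^ 2) * |(Real.Gamma α)⁻¹| *
    (W * Q * ρ ^ (-δ) * Real.exp (ρ * t)) with hK
  have hK0 : 0 ≤ K := by positivity
  have hts : 0 < t - s := by linarith
  have key := norm_integral_le_beta (X := V) (a := 1 - β) (b := δ) (r := s)
    (K := K * (t - s) ^ (β' - 3 * δ)) (by linarith) hδ hs.le
    (mul_nonneg hK0 (Real.rpow_nonneg hts.le _))
    (f := fun r => leftD α (fun q => (S (t - q)).comp (Γ q)) r (pathD α t w r - pathD α s w r))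
    fun r hr => by
      have b1 := hd.norm_leftD_le ⟨hr.1, hr.2.trans hst⟩
      have b2 := norm_pathD_sub_le (α := α) (by linarith) (by linarith) hα1 hwc hw hr.1.le hr.2
        hst.le ht hW
      have hsr : 0 < s - r := by linarith [hr.2]
      have htr : 0 < t - r := by linarith
      -- The singularity is split since t - r exceeds both t - s and s - r. The part (s-r)^(-(α-δ))
      -- times (s-r)^(α-1) is just integrable, and the loss (t-s)^(-3δ) is covered by (t-s)^β'
      -- thanks to β + 4δ ≤ β'. This uses δ ≤ α.
      have b3 : (t - r) ^ (-0 - α - 2 * δ) ≤ (t - s) ^ (-(3 * δ)) * (s - r) ^ (-(α - δ)) := by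
        rw [show -0 - α - 2 * δ = -(3 * δ) + -(α - δ) by ring, Real.rpow_add htr]
        exact mul_le_mul (Real.rpow_le_rpow_of_nonpos hts (by linarith [hr.2]) (by linarith))
          (Real.rpow_le_rpow_of_nonpos hsr (by linarith) (by linarith))
          (Real.rpow_nonneg htr.le _) (Real.rpow_nonneg hts.le _)
      have hrβ := Real.rpow_nonneg hr.1.le (-β)
      have b4 := Real.rpow_nonneg hts.le β'
      have b5 := Real.rpow_nonneg hsr.le (α - 1)
      have e1 : (t - s) ^ (β' - 3 * δ) = (t - s) ^ (-(3 * δ)) * (t - s) ^ β' := by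
        rw [← Real.rpow_add hts]; congr 1; ring
      have e2 : (s - r) ^ (δ - 1) = (s - r) ^ (-(α - δ)) * (s - r) ^ (α - 1) := by
        rw [← Real.rpow_add hsr]; congr 1; ring
      calc _ ≤ _ := ContinuousLinearMap.le_opNorm _ _
        _ ≤ _ := mul_le_mul b1 b2 (norm_nonneg _) ((norm_nonneg _).trans b1)
        _ = K * ((t - r) ^ (-0 - α - 2 * δ)) *
            (r ^ (-β) * ((t - s) ^ β' * (s - r) ^ (α - 1))) := by rw [hK]; ring
        _ ≤ K * ((t - s) ^ (-(3 * δ)) * (s - r) ^ (-(α - δ))) *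
            (r ^ (-β) * ((t - s) ^ β' * (s - r) ^ (α - 1))) := by gcongr
        _ = _ := by
            rw [e1, e2, show 1 - β - 1 = -β by ring]; ring
  have h4 : (t - s) ^ (β' - 3 * δ) ≤ T * (t - s) ^ (β + δ) :=
    rpow_le_mul_rpow hts (by linarith) hT (by linarith) (by linarith)
  have h5 : s ^ β * s ^ (1 - β + δ - 1) ≤ T := by
    rw [← Real.rpow_add hs]
    exact rpow_le_of_le_one hs.le (by linarith) hT (by linarith) (by linarith)
  have h6 := Real.rpow_nonneg hts.le (β + δ)
  calc _ ≤ _ := mul_le_mul_of_nonneg_left key hsβ.le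
    _ = K * betaConst (1 - β) δ * ((t - s) ^ (β' - 3 * δ) * (s ^ β * s ^ (1 - β + δ - 1))) := by
        ring
    _ ≤ K * betaConst (1 - β) δ * ((T * (t - s) ^ (β + δ)) * T) := by gcongr
    _ = _ := by rw [hK]; ring

theorem exists_convBound_youngConv (hx : Exponents α β β' δ) (hS : SmoothingSemigroup S)
    (hT : 1 ≤ T) : ∃ C, 0 ≤ C ∧ ∀ (ρ Q W : ℝ) (Γ : ℝ → V →L[ℝ] V) (w : ℝ → V), 0 < ρ →
      WBound β T ρ Q Γ → ContinuousOn Γ (Icc 0 T) → Continuous w → HolderBound β' T W w → 0 ≤ W →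
      ConvBound S β δ T ρ (C * (W * Q * ρ ^ (-δ))) (youngConv S α Γ w) := by
  obtain ⟨C1, hC1, h1⟩ := exists_norm_youngConv_le hx hS hT
  obtain ⟨C2, hC2, h2⟩ := exists_regular_youngConv_le hx hS hT
  obtain ⟨C3, hC3, h3⟩ := exists_tail_youngConv_le hx hS hT
  obtain ⟨C4, hC4, h4⟩ := exists_shift_youngConv_le hx hS hT
  refine ⟨C1 + C2 + C3 + C4, by positivity, ?_⟩
  intro ρ Q W Γ w hρ hΓ hΓc hwc hw hW
  have hQ := hΓ.nonneg (by linarith)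
  have hρδ := Real.rpow_nonneg hρ.le (-δ)
  have hM : 0 ≤ W * Q * ρ ^ (-δ) := by positivity
  refine ⟨fun t ht => ?_, fun s hs h hh => ?_, fun s t hs hst ht => ?_⟩
  · refine (h1 ρ Q W Γ w hρ hΓ hΓc hwc hw hW t ht).trans ?_
    have := Real.rpow_nonneg ht.1 δ
    gcongr
    linarith
  · refine (h2 ρ Q W Γ w hρ hΓ hΓc hwc hw hW s hs h hh).trans ?_
    have := Real.rpow_nonneg hh (β + δ)
    gcongr
    linarith
  · have hsβ := Real.rpow_nonneg hs.le β
    have a2 := h2 ρ Q W Γ w hρ hΓ hΓc hwc hw hW s ⟨hs, by linarith⟩ (t - s) (by linarith)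
    have a3 := h3 ρ Q W Γ w hρ hΓ hΓc hwc hw hW s t hs hst ht
    have a4 := h4 ρ Q W Γ w hρ hΓ hΓc hwc hw hW s t hs hst ht
    have hp := Real.rpow_nonneg (sub_nonneg.2 hst.le) (β + δ)
    have hexp : Real.exp (ρ * s) ≤ Real.exp (ρ * t) :=
      Real.exp_le_exp.2 (mul_le_mul_of_nonneg_left hst.le hρ.le)
    have a2' := a2.trans (show _ ≤ C2 * (W * Q * ρ ^ (-δ)) * Real.exp (ρ * t) *
      (t - s) ^ (β + δ) by gcongr)
    have hle : 0 ≤ C1 * (W * Q * ρ ^ (-δ)) * Real.exp (ρ * t) * (t - s) ^ (β + δ) := by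
      positivity
    rw [youngConv_sub hx hS hT hρ hs.le hst.le ht hΓ hΓc hwc hw hW]
    have hn := mul_le_mul_of_nonneg_left (norm_sub_le_of_le (norm_sub_le
      (S (t - s) (youngConv S α Γ w s) - youngConv S α Γ w s)
      (∫ r in s..t, leftD α (fun q => (S (t - q)).comp (Γ q)) r (pathD α t w r)))
      (le_refl ‖∫ r in (0 : ℝ)..s, leftD α (fun q => (S (t - q)).comp (Γ q)) r
        (pathD α t w r - pathD α s w r)‖)) hsβ
    refine hn.trans ?_
    rw [mul_add, mul_add]
    linarith

theorem semigroup_detConv (hS : SmoothingSemigroup S) {f : ℝ → V} {t h : ℝ} (hh : 0 ≤ h)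
    (ht0 : 0 ≤ t) (ht : t ≤ T) (hf : ContinuousOn f (Icc 0 T)) {M : ℝ}
    (hM : ∀ r ∈ Icc 0 T, ‖f r‖ ≤ M) :
    S h (detConv S f t) = ∫ r in (0 : ℝ)..t, S (t + h - r) (f r) := by
  rw [detConv, ← integral_clm_comp _ (intervalIntegrable_detConv hS ht0 ht hf hM)]
  refine integral_congr_Ioo ht0 fun r hr => ?_
  rw [← hS.apply_add hh (by linarith [hr.2])]
  congr 2
  ring

/-- The same three estimates as for the path integral, now with only the semigroup singularity
(s-r)^(-κ) and the δ spent on the exponential weight. -/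
theorem exists_convBound_detConv (hx : Exponents α β β' δ) (hS : SmoothingSemigroup S)
    (hT : 1 ≤ T) : ∃ C, 0 ≤ C ∧ ∀ (ρ Q : ℝ) (f : ℝ → V), 0 < ρ → 0 ≤ Q →
      (∀ r ∈ Icc 0 T, ‖f r‖ ≤ Real.exp (ρ * r) * Q) → ContinuousOn f (Icc 0 T) →
      ConvBound S β δ T ρ (C * (Q * ρ ^ (-δ))) (detConv S f) := by
  obtain ⟨hδ, hδα, hαβ, hββ, hβ1, hα1⟩ := id hx
  have hb1 : 0 < 1 - 0 - δ := by linarith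
  have hb2 : 0 < 1 - (β + δ) - δ := by linarith
  refine ⟨T / (1 - 0 - δ) + T ^ 2 / (1 - 0 - δ) + T ^ 2 / (1 - (β + δ) - δ), by positivity, ?_⟩
  intro ρ Q f hρ hQ hf hfc
  set M := Q * ρ ^ (-δ) with hM
  have hM0 : 0 ≤ M := mul_nonneg hQ (Real.rpow_nonneg hρ.le _)
  have hTT : T ≤ T ^ 2 := by nlinarith
  have hfM : ∀ r ∈ Icc 0 T, ‖f r‖ ≤ Real.exp (ρ * T) * Q := fun r hr =>
    (hf r hr).trans (mul_le_mul_of_nonneg_right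
      (Real.exp_le_exp.2 (mul_le_mul_of_nonneg_left hr.2 hρ.le)) hQ)
  have tail : ∀ s t, 0 ≤ s → s ≤ t → t ≤ T → ‖∫ r in s..t, S (t - r) (f r)‖ ≤
      M * Real.exp (ρ * t) * ((t - s) ^ (1 - 0 - δ) / (1 - 0 - δ)) := by
    intro s t hs hst ht
    refine norm_integral_le_sub_rpow hb1 hst fun r hr => ?_
    have := norm_detConv_integrand_le (P := fun r => S (t - r)) (κ := 0) hδ.le (by linarith) hρ
      zero_le_one (by simpa using hS.norm_le (t - r) (by linarith [hr.2]))
      (hf r ⟨by linarith [hr.1], by linarith [hr.2]⟩) hQ hr.2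
    rwa [one_mul] at this
  have reg : ∀ s ∈ Ioc 0 T, ∀ h, 0 ≤ h → s ^ β * ‖S h (detConv S f s) - detConv S f s‖ ≤
      T ^ 2 / (1 - (β + δ) - δ) * M * Real.exp (ρ * s) * h ^ (β + δ) := by
    intro s hs h hh
    have hhp := Real.rpow_nonneg hh (β + δ)
    have he : S h (detConv S f s) - detConv S f s =
        ∫ r in (0 : ℝ)..s, (S h - ContinuousLinearMap.id ℝ V).comp (S (s - r)) (f r) := by
      have := integral_clm_comp (S h - ContinuousLinearMap.id ℝ V)
        (intervalIntegrable_detConv hS hs.1.le hs.2 hfc hfM)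
      simp only [ContinuousLinearMap.comp_apply]
      rw [this]
      rfl
    have key := norm_integral_le_sub_rpow hb2 hs.1.le fun r hr =>
      norm_detConv_integrand_le (P := fun r => (S h - ContinuousLinearMap.id ℝ V).comp (S (s - r)))
        (f := f) (κ := β + δ) hδ.le (by linarith) hρ hhp
        (hS.smoothing (β + δ) h (s - r) (by linarith) (by linarith) hh (by linarith [hr.2]))
        (hf r ⟨hr.1.le, by linarith [hr.2, hs.2]⟩) hQ hr.2
    have h1 := rpow_le_of_le_one hs.1.le hs.2 hT (by linarith : 0 ≤ β) (by linarith)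
    have h2 := rpow_le_of_le_one (y := 1 - (β + δ) - δ) hs.1.le hs.2 hT (by linarith) (by linarith)
    have h3 := Real.rpow_nonneg hs.1.le β
    rw [he]
    rw [sub_zero] at key
    calc _ ≤ _ := mul_le_mul_of_nonneg_left key h3
      _ ≤ T * (h ^ (β + δ) * (Q * ρ ^ (-δ) * Real.exp (ρ * s)) * (T / (1 - (β + δ) - δ))) := by
          rw [← hM]
          have := Real.rpow_nonneg hs.1.le (1 - (β + δ) - δ)
          gcongr
      _ = _ := by rw [hM]; ring
  refine ⟨fun t ht => ?_, fun s hs h hh => ?_, fun s t hs hst ht => ?_⟩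
  · have h1 := tail 0 t le_rfl ht.1 ht.2
    rw [sub_zero] at h1
    have h2 := rpow_le_mul_rpow_of_nonneg (a := δ) (b := 1 - 0 - δ) ht.1 ht.2 hT hδ
      (by linarith) (by linarith)
    have h3 := Real.rpow_nonneg ht.1 δ
    calc _ ≤ _ := h1
      _ ≤ M * Real.exp (ρ * t) * (T * t ^ δ / (1 - 0 - δ)) := by gcongr
      _ = T / (1 - 0 - δ) * M * Real.exp (ρ * t) * t ^ δ := by ring
      _ ≤ _ := by
          gcongr
          have : 0 ≤ T ^ 2 / (1 - 0 - δ) := by positivity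
          have : 0 ≤ T ^ 2 / (1 - (β + δ) - δ) := by positivity
          linarith
  · have h3 := Real.rpow_nonneg hh (β + δ)
    refine (reg s hs h hh).trans ?_
    gcongr
    have : 0 ≤ T ^ 2 / (1 - 0 - δ) := by positivity
    have : 0 ≤ T / (1 - 0 - δ) := by positivity
    linarith
  · have hts : 0 < t - s := sub_pos.2 hst
    have h3 := Real.rpow_nonneg hts.le (β + δ)
    have hsβ := Real.rpow_nonneg hs.le β
    have hi := intervalIntegrable_detConv hS (hs.le.trans hst.le) ht hfc hfM
    have it1 := hi.mono_set (show uIcc 0 s ⊆ uIcc 0 t by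
      rw [uIcc_of_le hs.le, uIcc_of_le (hs.le.trans hst.le)]; exact Icc_subset_Icc_right hst.le)
    have it2 := hi.mono_set (show uIcc s t ⊆ uIcc 0 t by
      rw [uIcc_of_le hst.le, uIcc_of_le (hs.le.trans hst.le)]; exact Icc_subset_Icc_left hs.le)
    have he : detConv S f t - detConv S f s = (S (t - s) (detConv S f s) - detConv S f s) +
        ∫ r in s..t, S (t - r) (f r) := by
      rw [semigroup_detConv hS hts.le hs.le (hst.le.trans ht) hfc hfM, add_sub_cancel]
      nth_rewrite 1 [detConv]
      rw [← intervalIntegral.integral_add_adjacent_intervals it1 it2]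
      abel
    have h1 := reg s ⟨hs, by linarith⟩ (t - s) hts.le
    have h2 := tail s t hs.le hst.le ht
    have h4 : (t - s) ^ (1 - 0 - δ) ≤ T * (t - s) ^ (β + δ) :=
      rpow_le_mul_rpow hts (by linarith) hT (by linarith) (by linarith)
    have h5 := rpow_le_of_le_one hs.le (by linarith : s ≤ T) hT (by linarith : 0 ≤ β) (by linarith)
    have hexp : Real.exp (ρ * s) ≤ Real.exp (ρ * t) :=
      Real.exp_le_exp.2 (mul_le_mul_of_nonneg_left hst.le hρ.le)
    rw [he]
    calc _ ≤ s ^ β * (‖S (t - s) (detConv S f s) - detConv S f s‖ +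
          ‖∫ r in s..t, S (t - r) (f r)‖) := mul_le_mul_of_nonneg_left (norm_add_le _ _) hsβ
      _ ≤ T ^ 2 / (1 - (β + δ) - δ) * M * Real.exp (ρ * t) * (t - s) ^ (β + δ) +
          T * (M * Real.exp (ρ * t) * (T * (t - s) ^ (β + δ) / (1 - 0 - δ))) := by
          rw [mul_add]
          refine add_le_add (h1.trans (by gcongr)) ?_
          refine mul_le_mul h5 (h2.trans (by gcongr)) (norm_nonneg _) (by linarith)
      _ = (T ^ 2 / (1 - 0 - δ) + T ^ 2 / (1 - (β + δ) - δ)) * M * Real.exp (ρ * t) *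
          (t - s) ^ (β + δ) := by ring
      _ ≤ _ := by
          gcongr
          have : 0 ≤ T / (1 - 0 - δ) := by positivity
          linarith

end ConvBounds

/-! ### Function space norms and real bounds -/

section Norms

variable {X : Type*} [NormedAddCommGroup X]

theorem norm_le_toReal_supNorm {a b t : ℝ} {f : ℝ → X} {N : ℝ≥0∞} (hN : N ≠ ⊤)
    (h : supNorm a b f ≤ N) (ht : t ∈ Icc a b) : ‖f t‖ ≤ N.toReal := by
  have h1 : ‖f t‖ₑ ≤ N := (le_iSup₂ (f := fun s (_ : s ∈ Icc a b) => ‖f s‖ₑ) t ht).trans h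
  rw [← toReal_enorm]
  exact ENNReal.toReal_mono hN h1

theorem holderBound_of_holderNorm {γ T : ℝ} {f : ℝ → X} (h : holderNorm γ 0 T f ≠ ⊤) :
    HolderBound γ T (holderNorm γ 0 T f).toReal f := by
  intro s t hs hst ht
  rcases hst.eq_or_lt with rfl | hst
  · simp only [sub_self, norm_zero]
    exact mul_nonneg ENNReal.toReal_nonneg (Real.rpow_nonneg le_rfl _)
  · have h1 : ENNReal.ofReal (‖f t - f s‖ / (t - s) ^ γ) ≤ holderNorm γ 0 T f :=
      (le_iSup_of_le s <| le_iSup_of_le t <| le_iSup_of_le ⟨hs, hst, ht⟩ le_rfl :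
        _ ≤ holderSeminorm γ 0 T f).trans le_add_self
    rwa [ENNReal.ofReal_le_iff_le_toReal h,
      div_le_iff₀ (Real.rpow_pos_of_pos (sub_pos.2 hst) _)] at h1

theorem holderNorm_mono {γ a b a' b' : ℝ} (ha : a' ≤ a) (hb : b ≤ b') (f : ℝ → X) :
    holderNorm γ a b f ≤ holderNorm γ a' b' f := by
  refine add_le_add ?_ ?_
  · exact iSup₂_le fun s hs =>
      le_iSup₂ (f := fun s (_ : s ∈ Icc a' b') => ‖f s‖ₑ) s ⟨ha.trans hs.1, hs.2.trans hb⟩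
  · refine iSup_le fun s => iSup_le fun t => iSup_le fun h => ?_
    exact le_iSup_of_le s <| le_iSup_of_le t <|
      le_iSup_of_le ⟨ha.trans h.1, h.2.1, h.2.2.trans hb⟩ le_rfl

theorem exists_holderBound_of_mem_pathSpace [NormedSpace ℝ X] {γ : ℝ} {w : ℝ → X}
    (hw : w ∈ pathSpace X γ) (T : ℝ) : ∃ W, 0 ≤ W ∧ HolderBound γ T W w := by
  obtain ⟨n, hn⟩ := exists_nat_ge T
  have h : holderNorm γ 0 T w ≠ ⊤ :=
    ((holderNorm_mono (by simp) hn w).trans_lt (hw.2.2 n).1).ne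
  exact ⟨_, ENNReal.toReal_nonneg, holderBound_of_holderNorm h⟩

theorem WBound.of_weightedHolderNorm {β T : ℝ} {f : ℝ → X}
    (h : weightedHolderNorm β 0 T f ≠ ⊤) : WBound β T 0 (weightedHolderNorm β 0 T f).toReal f := by
  refine ⟨fun t ht => ?_, fun s t hs hst ht => ?_⟩
  · rw [zero_mul, Real.exp_zero, one_mul]
    exact norm_le_toReal_supNorm h le_self_add ht
  · have h1 : ENNReal.ofReal ((s - 0) ^ β * (‖f t - f s‖ / (t - s) ^ β)) ≤
        weightedHolderNorm β 0 T f :=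
      (le_iSup_of_le s <| le_iSup_of_le t <| le_iSup_of_le ⟨hs, hst, ht⟩ le_rfl :
        _ ≤ weightedHolderSeminorm β 0 T f).trans le_add_self
    rw [ENNReal.ofReal_le_iff_le_toReal h, sub_zero, ← mul_div_assoc,
      div_le_iff₀ (Real.rpow_pos_of_pos (sub_pos.2 hst) _)] at h1
    rwa [zero_mul, Real.exp_zero, one_mul]

/-- The norm is the sum of the supremum and the seminorm, each at most U. -/
theorem WBound.weightedHolderNorm_le {β T U : ℝ} {f : ℝ → X} (h : WBound β T 0 U f) :
    weightedHolderNorm β 0 T f ≤ ENNReal.ofReal U + ENNReal.ofReal U := by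
  obtain ⟨h1, h2⟩ := h
  simp only [zero_mul, Real.exp_zero, one_mul] at h1 h2
  refine add_le_add (iSup₂_le fun s hs => ?_)
    (iSup_le fun s => iSup_le fun t => iSup_le fun hst => ?_)
  · rw [← ofReal_norm]
    exact ENNReal.ofReal_le_ofReal (h1 s hs)
  · refine ENNReal.ofReal_le_ofReal ?_
    rw [sub_zero, ← mul_div_assoc, div_le_iff₀ (Real.rpow_pos_of_pos (sub_pos.2 hst.2.1) _)]
    exact h2 s t hst.1 hst.2.1 hst.2.2

theorem WBound.of_zero {β T ρ U : ℝ} {f : ℝ → X} (hT : 0 ≤ T) (hρ : 0 ≤ ρ)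
    (h : WBound β T 0 U f) : WBound β T ρ U f := by
  have hU := h.nonneg hT
  have hexp {t : ℝ} (ht : 0 ≤ t) : Real.exp (0 * t) ≤ Real.exp (ρ * t) := by
    rw [zero_mul]; exact Real.exp_le_exp.2 (mul_nonneg hρ ht)
  refine ⟨fun t ht => (h.1 t ht).trans ?_, fun s t hs hst ht => (h.2 s t hs hst ht).trans ?_⟩
  · exact mul_le_mul_of_nonneg_right (hexp ht.1) hU
  · exact mul_le_mul_of_nonneg_right (mul_le_mul_of_nonneg_right (hexp (by linarith)) hU)
      (Real.rpow_nonneg (sub_nonneg.2 hst.le) _)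

theorem WBound.to_zero {β T ρ U : ℝ} {f : ℝ → X} (hT : 0 ≤ T) (hρ : 0 ≤ ρ)
    (h : WBound β T ρ U f) : WBound β T 0 (Real.exp (ρ * T) * U) f := by
  have hU := h.nonneg hT
  have hexp {t : ℝ} (ht : t ≤ T) : Real.exp (ρ * t) ≤ Real.exp (ρ * T) :=
    Real.exp_le_exp.2 (mul_le_mul_of_nonneg_left ht hρ)
  refine ⟨fun t ht => (h.1 t ht).trans ?_, fun s t hs hst ht => (h.2 s t hs hst ht).trans ?_⟩
  · rw [zero_mul, Real.exp_zero, one_mul]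
    exact mul_le_mul_of_nonneg_right (hexp ht.2) hU
  · rw [zero_mul, Real.exp_zero, one_mul]
    exact mul_le_mul_of_nonneg_right (mul_le_mul_of_nonneg_right (hexp ht) hU)
      (Real.rpow_nonneg (sub_nonneg.2 hst.le) _)

theorem WBound.of_tendsto {β T ρ : ℝ} {U : ℕ → ℝ} {U' : ℝ} {f : ℕ → ℝ → X} {g : ℝ → X}
    (hU : Tendsto U atTop (𝓝 U')) (hf : ∀ t ∈ Icc 0 T, Tendsto (fun n => f n t) atTop (𝓝 (g t)))
    (h : ∀ n, WBound β T ρ (U n) (f n)) : WBound β T ρ U' g := by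
  refine ⟨fun t ht => ?_, fun s t hs hst ht => ?_⟩
  · exact le_of_tendsto_of_tendsto' (hf t ht).norm (hU.const_mul _) fun n => (h n).1 t ht
  · exact le_of_tendsto_of_tendsto'
      (((hf t ⟨by linarith, ht⟩).sub (hf s ⟨hs.le, by linarith⟩)).norm.const_mul _)
      ((hU.const_mul _).mul_const _) fun n => (h n).2 s t hs hst ht

/-- Iterating U ↦ a + U/2 from some finite bound converges to the fixed point 2a, and the bounds are
closed under limits in U. A finite initial bound is indispensable. -/
theorem WBound.absorb {β T ρ a U : ℝ} {f : ℝ → X} (h0 : WBound β T ρ U f)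
    (h : ∀ U, WBound β T ρ U f → WBound β T ρ (a + U / 2) f) : WBound β T ρ (2 * a) f := by
  have hn : ∀ n : ℕ, WBound β T ρ (2 * a + (U - 2 * a) * (1 / 2) ^ n) f := by
    intro n
    induction n with
    | zero => simpa using h0
    | succ n ih =>
      have := h _ ih
      convert this using 1
      ring
  refine WBound.of_tendsto (f := fun _ => f) (U := fun n : ℕ => 2 * a + (U - 2 * a) * (1 / 2) ^ n)
    ?_ (fun t _ => tendsto_const_nhds) hn
  have := ((tendsto_pow_atTop_nhds_zero_of_lt_one (r := (1 / 2 : ℝ)) (by norm_num)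
    (by norm_num)).const_mul (U - 2 * a)).const_add (2 * a)
  simpa using this

theorem WBound.comp_lipschitz {Y : Type*} [NormedAddCommGroup Y] {β T ρ U L : ℝ} {f : ℝ → X}
    {G : X → Y} (hT : 0 ≤ T) (hρ : 0 ≤ ρ) (hL : 0 ≤ L) (hG : ∀ x y, ‖G x - G y‖ ≤ L * ‖x - y‖)
    (h : WBound β T ρ U f) : WBound β T ρ (‖G 0‖ + L * U) (fun t => G (f t)) := by
  have hU := h.nonneg hT
  refine ⟨fun t ht => ?_, fun s t hs hst ht => ?_⟩
  · have h1 := h.1 t ht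
    have h2 := hG (f t) 0
    rw [sub_zero] at h2
    have h3 : ‖G (f t)‖ ≤ ‖G 0‖ + ‖G (f t) - G 0‖ := by
      simpa using norm_add_le (G 0) (G (f t) - G 0)
    have h4 : (1 : ℝ) ≤ Real.exp (ρ * t) := Real.one_le_exp (mul_nonneg hρ ht.1)
    calc _ ≤ ‖G 0‖ + L * (Real.exp (ρ * t) * U) :=
          h3.trans (add_le_add_right (h2.trans (mul_le_mul_of_nonneg_left h1 hL)) _)
      _ ≤ Real.exp (ρ * t) * ‖G 0‖ + L * (Real.exp (ρ * t) * U) := by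
          have := mul_le_mul_of_nonneg_right h4 (norm_nonneg (G 0))
          linarith
      _ = _ := by ring
  · have hsβ := Real.rpow_nonneg hs.le β
    have hp := Real.rpow_nonneg (sub_nonneg.2 hst.le) β
    calc _ ≤ s ^ β * (L * ‖f t - f s‖) := mul_le_mul_of_nonneg_left (hG _ _) hsβ
      _ = L * (s ^ β * ‖f t - f s‖) := by ring
      _ ≤ L * (Real.exp (ρ * t) * U * (t - s) ^ β) :=
          mul_le_mul_of_nonneg_left (h.2 s t hs hst ht) hL
      _ = Real.exp (ρ * t) * (L * U) * (t - s) ^ β := by ring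
      _ ≤ _ := by
          have := norm_nonneg (G 0)
          gcongr
          linarith

end Norms

/-! ### A priori bounds for mild solutions. -/

section Apriori

variable {V : Type*} [NormedAddCommGroup V] [InnerProductSpace ℝ V]
  {S : ℝ → V →L[ℝ] V} {α β β' δ T : ℝ}

theorem SmoothingSemigroup.wbound_apply (hS : SmoothingSemigroup S) (hβ0 : 0 ≤ β) (hβ1 : β ≤ 1)
    (T : ℝ) (x : V) : WBound β T 0 ‖x‖ (fun t => S t x) := by
  refine ⟨fun t ht => ?_, fun s t hs hst ht => ?_⟩
  · rw [zero_mul, Real.exp_zero, one_mul]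
    exact hS.norm_apply_le ht.1 x
  · rw [zero_mul, Real.exp_zero, one_mul]
    have h1 := (S t - S s).le_of_opNorm_le (hS.norm_sub_le hβ0 hβ1 hs hst.le) x
    have h2 : s ^ β * s ^ (-β) = 1 := by rw [← Real.rpow_add hs]; simp
    calc s ^ β * ‖S t x - S s x‖ ≤ s ^ β * ((t - s) ^ β * s ^ (-β) * ‖x‖) :=
          mul_le_mul_of_nonneg_left h1 (Real.rpow_nonneg hs.le _)
      _ = (s ^ β * s ^ (-β)) * (‖x‖ * (t - s) ^ β) := by ring
      _ = _ := by rw [h2, one_mul]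

theorem WBound.add {X : Type*} [NormedAddCommGroup X] {ρ U U' : ℝ} {f g : ℝ → X}
    (hf : WBound β T ρ U f) (hg : WBound β T ρ U' g) :
    WBound β T ρ (U + U') (fun t => f t + g t) := by
  refine ⟨fun t ht => (norm_add_le _ _).trans ?_, fun s t hs hst ht => ?_⟩
  · linarith [hf.1 t ht, hg.1 t ht]
  · rw [add_sub_add_comm]
    have h := mul_le_mul_of_nonneg_left (norm_add_le (f t - f s) (g t - g s))
      (Real.rpow_nonneg hs.le β)
    linarith [hf.2 s t hs hst ht, hg.2 s t hs hst ht]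

theorem WBound.congr {X : Type*} [NormedAddCommGroup X] {ρ U : ℝ} {f g : ℝ → X}
    (hf : WBound β T ρ U f) (h : ∀ t ∈ Icc 0 T, f t = g t) : WBound β T ρ U g := by
  refine ⟨fun t ht => ?_, fun s t hs hst ht => ?_⟩
  · rw [← h t ht]; exact hf.1 t ht
  · rw [← h t ⟨by linarith, ht⟩, ← h s ⟨hs.le, by linarith⟩]; exact hf.2 s t hs hst ht

theorem WBound.mono {X : Type*} [NormedAddCommGroup X] {ρ U U' : ℝ} {f : ℝ → X}
    (hf : WBound β T ρ U f) (h : U ≤ U') : WBound β T ρ U' f := by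
  refine ⟨fun t ht => (hf.1 t ht).trans (by gcongr), fun s t hs hst ht =>
    (hf.2 s t hs hst ht).trans ?_⟩
  have := Real.rpow_nonneg (sub_nonneg.2 hst.le) β
  gcongr

theorem ConvBound.congr {ρ K : ℝ} {v v' : ℝ → V}
    (h : ConvBound S β δ T ρ K v) (hv : ∀ t ∈ Icc 0 T, v t = v' t) :
    ConvBound S β δ T ρ K v' where
  norm_le t ht := by rw [← hv t ht]; exact h.norm_le t ht
  regular s hs r hr := by rw [← hv s ⟨hs.1.le, hs.2⟩]; exact h.regular s hs r hr
  incr s t hs hst ht := by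
    rw [← hv t ⟨by linarith, ht⟩, ← hv s ⟨hs.le, by linarith⟩]; exact h.incr s t hs hst ht

theorem ConvBound.wbound {ρ K : ℝ} {v : ℝ → V} (hT : 1 ≤ T) (hδ : 0 < δ) (hδ1 : δ ≤ 1)
    (hK : 0 ≤ K) (h : ConvBound S β δ T ρ K v) : WBound β T ρ (K * T) v := by
  refine ⟨fun t ht => (h.norm_le t ht).trans ?_, fun s t hs hst ht =>
    (h.incr s t hs hst ht).trans ?_⟩
  · have := rpow_le_of_le_one ht.1 ht.2 hT hδ.le hδ1
    calc _ ≤ K * Real.exp (ρ * t) * T := by gcongr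
      _ = _ := by ring
  · have := rpow_le_mul_rpow (a := β) (b := β + δ) (sub_pos.2 hst) (by linarith : t - s ≤ T) hT
      (by linarith) (by linarith)
    calc _ ≤ K * Real.exp (ρ * t) * (T * (t - s) ^ β) := by gcongr
      _ = _ := by ring

theorem ConvBound.to_zero {ρ K : ℝ} {v : ℝ → V} (hρ : 0 ≤ ρ) (hK : 0 ≤ K)
    (h : ConvBound S β δ T ρ K v) : ConvBound S β δ T 0 (K * Real.exp (ρ * T)) v := by
  have hexp {t : ℝ} (ht : t ≤ T) : K * Real.exp (ρ * t) ≤ K * Real.exp (ρ * T) * Real.exp (0 * t) := by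
    rw [zero_mul, Real.exp_zero, mul_one]
    exact mul_le_mul_of_nonneg_left (Real.exp_le_exp.2 (mul_le_mul_of_nonneg_left ht hρ)) hK
  exact ⟨fun t ht => (h.norm_le t ht).trans
      (mul_le_mul_of_nonneg_right (hexp ht.2) (Real.rpow_nonneg ht.1 _)),
    fun s hs r hr => (h.regular s hs r hr).trans
      (mul_le_mul_of_nonneg_right (hexp hs.2) (Real.rpow_nonneg hr _)),
    fun s t hs hst ht => (h.incr s t hs hst ht).trans
      (mul_le_mul_of_nonneg_right (hexp ht) (Real.rpow_nonneg (sub_nonneg.2 hst.le) _))⟩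

/-- A solution of the mild equation on `[0, T]` whose integral is written in vector valued form. -/
structure MildEq (S : ℝ → V →L[ℝ] V) (F : V → V) (G : V → V →L[ℝ] V) (α β T : ℝ)
    (w : ℝ → V) (x : V) (u : ℝ → V) : Prop where
  cont : ContinuousOn u (Icc 0 T)
  bound : ∃ U, WBound β T 0 U u
  eq : ∀ t ∈ Icc 0 T, u t = S t x + detConv S (fun r => F (u r)) t +
    youngConv S α (fun r => G (u r)) w t

theorem continuous_of_lipschitz_bound {X Y : Type*} [NormedAddCommGroup X] [NormedAddCommGroup Y]
    {L : ℝ} {G : X → Y} (hL : 0 ≤ L) (hG : ∀ x y, ‖G x - G y‖ ≤ L * ‖x - y‖) : Continuous G :=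
  (LipschitzWith.of_dist_le_mul (K := ⟨L, hL⟩) fun x y => by
    rw [dist_eq_norm, dist_eq_norm]; exact hG x y).continuous

variable [CompleteSpace V] {F : V → V} {G : V → V →L[ℝ] V} {cF LF LG : ℝ}

/-- If u has weighted bound U, its convolution part has bound (p + qU)ρ^(-δ). For large ρ the linear
term is at most U/2 and is absorbed; feeding the resulting bound back gives the gain of regularity.
The weight is removed at the end at the cost of e^(ρT). -/
theorem exists_apriori_bound (hx : Exponents α β β' δ) (hS : SmoothingSemigroup S) (hT : 1 ≤ T)
    (hF : Continuous F) (hcF : 0 ≤ cF) (hLF : 0 ≤ LF) (hFg : ∀ v, ‖F v‖ ≤ cF + LF * ‖v‖)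
    (hLG : 0 ≤ LG) (hG : ∀ x y, ‖G x - G y‖ ≤ LG * ‖x - y‖) {W R : ℝ} (hW : 0 ≤ W) :
    ∃ U K, 0 ≤ K ∧ ∀ (w : ℝ → V) (x : V) (u : ℝ → V), ‖x‖ ≤ R → Continuous w →
      HolderBound β' T W w → MildEq S F G α β T w x u →
      WBound β T 0 U u ∧ ConvBound S β δ T 0 K (fun t => u t - S t x) := by
  obtain ⟨C1, hC1, h1⟩ := exists_convBound_detConv hx hS hT
  obtain ⟨C2, hC2, h2⟩ := exists_convBound_youngConv hx hS hT
  obtain ⟨hδ, hδα, hαβ, hββ, hβ1, hα1⟩ := id hx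
  have hT0 : 0 ≤ T := by linarith
  set p : ℝ := C1 * cF + C2 * (W * ‖G 0‖) with hp
  set q : ℝ := C1 * LF + C2 * (W * LG) with hq
  have hp0 : 0 ≤ p := by positivity
  have hq0 : 0 ≤ q := by positivity
  obtain ⟨ρ, hρ1, hρ⟩ : ∃ ρ : ℝ, 1 ≤ ρ ∧ q * T * ρ ^ (-δ) ≤ 1 / 2 := by
    have hlim := (tendsto_rpow_neg_atTop hδ).const_mul (q * T)
    rw [mul_zero] at hlim
    exact ((eventually_ge_atTop 1).and (hlim.eventually_le_const (by norm_num))).exists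
  have hρ0 : 0 < ρ := by linarith
  set m := ρ ^ (-δ) with hm
  have hm0 : 0 ≤ m := Real.rpow_nonneg hρ0.le _
  set a : ℝ := R + p * m * T with ha
  have conv : ∀ (w : ℝ → V) (x : V) (u : ℝ → V), Continuous w → HolderBound β' T W w →
      MildEq S F G α β T w x u → ∀ U, WBound β T ρ U u →
      ConvBound S β δ T ρ ((p + q * U) * m) (fun t => u t - S t x) := by
    intro w x u hwc hw hu U hU
    have hU0 := hU.nonneg hT0
    have b1 := h1 ρ (cF + LF * U) (fun r => F (u r)) hρ0 (by positivity) (fun r hr => by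
      refine (hFg _).trans ?_
      have e1 := hU.1 r hr
      have e2 : (1 : ℝ) ≤ Real.exp (ρ * r) := Real.one_le_exp (mul_nonneg hρ0.le hr.1)
      have e3 := mul_le_mul_of_nonneg_left e1 hLF
      have e4 := mul_le_mul_of_nonneg_right e2 hcF
      linarith) (hF.comp_continuousOn hu.cont)
    have b2 := h2 ρ (‖G 0‖ + LG * U) W (fun r => G (u r)) w hρ0
      (hU.comp_lipschitz hT0 hρ0.le hLG hG)
      ((continuous_of_lipschitz_bound hLG hG).comp_continuousOn hu.cont) hwc hw hW
    refine ((b1.add b2).congr fun t ht => ?_).mono (le_of_eq ?_)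
    · rw [hu.eq t ht]; abel
    · rw [hp, hq]; ring
  have hbound : ∀ (w : ℝ → V) (x : V) (u : ℝ → V), ‖x‖ ≤ R → Continuous w →
      HolderBound β' T W w → MildEq S F G α β T w x u → WBound β T ρ (2 * a) u := by
    intro w x u hxR hwc hw hu
    obtain ⟨U0, hU0⟩ := hu.bound
    refine (hU0.of_zero hT0 hρ0.le).absorb fun U hU => ?_
    have hUn := hU.nonneg hT0
    have c1 := (conv w x u hwc hw hu U hU).wbound hT hδ (by linarith) (by positivity)
    have c2 := (hS.wbound_apply (β := β) (by linarith) (by linarith) T x).of_zero hT0 hρ0.le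
    refine ((c2.add c1).congr fun t _ => by abel).mono ?_
    have := mul_le_mul_of_nonneg_right hρ hUn
    calc _ ≤ R + (p + q * U) * m * T := by linarith
      _ = a + q * T * m * U := by rw [ha]; ring
      _ ≤ a + U / 2 := by linarith
  -- For negative R no initial value qualifies; the case is separated because K ≥ 0 relies on a ≥ 0.
  by_cases hR : 0 ≤ R
  · have ha0 : 0 ≤ a := by positivity
    refine ⟨Real.exp (ρ * T) * (2 * a), (p + q * (2 * a)) * m * Real.exp (ρ * T), by positivity, ?_⟩
    intro w x u hxR hwc hw hu
    have hb := hbound w x u hxR hwc hw hu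
    exact ⟨hb.to_zero hT0 hρ0.le, (conv w x u hwc hw hu _ hb).to_zero hρ0.le (by positivity)⟩
  · exact ⟨0, 0, le_rfl, fun w x u hxR => absurd ((norm_nonneg x).trans hxR) hR⟩

end Apriori

/-! ### Compactness and passage to the limit -/

section Compactness

variable {V : Type*} [NormedAddCommGroup V] [InnerProductSpace ℝ V]
  {S : ℝ → V →L[ℝ] V} {α β β' δ T : ℝ}

/-- Removes the weight at zero. If t - s ≤ s, the factor (t-s)^β is at most s^β and cancels it.
Otherwise s and t are both at most 2(t-s), and the decay at zero bounds the two values separately.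
-/
theorem ConvBound.norm_sub_le {K : ℝ} {v : ℝ → V} (hδ : 0 < δ) (hδ1 : δ ≤ 1) (hβ : 0 ≤ β)
    (hK : 0 ≤ K) (h : ConvBound S β δ T 0 K v) {s t : ℝ} (hs : 0 ≤ s) (hst : s ≤ t)
    (ht : t ≤ T) : ‖v t - v s‖ ≤ 4 * K * (t - s) ^ δ := by
  rcases hst.eq_or_lt with rfl | hst
  · simp [Real.zero_rpow hδ.ne']
  have hts : 0 < t - s := sub_pos.2 hst
  have hp := Real.rpow_nonneg hts.le δ
  rcases le_total (t - s) s with hle | hle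
  · have hs0 : 0 < s := hts.trans_le hle
    have h1 := h.incr s t hs0 hst ht
    rw [zero_mul, Real.exp_zero, mul_one, Real.rpow_add hts] at h1
    have h2 : (t - s) ^ β ≤ s ^ β := Real.rpow_le_rpow hts.le hle hβ
    have h3 : 0 < s ^ β := Real.rpow_pos_of_pos hs0 β
    have h4 : s ^ β * ‖v t - v s‖ ≤ s ^ β * (K * (t - s) ^ δ) :=
      calc _ ≤ K * ((t - s) ^ β * (t - s) ^ δ) := h1
        _ ≤ K * (s ^ β * (t - s) ^ δ) := by gcongr
        _ = _ := by ring
    have h5 := le_of_mul_le_mul_left h4 h3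
    have : 0 ≤ K * (t - s) ^ δ := by positivity
    linarith
  · have h1 := h.norm_le t ⟨by linarith, ht⟩
    have h2 := h.norm_le s ⟨hs, by linarith⟩
    rw [zero_mul, Real.exp_zero, mul_one] at h1 h2
    have h3 : s ^ δ ≤ (t - s) ^ δ := Real.rpow_le_rpow hs hle hδ.le
    have h4 : t ^ δ ≤ 2 * (t - s) ^ δ :=
      calc t ^ δ ≤ (2 * (t - s)) ^ δ := Real.rpow_le_rpow (by linarith) (by linarith) hδ.le
        _ = 2 ^ δ * (t - s) ^ δ := Real.mul_rpow zero_le_two hts.le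
        _ ≤ 2 * (t - s) ^ δ := by
            refine mul_le_mul_of_nonneg_right ?_ hp
            calc (2 : ℝ) ^ δ ≤ 2 ^ (1 : ℝ) := Real.rpow_le_rpow_of_exponent_le one_le_two hδ1
              _ = 2 := Real.rpow_one 2
    have h5 := mul_le_mul_of_nonneg_left h3 hK
    have h6 := mul_le_mul_of_nonneg_left h4 hK
    have : 0 ≤ K * (t - s) ^ δ := by positivity
    linarith [_root_.norm_sub_le (v t) (v s)]

/-- For small r all a n are within ε/2 of S(r)(a n), which lie in one compact set. The range is
therefore totally bounded. -/
theorem isCompact_closure_range_of_semigroup [CompleteSpace V] (hS : SmoothingSemigroup S)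
    {a : ℕ → V} {M c κ : ℝ} (hκ : 0 < κ) (hM : ∀ n, ‖a n‖ ≤ M)
    (h : ∀ n r, 0 ≤ r → ‖S r (a n) - a n‖ ≤ c * r ^ κ) : IsCompact (closure (range a)) := by
  refine TotallyBounded.isCompact_of_isClosed (TotallyBounded.closure ?_) isClosed_closure
  rw [Metric.totallyBounded_iff]
  intro ε hε
  obtain ⟨r, hr, hr0⟩ : ∃ r : ℝ, c * r ^ κ < ε / 2 ∧ 0 < r := by
    have hlim : Tendsto (fun r : ℝ => c * r ^ κ) (𝓝[>] 0) (𝓝 0) := by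
      have : ContinuousAt (fun r : ℝ => c * r ^ κ) 0 :=
        continuousAt_const.mul (Real.continuousAt_rpow_const _ _ (Or.inr hκ.le))
      have h2 := this.tendsto
      rw [Real.zero_rpow hκ.ne', mul_zero] at h2
      exact h2.mono_left nhdsWithin_le_nhds
    exact ((hlim.eventually_lt_const (half_pos hε)).and self_mem_nhdsWithin).exists
  obtain ⟨C, hC, hCS⟩ := hS.compact r M hr0
  obtain ⟨t, ht, hCt⟩ := Metric.totallyBounded_iff.1 hC.totallyBounded (ε / 2) (half_pos hε)
  refine ⟨t, ht, ?_⟩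
  rintro _ ⟨n, rfl⟩
  obtain ⟨y, hy, hny⟩ := mem_iUnion₂.1 (hCt (hCS (a n) (hM n)))
  refine mem_iUnion₂.2 ⟨y, hy, ?_⟩
  rw [Metric.mem_ball] at hny ⊢
  have h1 : dist (a n) (S r (a n)) ≤ c * r ^ κ := by
    rw [dist_comm, dist_eq_norm]; exact h n r hr0.le
  linarith [dist_triangle (a n) (S r (a n)) y]

/-- Restriction to `[0, ∞)` of a function as a continuous function. -/
def toContinuousMapNNReal (v : ℝ → V) (h : ContinuousOn v (Ici 0)) : C(ℝ≥0, V) :=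
  ⟨fun t => v t, h.comp_continuous NNReal.continuous_coe fun t => t.2⟩

theorem continuousOn_Ici_of_convBound {K : ℝ → ℝ} {v : ℝ → V} (hδ : 0 < δ) (hδ1 : δ ≤ 1)
    (hβ : 0 ≤ β) (hK : ∀ T, 0 ≤ K T) (h : ∀ T, 1 ≤ T → ConvBound S β δ T 0 (K T) v) :
    ContinuousOn v (Ici 0) := by
  intro s hs
  rw [mem_Ici] at hs
  rw [ContinuousWithinAt, tendsto_iff_norm_sub_tendsto_zero]
  have hlim : Tendsto (fun t : ℝ => 4 * K (s + 1) * |t - s| ^ δ) (𝓝[Ici 0] s) (𝓝 0) := by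
    have h1 : Continuous fun t : ℝ => 4 * K (s + 1) * |t - s| ^ δ :=
      continuous_const.mul ((continuous_abs.comp (continuous_id.sub continuous_const)).rpow_const
        fun _ => Or.inr hδ.le)
    have h2 := (h1.tendsto s).mono_left (nhdsWithin_le_nhds (s := Ici 0))
    simpa [Real.zero_rpow hδ.ne'] using h2
  refine squeeze_zero' (Eventually.of_forall fun t => norm_nonneg _) ?_ hlim
  filter_upwards [self_mem_nhdsWithin, mem_nhdsWithin_of_mem_nhds (gt_mem_nhds (lt_add_one s))]
    with t ht hts
  rw [mem_Ici] at ht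
  rcases le_total s t with hle | hle
  · rw [abs_of_nonneg (sub_nonneg.2 hle)]
    exact (h (s + 1) (by linarith)).norm_sub_le hδ hδ1 hβ (hK _) hs hle hts.le
  · rw [abs_sub_comm, abs_of_nonneg (sub_nonneg.2 hle), norm_sub_rev]
    exact (h (s + 1) (by linarith)).norm_sub_le hδ hδ1 hβ (hK _) ht hle (by linarith)

/-- Arzelà–Ascoli is applied in C([0, ∞), V) with the topology of compact convergence, so one
extraction serves all T and no diagonal sequence is needed. -/
theorem exists_subseq_tendsto_of_convBound [CompleteSpace V] (hS : SmoothingSemigroup S)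
    {K : ℝ → ℝ} {v : ℕ → ℝ → V} (hδ : 0 < δ) (hδ1 : δ ≤ 1) (hβ : 0 ≤ β) (hK : ∀ T, 0 ≤ K T)
    (h : ∀ n T, 1 ≤ T → ConvBound S β δ T 0 (K T) (v n)) :
    ∃ φ : ℕ → ℕ, StrictMono φ ∧ ∃ v₀ : ℝ → V, ∀ T, 0 ≤ T →
      TendstoUniformlyOn (fun n => v (φ n)) v₀ atTop (Icc 0 T) := by
  have hc (n : ℕ) := continuousOn_Ici_of_convBound hδ hδ1 hβ hK (h n)
  set f : ℕ → C(ℝ≥0, V) := fun n => toContinuousMapNNReal (v n) (hc n) with hf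
  have hcov : ⋃₀ {K : Set ℝ≥0 | IsCompact K} = univ :=
    sUnion_eq_univ_iff.2 fun x => ⟨{x}, isCompact_singleton, mem_singleton x⟩
  have := UniformOnFun.t2Space_of_covering (β := V) hcov
  have hcpt : IsCompact (closure (range f)) := by
    refine ArzelaAscoli.isCompact_closure_of_isClosedEmbedding
      (𝔖 := {K : Set ℝ≥0 | IsCompact K}) (F := fun g : C(ℝ≥0, V) => (g : ℝ≥0 → V))
      (fun K hK => hK)
      ContinuousMap.isUniformEmbedding_toUniformOnFunIsCompact.isClosedEmbedding ?_ ?_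
    · intro C _ s _
      refine EquicontinuousAt.equicontinuousWithinAt ?_ _
      rw [Metric.equicontinuousAt_iff]
      intro ε hε
      have hlim : Tendsto (fun r : ℝ => 4 * K (s + 1) * r ^ δ) (𝓝 0) (𝓝 0) := by
        have : ContinuousAt (fun r : ℝ => 4 * K (s + 1) * r ^ δ) 0 :=
          continuousAt_const.mul (Real.continuousAt_rpow_const _ _ (Or.inr hδ.le))
        have h2 := this.tendsto
        rwa [Real.zero_rpow hδ.ne', mul_zero] at h2
      obtain ⟨η, hη, hη2⟩ := Metric.eventually_nhds_iff.1 (hlim.eventually_lt_const hε)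
      refine ⟨min η 1, lt_min hη one_pos, ?_⟩
      rintro t ht ⟨_, n, rfl⟩
      have hts : |(t : ℝ) - s| < min η 1 := by
        rw [← NNReal.dist_eq]; exact ht
      have hts1 := abs_lt.1 (hts.trans_le (min_le_right _ _))
      have hsm := hη2 (y := |(t : ℝ) - s|) (by
        rw [Real.dist_eq, sub_zero, abs_abs]; exact hts.trans_le (min_le_left _ _))
      rw [dist_comm, dist_eq_norm]
      refine lt_of_le_of_lt ?_ hsm
      change ‖v n t - v n s‖ ≤ _
      have hb := h n (s + 1) (by linarith [s.2])
      rcases le_total (s : ℝ) t with hle | hle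
      · rw [abs_of_nonneg (sub_nonneg.2 hle)]
        exact hb.norm_sub_le hδ hδ1 hβ (hK _) s.2 hle (by linarith)
      · rw [abs_sub_comm, abs_of_nonneg (sub_nonneg.2 hle), norm_sub_rev]
        exact hb.norm_sub_le hδ hδ1 hβ (hK _) t.2 hle (by linarith)
    · intro C _ t _
      have hb (n : ℕ) := h n (t + 1) (by linarith [t.2])
      have hcl : IsCompact (closure (range fun n => v n t)) := by
        -- At time zero the regularisation bound is not available, but all functions vanish there.
        rcases t.2.eq_or_lt with h0 | h0
        · have hz (n : ℕ) : v n t = 0 := by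
            have h1 := (hb n).norm_le t ⟨t.2, by linarith⟩
            have h2 : (t : ℝ) = 0 := h0.symm
            rw [h2, Real.zero_rpow hδ.ne', mul_zero] at h1
            rw [h2]
            exact norm_le_zero_iff.1 h1
          simp [hz]
        · refine isCompact_closure_range_of_semigroup hS (M := K (t + 1) * (t : ℝ) ^ δ)
            (c := K (t + 1) * ((t : ℝ) ^ β)⁻¹) (κ := β + δ) (by linarith) (fun n => ?_)
            (fun n r hr => ?_)
          · have h1 := (hb n).norm_le t ⟨t.2, by linarith⟩
            rwa [zero_mul, Real.exp_zero, mul_one] at h1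
          · have h1 := (hb n).regular t ⟨h0, by linarith⟩ r hr
            rw [zero_mul, Real.exp_zero, mul_one] at h1
            have h2 : 0 < (t : ℝ) ^ β := Real.rpow_pos_of_pos h0 β
            calc ‖S r (v n t) - v n t‖ =
                ((t : ℝ) ^ β)⁻¹ * ((t : ℝ) ^ β * ‖S r (v n t) - v n t‖) := by
                  rw [← mul_assoc, inv_mul_cancel₀ h2.ne', one_mul]
              _ ≤ ((t : ℝ) ^ β)⁻¹ * (K (t + 1) * r ^ (β + δ)) :=
                  mul_le_mul_of_nonneg_left h1 (inv_nonneg.2 h2.le)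
              _ = _ := by ring
      refine ⟨_, hcl, ?_⟩
      rintro _ ⟨n, rfl⟩
      exact subset_closure ⟨n, rfl⟩
  obtain ⟨g, -, φ, hφ, hlim⟩ := hcpt.isSeqCompact fun n => subset_closure (mem_range_self n)
  refine ⟨φ, hφ, fun t => g t.toNNReal, fun T hT => ?_⟩
  have h1 := ContinuousMap.tendsto_iff_forall_isCompact_tendstoUniformlyOn.1 hlim
    (Icc 0 T.toNNReal) isCompact_Icc
  rw [Metric.tendstoUniformlyOn_iff] at h1 ⊢
  intro ε hε
  filter_upwards [h1 ε hε] with n hn t ht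
  have h2 := hn t.toNNReal ⟨bot_le, Real.toNNReal_le_toNNReal ht.2⟩
  convert h2 using 2
  change v (φ n) t = v (φ n) (t.toNNReal : ℝ)
  rw [Real.coe_toNNReal t ht.1]

end Compactness

/-! ### Passage to the limit in the convolutions, and interpolation. -/

section Limit

variable {V : Type*} [NormedAddCommGroup V] [InnerProductSpace ℝ V]
  {S : ℝ → V →L[ℝ] V} {α β β' δ T : ℝ}

theorem tendsto_detConv (hS : SmoothingSemigroup S) {f : ℕ → ℝ → V} {g : ℝ → V} {M t : ℝ}
    (ht : t ∈ Icc 0 T) (hf : ∀ n, ContinuousOn (f n) (Icc 0 T))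
    (hM : ∀ n, ∀ r ∈ Icc 0 T, ‖f n r‖ ≤ M)
    (hlim : ∀ r ∈ Icc 0 T, Tendsto (fun n => f n r) atTop (𝓝 (g r))) :
    Tendsto (fun n => detConv S (f n) t) atTop (𝓝 (detConv S g t)) := by
  refine intervalIntegral.tendsto_integral_filter_of_dominated_convergence (fun _ => M) ?_ ?_
    intervalIntegrable_const ?_
  · refine Eventually.of_forall fun n => ?_
    rw [uIoc_of_le ht.1, ← restrict_Ioo_eq_restrict_Ioc]
    exact aestronglyMeasurable_detConv hS ht.2 (hf n)
  · refine Eventually.of_forall fun n => ae_of_all _ fun r hr => ?_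
    rw [uIoc_of_le ht.1] at hr
    exact (hS.norm_apply_le (by linarith [hr.2]) _).trans (hM n r ⟨hr.1.le, hr.2.trans ht.2⟩)
  · refine ae_of_all _ fun r hr => ?_
    rw [uIoc_of_le ht.1] at hr
    exact ((S (t - r)).continuous.tendsto _).comp (hlim r ⟨hr.1.le, hr.2.trans ht.2⟩)

theorem tendsto_leftD {X : Type*} [NormedAddCommGroup X] [NormedSpace ℝ X] {A r t : ℝ}
    {f : ℕ → ℝ → X} {g : ℝ → X} (hβ : β < 1) (hδ : 0 < δ) (hr : r ∈ Ioo 0 t)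
    (hf : ∀ n, ContinuousOn (f n) (Ioo 0 t)) (hA : ∀ n, LeftBound α β δ A (f n) r)
    (hlim : ∀ q ∈ Ioc 0 r, Tendsto (fun n => f n q) atTop (𝓝 (g q))) :
    Tendsto (fun n => leftD α (f n) r) atTop (𝓝 (leftD α g r)) := by
  have hr' := hlim r ⟨hr.1, le_rfl⟩
  refine ((hr'.const_smul _).add (Tendsto.const_smul ?_ _)).const_smul _
  refine intervalIntegral.tendsto_integral_filter_of_dominated_convergence
    (fun q => A * (q ^ ((1 - β) - 1) * (r - q) ^ (δ - 1))) ?_ ?_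
    ((intervalIntegrable_beta (by linarith) hδ hr.1.le).const_mul A) ?_
  · refine Eventually.of_forall fun n => ?_
    rw [uIoc_of_le hr.1.le]
    exact (intervalIntegrable_leftD_integrand hβ hδ (hf n) hr (hA n)).1.aestronglyMeasurable
  · refine Eventually.of_forall fun n => ?_
    filter_upwards [ae_mem_Ioo_of_mem_Ioc 0 r] with q hq hq'
    rw [uIoc_of_le hr.1.le] at hq'
    exact leftD_integrand_le (hA n) (hq hq')
  · refine ae_of_all _ fun q hq => ?_
    rw [uIoc_of_le hr.1.le] at hq
    exact (hr'.sub (hlim q hq)).const_smul _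

theorem tendsto_pathD {X : Type*} [NormedAddCommGroup X] [NormedSpace ℝ X] {W r t γ : ℝ}
    {f : ℕ → ℝ → X} {g : ℝ → X} (hγ : 1 - α < γ) (hr : r ∈ Ioo 0 t) (ht : t ≤ T)
    (hf : ∀ n, Continuous (f n)) (hW : ∀ n, HolderBound γ T W (f n))
    (hlim : ∀ q ∈ Icc 0 T, Tendsto (fun n => f n q) atTop (𝓝 (g q))) :
    Tendsto (fun n => pathD α t (f n) r) atTop (𝓝 (pathD α t g r)) := by
  have hr' := hlim r ⟨hr.1.le, hr.2.le.trans ht⟩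
  have ht' := hlim t ⟨hr.1.le.trans hr.2.le, ht⟩
  unfold pathD rightD
  refine (((hr'.sub ht').const_smul _).add (Tendsto.const_smul ?_ _)).const_smul _
  simp only [sub_sub_sub_cancel_right]
  refine intervalIntegral.tendsto_integral_filter_of_dominated_convergence
    (fun q => W * (q - r) ^ ((γ + α - 1) - 1)) ?_ ?_
    ((intervalIntegrable_rpow_sub (by linarith) r).const_mul W) ?_
  · refine Eventually.of_forall fun n => ?_
    rw [uIoc_of_le hr.2.le]
    exact (intervalIntegrable_rightD_integrand hγ (hf n) (hW n) hr.1.le le_rfl hr.2.le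
      ht).1.aestronglyMeasurable
  · refine Eventually.of_forall fun n => ?_
    filter_upwards [ae_mem_Ioo_of_mem_Ioc r t] with q hq hq'
    rw [uIoc_of_le hr.2.le] at hq'
    exact rightD_integrand_le (hW n) hr.1.le ht (hq hq')
  · refine ae_of_all _ fun q hq => ?_
    rw [uIoc_of_le hr.2.le] at hq
    exact (hr'.sub (hlim q ⟨hr.1.le.trans hq.1.le, hq.2.trans ht⟩)).const_smul _

/-- Dominated convergence is used at two levels: inside both fractional derivatives, and in the
outer integral. All majorants come from the uniform bounds, so pointwise convergence of Γ and w
suffices. -/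
theorem tendsto_youngConv (hx : Exponents α β β' δ) (hS : SmoothingSemigroup S) (hT : 1 ≤ T)
    {ρ Q W t : ℝ} {Γ : ℕ → ℝ → V →L[ℝ] V} {Γ₀ : ℝ → V →L[ℝ] V} {w : ℕ → ℝ → V} {w₀ : ℝ → V}
    (hρ : 0 < ρ) (ht : t ∈ Icc 0 T) (hΓ : ∀ n, WBound β T ρ Q (Γ n))
    (hΓc : ∀ n, ContinuousOn (Γ n) (Icc 0 T)) (hwc : ∀ n, Continuous (w n))
    (hw : ∀ n, HolderBound β' T W (w n)) (hW : 0 ≤ W)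
    (hΓlim : ∀ r ∈ Icc 0 T, Tendsto (fun n => Γ n r) atTop (𝓝 (Γ₀ r)))
    (hwlim : ∀ r ∈ Icc 0 T, Tendsto (fun n => w n r) atTop (𝓝 (w₀ r))) :
    Tendsto (fun n => youngConv S α (Γ n) (w n) t) atTop (𝓝 (youngConv S α Γ₀ w₀ t)) := by
  obtain ⟨hδ, hδα, hαβ, hββ, hβ1, hα1⟩ := id hx
  have hd (n : ℕ) := convData_semigroup hx hS hT hρ ht.1 ht.2 (hΓ n) (hΓc n) (hwc n) (hw n) hW
  have hκ : (0 : ℝ) ≤ β + δ := by linarith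
  refine Tendsto.neg (intervalIntegral.tendsto_integral_filter_of_dominated_convergence
    (fun r => ConvData.const α β β' δ T ρ Q W 1 t *
      (r ^ ((1 - β) - 1) * (t - r) ^ ((β' - 0 - 2 * δ) - 1))) ?_ ?_
    ((hd 0).integrable_bound hκ) ?_)
  · refine Eventually.of_forall fun n => ?_
    rw [uIoc_of_le ht.1]
    exact ((hd n).integrable hκ).1.aestronglyMeasurable
  · refine Eventually.of_forall fun n => ?_
    filter_upwards [ae_mem_Ioo_of_mem_Ioc 0 t] with r hr hr'
    rw [uIoc_of_le ht.1] at hr'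
    exact (ContinuousLinearMap.le_opNorm _ _).trans ((hd n).integrand_le (hr hr'))
  · filter_upwards [ae_mem_Ioo_of_mem_Ioc 0 t] with r hr hr'
    rw [uIoc_of_le ht.1] at hr'
    have hr0 := hr hr'
    have h1 := tendsto_leftD (α := α) (δ := δ) (by linarith : β < 1) hδ hr0
      (fun n => (hd n).continuousOn_comp) (fun n => (hd n).leftBound hr0)
      (g := fun q => (S (t - q)).comp (Γ₀ q)) fun q hq =>
        ((ContinuousLinearMap.compL ℝ V V V (S (t - q))).continuous.tendsto _).comp
          (hΓlim q ⟨hq.1.le, by linarith [hq.2, hr0.2, ht.2]⟩)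
    exact (isBoundedBilinearMap_apply.continuous.tendsto _).comp
      (h1.prodMk_nhds (tendsto_pathD hα1 hr0 ht.2 hwc hw hwlim))

/-- The geometric mean of the two bounds with weights β/(β+δ) and δ/(β+δ), chosen so that exactly
τ^β survives. -/
theorem interpolation_le {a A B τ : ℝ} (hβ : 0 ≤ β) (hδ : 0 < δ) (ha : 0 ≤ a) (hA : 0 ≤ A)
    (hτ : 0 ≤ τ) (h1 : a ≤ A * τ ^ (β + δ)) (h2 : a ≤ B) :
    a ≤ A ^ (β / (β + δ)) * B ^ (δ / (β + δ)) * τ ^ β := by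
  have hs : 0 < β + δ := by linarith
  have e0 : β / (β + δ) + δ / (β + δ) = 1 := by field_simp
  have hθ : 0 ≤ β / (β + δ) := by positivity
  have hθ' : 0 ≤ δ / (β + δ) := by positivity
  have e1 : (τ ^ (β + δ)) ^ (β / (β + δ)) = τ ^ β := by
    rw [← Real.rpow_mul hτ]; congr 1; field_simp
  calc a = a ^ (β / (β + δ)) * a ^ (δ / (β + δ)) := by
        rw [← Real.rpow_add_of_nonneg ha hθ hθ', e0, Real.rpow_one]
    _ ≤ (A * τ ^ (β + δ)) ^ (β / (β + δ)) * B ^ (δ / (β + δ)) :=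
        mul_le_mul (Real.rpow_le_rpow ha h1 hθ) (Real.rpow_le_rpow ha h2 hθ')
          (Real.rpow_nonneg ha _) (Real.rpow_nonneg (ha.trans h1) _)
    _ = _ := by
        rw [Real.mul_rpow hA (Real.rpow_nonneg hτ _), e1]; ring

theorem ConvBound.wbound_sub {K ε : ℝ} {v v' : ℝ → V} (hT : 1 ≤ T) (hδ : 0 < δ) (hβ : 0 ≤ β)
    (hβ1 : β ≤ 1) (hK : 0 ≤ K) (h : ConvBound S β δ T 0 K v) (h' : ConvBound S β δ T 0 K v')
    (hε : ∀ t ∈ Icc 0 T, ‖v t - v' t‖ ≤ ε) :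
    WBound β T 0 (ε + (2 * K) ^ (β / (β + δ)) * (T * (2 * ε)) ^ (δ / (β + δ)))
      (fun t => v t - v' t) := by
  have hε0 : 0 ≤ ε := (norm_nonneg _).trans (hε 0 ⟨le_rfl, by linarith⟩)
  have hc : 0 ≤ (2 * K) ^ (β / (β + δ)) * (T * (2 * ε)) ^ (δ / (β + δ)) := by positivity
  refine ⟨fun t ht => ?_, fun s t hs hst ht => ?_⟩
  · rw [zero_mul, Real.exp_zero, one_mul]
    linarith [hε t ht]
  · rw [zero_mul, Real.exp_zero, one_mul]
    have hts := sub_nonneg.2 hst.le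
    have hsβ := Real.rpow_nonneg hs.le β
    have h1 := h.incr s t hs hst ht
    have h2 := h'.incr s t hs hst ht
    rw [zero_mul, Real.exp_zero, mul_one] at h1 h2
    have h3 := hε t ⟨by linarith, ht⟩
    have h4 := hε s ⟨hs.le, by linarith⟩
    have h5 := rpow_le_of_le_one hs.le (by linarith : s ≤ T) hT hβ hβ1
    have e : v t - v' t - (v s - v' s) = (v t - v s) - (v' t - v' s) := by abel
    have b1 : s ^ β * ‖v t - v' t - (v s - v' s)‖ ≤ 2 * K * (t - s) ^ (β + δ) := by
      rw [e]
      calc _ ≤ s ^ β * (‖v t - v s‖ + ‖v' t - v' s‖) :=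
            mul_le_mul_of_nonneg_left (_root_.norm_sub_le _ _) hsβ
        _ ≤ _ := by linarith
    have b2 : s ^ β * ‖v t - v' t - (v s - v' s)‖ ≤ T * (2 * ε) :=
      mul_le_mul h5 ((_root_.norm_sub_le _ _).trans (by linarith)) (norm_nonneg _) (by linarith)
    refine (interpolation_le hβ hδ (mul_nonneg hsβ (norm_nonneg _)) (by linarith) hts b1 b2).trans ?_
    exact mul_le_mul_of_nonneg_right (by linarith) (Real.rpow_nonneg hts _)

theorem ConvBound.of_tendsto {K : ℝ} {v : ℕ → ℝ → V} {v₀ : ℝ → V}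
    (h : ∀ n, ConvBound S β δ T 0 K (v n))
    (hlim : ∀ t ∈ Icc 0 T, Tendsto (fun n => v n t) atTop (𝓝 (v₀ t))) :
    ConvBound S β δ T 0 K v₀ where
  norm_le t ht := le_of_tendsto' (hlim t ht).norm fun n => (h n).norm_le t ht
  regular s hs r hr := by
    have h1 := hlim s ⟨hs.1.le, hs.2⟩
    exact le_of_tendsto' (((((S r).continuous.tendsto _).comp h1).sub h1).norm.const_mul _)
      fun n => (h n).regular s hs r hr
  incr s t hs hst ht := by
    have h1 := hlim s ⟨hs.le, by linarith⟩
    have h2 := hlim t ⟨by linarith, ht⟩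
    exact le_of_tendsto' ((h2.sub h1).norm.const_mul _) fun n => (h n).incr s t hs hst ht

end Limit

/-! ### Mild solutions and their limits -/

section HilbertSchmidt

variable {V : Type*} [NormedAddCommGroup V] [InnerProductSpace ℝ V] {ι : Type*}

/-- Cauchy–Schwarz on the basis expansion. Through it the Lipschitz condition on G becomes one in
operator norm, the only norm used in the estimates. -/
theorem IsHilbertSchmidt.norm_le {e : HilbertBasis ι ℝ V} {T : V →L[ℝ] V}
    (hT : IsHilbertSchmidt e T) : ‖T‖ ≤ hilbertSchmidtNorm e T := by
  refine T.opNorm_le_bound (Real.sqrt_nonneg _) fun v => ?_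
  have h := ((e.hasSum_repr v).mapL T).norm
  refine le_of_tendsto' h fun s => ?_
  have h1 : Real.sqrt (∑ i ∈ s, ‖⟪e i, v⟫_ℝ‖ ^ 2) ≤ ‖v‖ :=
    Real.sqrt_le_iff.2 ⟨norm_nonneg _, e.orthonormal.sum_inner_products_le (x := v) (s := s)⟩
  have h2 : Real.sqrt (∑ i ∈ s, ‖T (e i)‖ ^ 2) ≤ hilbertSchmidtNorm e T :=
    Real.sqrt_le_sqrt (hT.sum_le_tsum s fun i _ => by positivity)
  calc ‖∑ i ∈ s, T (e.repr v i • e i)‖ ≤ ∑ i ∈ s, ‖T (e i)‖ * ‖⟪e i, v⟫_ℝ‖ := by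
        refine norm_sum_le_of_le s fun i _ => ?_
        rw [map_smul, norm_smul, e.repr_apply_apply, mul_comm]
    _ ≤ Real.sqrt (∑ i ∈ s, ‖T (e i)‖ ^ 2) * Real.sqrt (∑ i ∈ s, ‖⟪e i, v⟫_ℝ‖ ^ 2) :=
        Real.sum_mul_le_sqrt_mul_sqrt s _ _
    _ ≤ _ := mul_le_mul h2 h1 (Real.sqrt_nonneg _) (Real.sqrt_nonneg _)

theorem IsHilbertSchmidt.sub {e : HilbertBasis ι ℝ V} {T T' : V →L[ℝ] V}
    (hT : IsHilbertSchmidt e T) (hT' : IsHilbertSchmidt e T') : IsHilbertSchmidt e (T - T') := by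
  refine Summable.of_nonneg_of_le (fun i => by positivity) (fun i => ?_)
    ((hT.add hT').mul_left 2)
  have h := norm_sub_le (T (e i)) (T' (e i))
  rw [sub_apply]
  nlinarith [sq_nonneg (‖T (e i)‖ - ‖T' (e i)‖), norm_nonneg (T (e i) - T' (e i))]

end HilbertSchmidt

section MildSolutions

variable {V : Type*} [NormedAddCommGroup V] [InnerProductSpace ℝ V] {ι : Type*}
  {S : ℝ → V →L[ℝ] V} {α β β' δ T : ℝ}

theorem exists_exponents (hββ' : β < β') (hβ' : β' < 1) (hα : 1 - β' < α) (hαβ : α < β) :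
    ∃ δ, Exponents α β β' δ := by
  have h0 : 0 < α := by linarith
  obtain ⟨δ, hδ0, hδ⟩ := exists_between
    (show 0 < min α (min ((β - α) / 2) ((β' - β) / 4)) from
      lt_min h0 (lt_min (by linarith) (by linarith)))
  rw [lt_min_iff, lt_min_iff] at hδ
  exact ⟨δ, hδ0, hδ.1.le, by linarith [hδ.2.1], by linarith [hδ.2.2], hβ', by linarith⟩

theorem WBound.restrict {X : Type*} [NormedAddCommGroup X] {T' ρ U : ℝ} {f : ℝ → X}
    (hf : WBound β T ρ U f) (h : T' ≤ T) : WBound β T' ρ U f :=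
  ⟨fun t ht => hf.1 t ⟨ht.1, ht.2.trans h⟩, fun s t hs hst ht => hf.2 s t hs hst (ht.trans h)⟩

variable [CompleteSpace V] [TopologicalSpace.SeparableSpace V]

theorem pathIntegral_eq_youngConv (e : HilbertBasis ι ℝ V) (hx : Exponents α β β' δ)
    (hS : SmoothingSemigroup S) (hT : 1 ≤ T) {Q W t : ℝ} {Γ : ℝ → V →L[ℝ] V} {w : ℝ → V}
    (ht : t ∈ Icc 0 T) (hΓ : WBound β T 0 Q Γ) (hΓc : ContinuousOn Γ (Icc 0 T))
    (hwc : Continuous w) (hw : HolderBound β' T W w) (hW : 0 ≤ W) :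
    pathIntegral e α 0 t (fun r => (S (t - r)).comp (Γ r)) w = youngConv S α Γ w t := by
  have hd := convData_semigroup hx hS hT one_pos ht.1 ht.2
    (hΓ.of_zero (by linarith) zero_le_one) hΓc hwc hw hW
  have hκ : (0 : ℝ) ≤ β + δ := by linarith [hx.pos, hx.alpha_beta, hx.le_alpha]
  exact pathIntegral_eq_fracIntegral e ht.1 ht.2 hx.alpha_gt hwc hw hd.continuousOn_comp
    (fun r hr => hd.inner_integrable hr) (hd.integrable_bound hκ) fun r hr => hd.integrand_le hr

variable {F : V → V} {G : V → V →L[ℝ] V} {LG : ℝ}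

theorem IsMildSolution.mildEq {e : HilbertBasis ι ℝ V} (hx : Exponents α β β' δ)
    (hS : SmoothingSemigroup S) (hT : 1 ≤ T) (hLG : 0 ≤ LG)
    (hG : ∀ x y, ‖G x - G y‖ ≤ LG * ‖x - y‖) {w : ℝ → V} {x : V} {u : ℝ → V}
    (hw : w ∈ pathSpace V β') (hu : IsMildSolution S e F G α β T w x u) :
    MildEq S F G α β T w x u := by
  obtain ⟨W, hW, hwb⟩ := exists_holderBound_of_mem_pathSpace hw T
  have hb := WBound.of_weightedHolderNorm hu.1.2.ne
  refine ⟨hu.1.1, ⟨_, hb⟩, fun t ht => ?_⟩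
  rw [hu.2 t ht, pathIntegral_eq_youngConv e hx hS hT ht
    (hb.comp_lipschitz (by linarith) le_rfl hLG hG)
    ((continuous_of_lipschitz_bound hLG hG).comp_continuousOn hu.1.1) hw.1 hwb hW]
  rfl

/-- The estimates need T ≥ 1, whereas solutions are tested on every interval; hence the passage to a
shorter horizon T'. -/
theorem MildEq.isMildSolution (e : HilbertBasis ι ℝ V) (hx : Exponents α β β' δ)
    (hS : SmoothingSemigroup S) (hT : 1 ≤ T) (hLG : 0 ≤ LG)
    (hG : ∀ x y, ‖G x - G y‖ ≤ LG * ‖x - y‖) {w : ℝ → V} {x : V} {u : ℝ → V}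
    (hw : w ∈ pathSpace V β') (hu : MildEq S F G α β T w x u) {T' : ℝ} (hTT : T' ≤ T) :
    IsMildSolution S e F G α β T' w x u := by
  obtain ⟨W, hW, hwb⟩ := exists_holderBound_of_mem_pathSpace hw T
  obtain ⟨U, hb⟩ := hu.bound
  refine ⟨⟨hu.cont.mono (Icc_subset_Icc_right hTT), (hb.restrict hTT).weightedHolderNorm_le.trans_lt
    (ENNReal.add_lt_top.2 ⟨ENNReal.ofReal_lt_top, ENNReal.ofReal_lt_top⟩)⟩, fun t ht => ?_⟩
  have ht' : t ∈ Icc 0 T := ⟨ht.1, ht.2.trans hTT⟩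
  rw [hu.eq t ht', pathIntegral_eq_youngConv e hx hS hT ht'
    (hb.comp_lipschitz (by linarith) le_rfl hLG hG)
    ((continuous_of_lipschitz_bound hLG hG).comp_continuousOn hu.cont) hw.1 hwb hW]
  rfl

end MildSolutions

/-! ### Consequences of convergence of the driving paths. -/

section PathConvergence

variable {X : Type*} [NormedAddCommGroup X]

theorem HolderBound.add {γ T W W' : ℝ} {f g : ℝ → X} (hf : HolderBound γ T W f)
    (hg : HolderBound γ T W' g) : HolderBound γ T (W + W') (fun t => f t + g t) := by
  intro s t hs hst ht
  rw [add_sub_add_comm, add_mul]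
  exact (norm_add_le _ _).trans (add_le_add (hf s t hs hst ht) (hg s t hs hst ht))

/-- From some index on the paths differ from the limit by Hölder norm at most one. The finitely many
earlier constants are bounded by their sum. -/
theorem exists_uniform_holderBound [NormedSpace ℝ X] {γ T : ℝ} {w : ℕ → ℝ → X} {w₀ : ℝ → X}
    (hw : ∀ n, w n ∈ pathSpace X γ) (hw₀ : w₀ ∈ pathSpace X γ)
    (h : Tendsto (fun n => holderNorm γ 0 T (fun s => w n s - w₀ s)) atTop (𝓝 0)) :
    ∃ W, 0 ≤ W ∧ ∀ n, HolderBound γ T W (w n) := by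
  obtain ⟨W₀, hW₀, hb₀⟩ := exists_holderBound_of_mem_pathSpace hw₀ T
  choose W hW hb using fun n => exists_holderBound_of_mem_pathSpace (hw n) T
  obtain ⟨N, hN⟩ := eventually_atTop.1 (h.eventually_lt_const one_pos)
  have hsum : 0 ≤ ∑ i ∈ Finset.range N, W i := Finset.sum_nonneg fun i _ => hW i
  refine ⟨W₀ + 1 + ∑ i ∈ Finset.range N, W i, by positivity, fun n => ?_⟩
  rcases lt_or_ge n N with hn | hn
  · refine (hb n).mono le_rfl ?_
    have := Finset.single_le_sum (fun i _ => hW i) (Finset.mem_range.2 hn)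
    linarith
  · have h1 := hN n hn
    have h2 := holderBound_of_holderNorm (h1.trans ENNReal.one_lt_top).ne
    have h3 : (holderNorm γ 0 T (fun s => w n s - w₀ s)).toReal ≤ 1 := by
      simpa using ENNReal.toReal_mono ENNReal.one_ne_top h1.le
    have h4 := hb₀.add (h2.mono le_rfl h3)
    simp only [add_sub_cancel] at h4
    exact h4.mono le_rfl (by linarith)

theorem enorm_sub_le_supNorm {a b t : ℝ} {f g : ℝ → X} (ht : t ∈ Icc a b) :
    edist (f t) (g t) ≤ supNorm a b (fun s => f s - g s) := by
  rw [edist_eq_enorm_sub]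
  exact le_iSup₂ (f := fun s (_ : s ∈ Icc a b) => ‖f s - g s‖ₑ) t ht

theorem tendsto_of_tendsto_holderNorm {γ T : ℝ} {w : ℕ → ℝ → X} {w₀ : ℝ → X}
    (h : Tendsto (fun n => holderNorm γ 0 T (fun s => w n s - w₀ s)) atTop (𝓝 0)) {t : ℝ}
    (ht : t ∈ Icc 0 T) : Tendsto (fun n => w n t) atTop (𝓝 (w₀ t)) := by
  rw [tendsto_iff_edist_tendsto_0]
  exact tendsto_of_tendsto_of_tendsto_of_le_of_le tendsto_const_nhds h (fun _ => bot_le)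
    fun n => (enorm_sub_le_supNorm ht).trans le_self_add

end PathConvergence

/-! ### Convergence of solutions and upper semicontinuity. -/

section MainResults

variable {V : Type*} [NormedAddCommGroup V] [InnerProductSpace ℝ V]
  {ι : Type*} {S : ℝ → V →L[ℝ] V} {α β β' δ : ℝ}
  {F : V → V} {G : V → V →L[ℝ] V} {cF LF LG : ℝ}

/-- The solutions converge uniformly on [0, t₀ + 1], which eventually contains the times t n, and
the limit is continuous at t₀. -/
theorem exists_subseq_tendsto_values {e : HilbertBasis ι ℝ V} {w : ℕ → ℝ → V} {w₀ : ℝ → V}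
    {x : ℕ → V} {x₀ : V}
    (hconv : ∀ u : ℕ → ℝ → V, (∀ n, u n ∈ globalSolutions S e F G α β (x n) (w n)) →
      ∃ φ : ℕ → ℕ, StrictMono φ ∧ ∃ u₀ ∈ globalSolutions S e F G α β x₀ w₀, ∀ T : ℝ, 0 < T →
        Tendsto (fun k => weightedHolderNorm β 0 T (fun s => u (φ k) s - u₀ s)) atTop (𝓝 0))
    {t : ℕ → ℝ≥0} {t₀ : ℝ≥0} {y : ℕ → V} (ht : Tendsto t atTop (𝓝 t₀))
    (hy : ∀ n, y n ∈ solutionMap S e F G α β (t n) (w n) (x n)) :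
    ∃ φ : ℕ → ℕ, StrictMono φ ∧ ∃ y₀ ∈ solutionMap S e F G α β t₀ w₀ x₀,
      Tendsto (fun k => y (φ k)) atTop (𝓝 y₀) := by
  choose u hu huy using hy
  obtain ⟨φ, hφ, u₀, hu₀, hlim⟩ := hconv u hu
  refine ⟨φ, hφ, u₀ t₀, ⟨u₀, hu₀, rfl⟩, ?_⟩
  have hT : (0 : ℝ) < t₀ + 1 := by positivity
  have htφ : Tendsto (fun k => ((t (φ k) : ℝ≥0) : ℝ)) atTop (𝓝 (t₀ : ℝ)) :=
    (NNReal.continuous_coe.tendsto _).comp (ht.comp hφ.tendsto_atTop)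
  have hmem : ∀ᶠ k in atTop, ((t (φ k) : ℝ≥0) : ℝ) ∈ Icc (0 : ℝ) (t₀ + 1) := by
    filter_upwards [htφ.eventually_lt_const (lt_add_one _)] with k hk
    exact ⟨NNReal.coe_nonneg _, hk.le⟩
  have h1 : Tendsto (fun k => u₀ (t (φ k))) atTop (𝓝 (u₀ t₀)) :=
    ((hu₀ _ hT).1.1 t₀ ⟨NNReal.coe_nonneg _, by linarith⟩).tendsto.comp
      (tendsto_nhdsWithin_iff.2 ⟨htφ, hmem⟩)
  have h2 : Tendsto (fun k => edist (y (φ k)) (u₀ (t (φ k)))) atTop (𝓝 0) := by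
    refine tendsto_of_tendsto_of_tendsto_of_le_of_le' tendsto_const_nhds (hlim _ hT)
      (Eventually.of_forall fun _ => bot_le) ?_
    filter_upwards [hmem] with k hk
    rw [← huy]
    exact (enorm_sub_le_supNorm hk).trans le_self_add
  rw [tendsto_iff_edist_tendsto_0] at h1 ⊢
  have h3 := h2.add h1
  rw [add_zero] at h3
  exact tendsto_of_tendsto_of_tendsto_of_le_of_le tendsto_const_nhds h3 (fun _ => bot_le)
    fun k => edist_triangle _ _ _

/-- The norms on [-m, m] increase with m, so a single m and δ describe a basic neighbourhood. If
none works, taking m = n and δ = 1/(n+1) yields convergent data and values outside O, whose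
subsequential limit lies in O by `hconv`; O being open, this is absurd. -/
theorem solutionMap_upperSemicontinuous {e : HilbertBasis ι ℝ V}
    (hconv : ∀ (t : ℕ → ℝ≥0) (t₀ : ℝ≥0) (x : ℕ → V) (x₀ : V) (w : ℕ → ℝ → V) (w₀ : ℝ → V)
      (y : ℕ → V), Tendsto t atTop (𝓝 t₀) → Tendsto x atTop (𝓝 x₀) →
      (∀ n, w n ∈ pathSpace V β') → w₀ ∈ pathSpace V β' →
      (∀ T : ℝ, 0 < T → Tendsto
        (fun n => holderNorm β' 0 T (fun s => w n s - w₀ s)) atTop (𝓝 0)) →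
      (∀ n, y n ∈ solutionMap S e F G α β (t n) (w n) (x n)) →
      ∃ φ : ℕ → ℕ, StrictMono φ ∧ ∃ y₀ ∈ solutionMap S e F G α β t₀ w₀ x₀,
        Tendsto (fun k => y (φ k)) atTop (𝓝 y₀))
    (t₀ : ℝ≥0) (x₀ : V) {w₀ : ℝ → V} (hw₀ : w₀ ∈ pathSpace V β') {O : Set V} (hO : IsOpen O)
    (hsub : solutionMap S e F G α β t₀ w₀ x₀ ⊆ O) :
    ∃ m : ℕ, ∃ δ : ℝ, 0 < δ ∧ ∀ (t : ℝ≥0) (x : V), ∀ w ∈ pathSpace V β',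
      dist t t₀ < δ → dist x x₀ < δ →
      holderNorm β' (-(m : ℝ)) m (fun s => w s - w₀ s) < ENNReal.ofReal δ →
      solutionMap S e F G α β t w x ⊆ O := by
  by_contra! hcon
  choose t x w hw ht hx hwn hnot using fun n : ℕ => hcon n (1 / ((n : ℝ) + 1)) (by positivity)
  choose y hy hyO using fun n => not_subset.1 (hnot n)
  have h0 := tendsto_one_div_add_atTop_nhds_zero_nat (𝕜 := ℝ)
  obtain ⟨φ, -, y₀, hy₀, hlim⟩ := hconv t t₀ x x₀ w w₀ y
    (tendsto_iff_dist_tendsto_zero.2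
      (squeeze_zero (fun _ => dist_nonneg) (fun n => (ht n).le) h0))
    (tendsto_iff_dist_tendsto_zero.2
      (squeeze_zero (fun _ => dist_nonneg) (fun n => (hx n).le) h0)) hw hw₀ (fun T hT => by
      have h1 := ENNReal.tendsto_ofReal h0
      rw [ENNReal.ofReal_zero] at h1
      refine tendsto_of_tendsto_of_tendsto_of_le_of_le' tendsto_const_nhds h1
        (Eventually.of_forall fun _ => bot_le) ?_
      filter_upwards [eventually_ge_atTop ⌈T⌉₊] with n hn
      exact (holderNorm_mono (by simp) (Nat.ceil_le.1 hn) _).trans (hwn n).le) hy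
  obtain ⟨k, hk⟩ := (hlim.eventually_mem (hO.mem_nhds (hsub hy₀))).exists
  exact hyO _ hk

variable [CompleteSpace V] [TopologicalSpace.SeparableSpace V]

theorem exists_subseq_tendsto_solutions (e : HilbertBasis ι ℝ V) (hx : Exponents α β β' δ)
    (hS : SmoothingSemigroup S) (hF : Continuous F) (hcF : 0 ≤ cF) (hLF : 0 ≤ LF)
    (hFg : ∀ v, ‖F v‖ ≤ cF + LF * ‖v‖) (hLG : 0 ≤ LG)
    (hG : ∀ x y, ‖G x - G y‖ ≤ LG * ‖x - y‖)
    {x : ℕ → V} {x₀ : V} {w : ℕ → ℝ → V} {w₀ : ℝ → V} {u : ℕ → ℝ → V}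
    (hxlim : Tendsto x atTop (𝓝 x₀)) (hw : ∀ n, w n ∈ pathSpace V β') (hw₀ : w₀ ∈ pathSpace V β')
    (hwlim : ∀ T : ℝ, 0 < T → Tendsto
      (fun n => holderNorm β' 0 T (fun s => w n s - w₀ s)) atTop (𝓝 0))
    (hu : ∀ n, u n ∈ globalSolutions S e F G α β (x n) (w n)) :
    ∃ φ : ℕ → ℕ, StrictMono φ ∧ ∃ u₀ ∈ globalSolutions S e F G α β x₀ w₀, ∀ T : ℝ, 0 < T →
      Tendsto (fun k => weightedHolderNorm β 0 T (fun s => u (φ k) s - u₀ s)) atTop (𝓝 0) := by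
  obtain ⟨hδ, hδα, hαβ, hββ, hβ1, hα1⟩ := id hx
  have hβ0 : 0 ≤ β := by linarith
  have hGc := continuous_of_lipschitz_bound hLG hG
  obtain ⟨R, hR⟩ : ∃ R, ∀ n, ‖x n‖ ≤ R := by
    obtain ⟨R, hR⟩ := hxlim.norm.bddAbove_range
    exact ⟨R, fun n => hR ⟨n, rfl⟩⟩
  have hmild (n : ℕ) {T : ℝ} (hT : 1 ≤ T) : MildEq S F G α β T (w n) (x n) (u n) :=
    (hu n T (by linarith)).mildEq hx hS hT hLG hG (hw n)
  -- For T < 1 zeros serve as default values, so that the chosen constants are defined and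
  -- nonnegative for every T.
  have hbd : ∀ T : ℝ, ∃ U K W : ℝ, 0 ≤ K ∧ 0 ≤ W ∧ (1 ≤ T → ∀ n, HolderBound β' T W (w n) ∧
      WBound β T 0 U (u n) ∧ ConvBound S β δ T 0 K (fun t => u n t - S t (x n))) := by
    intro T
    by_cases hT : 1 ≤ T
    · obtain ⟨W, hW, hWb⟩ := exists_uniform_holderBound hw hw₀ (hwlim T (by linarith))
      obtain ⟨U, K, hK, hUK⟩ := exists_apriori_bound (R := R) hx hS hT hF hcF hLF hFg hLG hG hW
      exact ⟨U, K, W, hK, hW, fun _ n =>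
        ⟨hWb n, hUK (w n) (x n) (u n) (hR n) (hw n).1 (hWb n) (hmild n hT)⟩⟩
    · exact ⟨0, 0, 0, le_rfl, le_rfl, fun h => absurd h hT⟩
  choose U K W hK hW hall using hbd
  obtain ⟨φ, hφ, v₀, hv₀⟩ := exists_subseq_tendsto_of_convBound (S := S) (β := β) (δ := δ) (K := K)
    (v := fun n t => u n t - S t (x n)) hS hδ (by linarith) hβ0 hK
    fun n T hT => (hall T hT n).2.2
  have hvlim {t : ℝ} (ht : 0 ≤ t) :
      Tendsto (fun n => u (φ n) t - S t (x (φ n))) atTop (𝓝 (v₀ t)) :=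
    (hv₀ t ht).tendsto_at ⟨ht, le_rfl⟩
  have hconv₀ {T : ℝ} (hT : 1 ≤ T) : ConvBound S β δ T 0 (K T) v₀ :=
    ConvBound.of_tendsto (fun n => (hall T hT (φ n)).2.2) fun t ht => hvlim ht.1
  have hxφ : Tendsto (fun n => x (φ n)) atTop (𝓝 x₀) := hxlim.comp hφ.tendsto_atTop
  set u₀ : ℝ → V := fun t => S t x₀ + v₀ t with hu₀
  have hSx (t : ℝ) : Tendsto (fun n => S t (x (φ n))) atTop (𝓝 (S t x₀)) :=
    ((S t).continuous.tendsto _).comp hxφ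
  have hulim {t : ℝ} (ht : 0 ≤ t) : Tendsto (fun n => u (φ n) t) atTop (𝓝 (u₀ t)) := by
    have := (hSx t).add (hvlim ht)
    simpa using this
  have hmild₀ {T : ℝ} (hT : 1 ≤ T) : MildEq S F G α β T w₀ x₀ u₀ := by
    have hT0 : 0 ≤ T := by linarith
    have hb (n : ℕ) := (hall T hT (φ n)).2.1
    have hU := (hb 0).nonneg hT0
    refine ⟨?_, ⟨U T, WBound.of_tendsto tendsto_const_nhds (fun t ht => hulim ht.1) hb⟩,
      fun t ht => ?_⟩
    · exact ((hS.continuousOn_apply x₀).add (continuousOn_Ici_of_convBound hδ (by linarith) hβ0 hK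
        fun T hT => hconv₀ hT)).mono Icc_subset_Ici_self
    · have h1 : Tendsto (fun n => detConv S (fun r => F (u (φ n) r)) t) atTop
          (𝓝 (detConv S (fun r => F (u₀ r)) t)) :=
        tendsto_detConv (M := cF + LF * U T) hS ht
          (fun n => hF.comp_continuousOn (hmild (φ n) hT).cont)
          (fun n r hr => (hFg _).trans (by
            have := (hb n).1 r hr
            rw [zero_mul, Real.exp_zero, one_mul] at this
            gcongr)) fun r hr => (hF.tendsto _).comp (hulim hr.1)
      have h2 : Tendsto (fun n => youngConv S α (fun r => G (u (φ n) r)) (w (φ n)) t) atTop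
          (𝓝 (youngConv S α (fun r => G (u₀ r)) w₀ t)) :=
        tendsto_youngConv hx hS hT one_pos ht
          (fun n => ((hb n).of_zero hT0 zero_le_one).comp_lipschitz hT0 zero_le_one hLG hG)
          (fun n => hGc.comp_continuousOn (hmild (φ n) hT).cont) (fun n => (hw (φ n)).1)
          (fun n => (hall T hT (φ n)).1) (hW T)
          (fun r hr => (hGc.tendsto _).comp (hulim hr.1))
          fun r hr => (tendsto_of_tendsto_holderNorm (hwlim T (by linarith)) hr).comp
            hφ.tendsto_atTop
      refine tendsto_nhds_unique (hulim ht.1) ((((hSx t).add h1).add h2).congr fun n => ?_)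
      exact ((hmild (φ n) hT).eq t ht).symm
  refine ⟨φ, hφ, u₀, fun T hT => (hmild₀ (le_max_right T 1)).isMildSolution e hx hS
    (le_max_right T 1) hLG hG hw₀ (le_max_left T 1), fun T hT => ?_⟩
  set T' := max T 1 with hT'
  have hT1 : 1 ≤ T' := le_max_right T 1
  -- The bound of `ConvBound.wbound_sub`: uniform distance ε between convolution parts controls
  -- their weighted Hölder distance by Ψ ε, which tends to zero with ε.
  set Ψ : ℝ → ℝ := fun ε =>
    ε + (2 * K T') ^ (β / (β + δ)) * (T' * (2 * ε)) ^ (δ / (β + δ)) with hΨ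
  have hθ : 0 < δ / (β + δ) := by positivity
  have hΨlim : Tendsto Ψ (𝓝[>] 0) (𝓝 0) := by
    have hc : Continuous Ψ := continuous_id.add (continuous_const.mul
      ((by fun_prop : Continuous fun ε : ℝ => T' * (2 * ε)).rpow_const fun _ => Or.inr hθ.le))
    have h0 : Ψ 0 = 0 := by simp [hΨ, Real.zero_rpow hθ.ne']
    have := hc.tendsto 0
    rw [h0] at this
    exact this.mono_left nhdsWithin_le_nhds
  rw [ENNReal.tendsto_nhds_zero]
  intro η hη
  -- The tolerance η may be infinite and is replaced by a finite r. The initial values and Ψ ε get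
  -- r/4 each; the sum is doubled when passing to the norm.
  obtain ⟨r, hr0, hrη⟩ := ENNReal.lt_iff_exists_nnreal_btwn.1 hη
  have hr0' : (0 : ℝ) < r := by exact_mod_cast hr0
  obtain ⟨ε, hε, hε0⟩ := ((hΨlim.eventually_lt_const (by positivity : (0 : ℝ) < r / 4)).and
    self_mem_nhdsWithin).exists
  have hx1 := (tendsto_iff_norm_sub_tendsto_zero.1 hxφ).eventually_lt_const
    (by positivity : (0 : ℝ) < r / 4)
  filter_upwards [hx1, (Metric.tendstoUniformlyOn_iff.1 (hv₀ T' (by linarith))) ε hε0]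
    with k hk1 hk2
  have hb1 := ((hall T' hT1 (φ k)).2.2).wbound_sub (ε := ε) hT1 hδ hβ0 (by linarith) (hK T')
    (hconv₀ hT1) fun t ht => by
      have := hk2 t ht
      rw [dist_comm, dist_eq_norm] at this
      exact this.le
  have hb2 := hS.wbound_apply hβ0 (by linarith) T' (x (φ k) - x₀)
  have hb3 := (((hb2.add hb1).congr (g := fun s => u (φ k) s - u₀ s) fun t _ => by
    simp only [hu₀, map_sub]; abel).restrict (le_max_left T 1)).weightedHolderNorm_le
  refine hb3.trans (le_trans ?_ hrη.le)
  have hle : ‖x (φ k) - x₀‖ + Ψ ε ≤ r / 2 := by linarith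
  calc _ ≤ ENNReal.ofReal (r / 2) + ENNReal.ofReal (r / 2) :=
        add_le_add (ENNReal.ofReal_le_ofReal hle) (ENNReal.ofReal_le_ofReal hle)
    _ = r := by
        rw [← ENNReal.ofReal_add (by positivity) (by positivity), add_halves]
        exact ENNReal.ofReal_coe_nnreal

end MainResults

end RoughEvolution

end

theorem mainTheorem6 {V : Type*} [NormedAddCommGroup V] [InnerProductSpace ℝ V]
    [CompleteSpace V] [TopologicalSpace.SeparableSpace V] {ι : Type*}
    (A : V →ₗ.[ℝ] V) (hA : RoughEvolution.IsPositiveWithCompactInverse (-A))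
    (S : ℝ → V →L[ℝ] V) (hS : RoughEvolution.IsSemigroupGeneratedBy A S)
    (e : HilbertBasis ι ℝ V) (he : ∀ i, ∃ μ : ℝ, (e i, μ • e i) ∈ (-A).graph)
    (F : V → V) (hF : Continuous F)
    (hF_growth : ∃ cF LF : ℝ, 0 < cF ∧ 0 < LF ∧ ∀ v, ‖F v‖ ≤ cF + LF * ‖v‖)
    (G : V → V →L[ℝ] V) (hG : ∀ v, RoughEvolution.IsHilbertSchmidt e (G v))
    (hG_lip : ∃ LG : ℝ, ∀ v w,
      RoughEvolution.hilbertSchmidtNorm e (G v - G w) ≤ LG * ‖v - w‖)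
    (α β β' : ℝ) (hβ : 1 / 2 < β) (hββ' : β < β') (hβ' : β' < 1)
    (hα : 1 - β' < α) (hαβ : α < β) :
    -- convergence of solutions
    (∀ (x : ℕ → V) (x₀ : V) (ω : ℕ → ℝ → V) (ω₀ : ℝ → V) (u : ℕ → ℝ → V),
      Tendsto x atTop (𝓝 x₀) →
      (∀ n, ω n ∈ RoughEvolution.pathSpace V β') → ω₀ ∈ RoughEvolution.pathSpace V β' →
      (∀ T : ℝ, 0 < T → Tendsto
        (fun n => RoughEvolution.holderNorm β' 0 T (fun s => ω n s - ω₀ s)) atTop (𝓝 0)) →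
      (∀ n, u n ∈ RoughEvolution.globalSolutions S e F G α β (x n) (ω n)) →
      ∃ φ : ℕ → ℕ, StrictMono φ ∧
        ∃ u₀ ∈ RoughEvolution.globalSolutions S e F G α β x₀ ω₀, ∀ T : ℝ, 0 < T →
          Tendsto (fun k => RoughEvolution.weightedHolderNorm β 0 T
            (fun s => u (φ k) s - u₀ s)) atTop (𝓝 0)) ∧
    -- sequential upper semicontinuity of the solution map
    (∀ (t : ℕ → ℝ≥0) (t₀ : ℝ≥0) (x : ℕ → V) (x₀ : V) (ω : ℕ → ℝ → V) (ω₀ : ℝ → V) (y : ℕ → V),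
      Tendsto t atTop (𝓝 t₀) → Tendsto x atTop (𝓝 x₀) →
      (∀ n, ω n ∈ RoughEvolution.pathSpace V β') → ω₀ ∈ RoughEvolution.pathSpace V β' →
      (∀ T : ℝ, 0 < T → Tendsto
        (fun n => RoughEvolution.holderNorm β' 0 T (fun s => ω n s - ω₀ s)) atTop (𝓝 0)) →
      (∀ n, y n ∈ RoughEvolution.solutionMap S e F G α β (t n) (ω n) (x n)) →
      ∃ φ : ℕ → ℕ, StrictMono φ ∧
        ∃ y₀ ∈ RoughEvolution.solutionMap S e F G α β t₀ ω₀ x₀,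
          Tendsto (fun k => y (φ k)) atTop (𝓝 y₀)) ∧
    -- upper semicontinuity of the solution map in all variables jointly
    (∀ (t₀ : ℝ≥0) (x₀ : V), ∀ ω₀ ∈ RoughEvolution.pathSpace V β', ∀ O : Set V, IsOpen O →
      RoughEvolution.solutionMap S e F G α β t₀ ω₀ x₀ ⊆ O →
      ∃ m : ℕ, ∃ δ : ℝ, 0 < δ ∧ ∀ (t : ℝ≥0) (x : V), ∀ ω ∈ RoughEvolution.pathSpace V β',
        dist t t₀ < δ → dist x x₀ < δ →
        RoughEvolution.holderNorm β' (-(m : ℝ)) m (fun s => ω s - ω₀ s) < ENNReal.ofReal δ →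
        RoughEvolution.solutionMap S e F G α β t ω x ⊆ O) := by
  have hsg := RoughEvolution.smoothingSemigroup_of_generator hA hS e he
  obtain ⟨δ, hx⟩ := RoughEvolution.exists_exponents hββ' hβ' hα hαβ
  obtain ⟨cF, LF, hcF, hLF, hFg⟩ := hF_growth
  obtain ⟨LG, hLG⟩ := hG_lip
  -- The sign of `LG` is not prescribed, hence the absolute value.
  have hGop (v w : V) : ‖G v - G w‖ ≤ |LG| * ‖v - w‖ :=
    ((hG v).sub (hG w)).norm_le.trans ((hLG v w).trans
      (mul_le_mul_of_nonneg_right (le_abs_self LG) (norm_nonneg _)))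
  have h1 := fun (x : ℕ → V) (x₀ : V) (ω : ℕ → ℝ → V) (ω₀ : ℝ → V) (u : ℕ → ℝ → V)
      hxlim hω hω₀ hωlim hu =>
    RoughEvolution.exists_subseq_tendsto_solutions (x := x) (x₀ := x₀) (w := ω) (w₀ := ω₀) (u := u)
      e hx hsg hF hcF.le hLF.le hFg (abs_nonneg LG) hGop hxlim hω hω₀ hωlim hu
  have h2 := fun (t : ℕ → ℝ≥0) (t₀ : ℝ≥0) (x : ℕ → V) (x₀ : V) (ω : ℕ → ℝ → V) (ω₀ : ℝ → V)
      (y : ℕ → V) ht hxlim hω hω₀ hωlim hy =>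
    RoughEvolution.exists_subseq_tendsto_values (t := t) (t₀ := t₀) (y := y)
      (fun u hu => h1 x x₀ ω ω₀ u hxlim hω hω₀ hωlim hu) ht hy
  exact ⟨h1, h2, fun t₀ x₀ ω₀ hω₀ O hO hsub =>
    RoughEvolution.solutionMap_upperSemicontinuous h2 t₀ x₀ hω₀ hO hsub⟩
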